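/- **Lemma 4.2 (Consistency).** *Setting.* Let $\Gamma_0\subset\mathbb R^3$ be a smooth, closed (compact without boundary), connected, oriented hypersurface, $T>0$, and $\Phi:\Gamma_0\times[0,T]\to\mathbb R^3$ a smooth map with $\Phi(\cdot,0)=\mathrm{id}$ such that, for each $t\in[0,T]$, $\Phi(\cdot,t)$ is a diffeomorphism of $\Gamma_0$ onto a surface $\Gamma(t)$ with unit normal $\nu(\cdot,t)$. Put $\overline{S_T}=\bigcup_{t\in[0,T]}\Gamma(t)\times\{t\}$ and $\|f\|_{B(\overline{S_T})}=\sup_{\overline{S_T}}|f|$ (for matrices $|\cdot|$ is the operator norm). For a function $f$ on $\overline{S_T}$ let $\nabla_\Gamma f=(I-\nu\otimes\nu)\nabla\tilde f$ be the tangential gradient ($\tilde f$ any extension of $f(\cdot,t)$), $\nabla_\Gamma^2f$ the matrix of iterated tangential derivatives, and $\partial^\bullet f(\Phi(X,t),t)=\frac{d}{dt}\big(f(\Phi(X,t),t)\big)$ the material derivative, $(\partial^\bullet)^2f=\partial^\bullet(\partial^\bullet f)$. The Hamiltonian $H:\overline{S_T}\times\mathbb R^3\to\mathbb R$ satisfies,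 with constants $L_{H,1},L_{H,2}>0$, $$|H(x,t,p)-H(y,s,p)|\le L_{H,1}(|x-y|+|t-s|)(1+|p|),\qquad |H(x,t,p)-H(x,t,q)|\le L_{H,2}|p-q|$$ for all $(x,t),(y,s)\in\overline{S_T}$ and $p,q\in\mathbb R^3$. *Triangulations.* Let $\Gamma(t)$ be triangulated by a fixed combinatorial closed surface with vertices $1,\dots,M$ at the positions $x_i(t)=\Phi(x_i^0,t)$, $x_i^0\in\Gamma_0$. For every $t\in[0,T]$ the flat triangles $K(t)$ spanned by the vertices are non-degenerate, any two of them meet only in a common face, every point of their union $\Gamma_h(t)$ has a unique closest point on $\Gamma(t)$, and the closest point map $\Gamma_h(t)\to\Gamma(t)$ is a homeomorphism. Let $h$ be the maximum of the diameters $h_{K(t)}$ over all triangles and all $t\in[0,T]$, and assume that $h_{K(t)}\le\gamma\rho_{K(t)}$ for all triangles and all $t\in[0,T]$, where $\rho_{K(t)}$ is the inradius of $K(t)$. Let $\chi_i(\cdot,t)$ be the nodal basis of the continuous, piecewise affine functions on $\Gamma_h(t)$. *Scheme.* Let $0=t^0<\dots<t^N=T$, $\tau^n=t^{n+1}-t^n$,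 $x_i^n=x_i(t^n)$. Let $i_1,\dots,i_{\Upsilon_i}$ be the neighbours of the vertex $i$ in cyclic order, $T_j^{n,i}$ the triangle with vertices $x_i^n,x_{i_j}^n,x_{i_{j+1}}^n$ (indices $j$ modulo $\Upsilon_i$) and $E_j^{n,i}$ its edge from $x_i^n$ to $x_{i_j}^n$. Let $d^{n,i}$ be the minimum over $j$ of the distances from $x_i^n$ to the point at which the inscribed circle of $T_j^{n,i}$ touches $E_j^{n,i}$, and let $V^{n,i}\subset\bigcup_jT_j^{n,i}$ be the polygonal region around $x_i^n$ bounded by the line segments perpendicular to the edges $E_j^{n,i}$ at distance $d^{n,i}$ from $x_i^n$; the parts of the segment perpendicular to $E_j^{n,i}$ that lie in $T_{j-1}^{n,i}$ and in $T_j^{n,i}$ have lengths $h_{j,L}^{n,i}$ and $h_{j,R}^{n,i}$. For $u_h=\sum_iu_i\chi_i(\cdot,t^n)$ put $$[S_h^n(u_h)]_i=u_i-\tau^n\Big\{\sum_{j=1}^{\Upsilon_i}\frac{|V^{n,i}\cap T_j^{n,i}|}{|V^{n,i}|}H\big(x_i^n,t^n,\nabla_{\Gamma_h}u_h|_{T_j^{n,i}}\big)-\frac{\varepsilon_i^n}{|V^{n,i}|}\sum_{j=1}^{\Upsilon_i}\frac{u_{i_j}-u_i}{|E_j^{n,i}|}\big(h_{j,L}^{n,i}+h_{j,R}^{n,i}\big)\Big\},$$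 where $\nabla_{\Gamma_h}u_h|_{T_j^{n,i}}$ is the constant tangential gradient on $T_j^{n,i}$ and $|\cdot|$ of a region is its area. Let $C_0,C_1,C_2>0$. The step-size constraints are, for all $i$, $j$ and $n=0,\dots,N-1$, $$C_0\max_jh_{T_j^{n,i}}\le\varepsilon_i^n\le C_1\max_jh_{T_j^{n,i}},\qquad \tau^n\le C_2|E_j^{n,i}|.\tag{1}$$ For $\varphi\in C^2(\overline{S_T})$ put $\varphi_i^n=\varphi(x_i^n,t^n)$ and $I_h^n\varphi=\sum_i\varphi_i^n\chi_i(\cdot,t^n)$. *Claim.* There is a constant $C_3>0$, depending only on the evolving surface (that is, on $\Gamma_0,\Phi,T$) and on $\gamma$, $L_{H,2}$, $C_0$, $C_1$, $C_2$, such that, for every such Hamiltonian, triangulation, time partition and coefficients $\varepsilon_i^n$ with (1), $$\left|\frac{\varphi_i^{n+1}-[S_h^n(I_h^n\varphi)]_i}{\tau^n}-\big\{\partial^\bullet\varphi(x_i^n,t^n)+H(x_i^n,t^n,\nabla_\Gamma\varphi(x_i^n,t^n))\big\}\right|\le C_3h\left(\|\nabla_\Gamma\varphi\|_{B(\overline{S_T})}+\|\nabla_\Gamma^2\varphi\|_{B(\overline{S_T})}+\|(\partial^\bullet)^2\varphi\|_{B(\overline{S_T})}\right)$$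 for all $\varphi\in C^2(\overline{S_T})$, $n=0,1,\dots,N-1$ and $i=1,\dots,M$. -/

import Mathlib

open Set MeasureTheory
open scoped ContDiff

namespace SurfaceHJ

/-- Euclidean three-space. -/
abbrev E3 := EuclideanSpace ℝ (Fin 3)

/-- The Euclidean plane. -/
abbrev E2 := EuclideanSpace ℝ (Fin 2)

/-- A smooth (embedded, two-dimensional) surface in three-space: near each of its points it is the
image of a smooth immersion of an open subset of the plane which is a homeomorphism onto its image
(`χ` is the continuous inverse). -/
def IsSmoothSurface (S : Set E3) : Prop :=
  ∀ p ∈ S, ∃ (V : Set E3) (U : Set E2) (ψ : E2 → E3) (χ : E3 → E2),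
    IsOpen V ∧ p ∈ V ∧ IsOpen U ∧ ContDiffOn ℝ ∞ ψ U ∧ ψ '' U = S ∩ V ∧
    (∀ u ∈ U, Function.Injective (fderiv ℝ ψ u)) ∧
    ContinuousOn χ (S ∩ V) ∧ ∀ u ∈ U, χ (ψ u) = u

/-- A family of closed, connected, oriented, smooth hypersurfaces `Γ(t) = Φ(Γ₀, t)`, `t ∈ [0, T]`,
given by a smooth flow map `Φ` on `Γ₀ × [0, T]` such that `Φ(·, t)` is a diffeomorphism of `Γ₀` onto
`Γ(t)` and `Φ(·, 0)` is the identity.  The orientation is a continuous unit normal field `ν(·, t)`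
on each `Γ(t)`.  (It may be the outward or the inward one: only `ν ⊗ ν` enters below.)
On the embedded manifolds (with boundary) `Γ₀ × [0, T]` and `Γ(t)`, `ContDiffOn ℝ ∞` is smoothness in
the usual sense. -/
structure EvolvingSurface where
  T : ℝ
  T_pos : 0 < T
  Γ₀ : Set E3
  smooth : IsSmoothSurface Γ₀
  compact : IsCompact Γ₀
  connected : IsConnected Γ₀
  Φ : E3 → ℝ → E3
  Φ_smooth : ContDiffOn ℝ ∞ (fun p : E3 × ℝ => Φ p.1 p.2) (Γ₀ ×ˢ Icc 0 T)
  Φ_zero : ∀ X ∈ Γ₀, Φ X 0 = X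
  Φ_inj : ∀ t ∈ Icc 0 T, InjOn (fun X => Φ X t) Γ₀
  Φ_inv_smooth : ∀ t ∈ Icc 0 T,
    ContDiffOn ℝ ∞ (Function.invFunOn (fun X => Φ X t) Γ₀) ((fun X => Φ X t) '' Γ₀)
  ν : E3 → ℝ → E3
  ν_unit : ∀ t ∈ Icc 0 T, ∀ x ∈ (fun X => Φ X t) '' Γ₀, ‖ν x t‖ = 1
  ν_normal : ∀ t ∈ Icc 0 T, ∀ x ∈ (fun X => Φ X t) '' Γ₀,
    ∀ w ∈ tangentConeAt ℝ ((fun X => Φ X t) '' Γ₀) x, inner ℝ (ν x t) w = 0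
  ν_cont : ∀ t ∈ Icc 0 T, ContinuousOn (fun x => ν x t) ((fun X => Φ X t) '' Γ₀)

namespace EvolvingSurface

variable (S : EvolvingSurface)

/-- The surface `Γ(t)`. -/
def Γ (t : ℝ) : Set E3 := (fun X => S.Φ X t) '' S.Γ₀

/-- The closed space-time surface: the union of `Γ(t) × {t}` over `t ∈ [0, T]`, that is, the closure
of the union of `Γ(t) × {t}` over `t ∈ (0, T)`. -/
def spaceTime : Set (E3 × ℝ) := {p | p.2 ∈ Icc 0 S.T ∧ p.1 ∈ S.Γ p.2}

/-- The projection `I - ν ⊗ ν` onto the tangent plane of `Γ(t)` at `x`. -/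
noncomputable def P (x : E3) (t : ℝ) : E3 →L[ℝ] E3 :=
  ContinuousLinearMap.id ℝ E3 - (innerSL ℝ (S.ν x t)).smulRight (S.ν x t)

/-- The tangential gradient `∇_Γ f (x, t)`: the tangential projection of the gradient at `x` of (any
extension of) `f(·, t)` from `Γ(t)`.  Two derivatives of `f(·, t)` within `Γ(t)` agree on tangent
vectors, so the projection does not depend on the one which `gradientWithin` picks. -/
noncomputable def tangGrad (f : E3 → ℝ → ℝ) (x : E3) (t : ℝ) : E3 :=
  S.P x t (gradientWithin (fun y => f y t) (S.Γ t) x)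

/-- The matrix `∇_Γ² f (x, t)` of second tangential derivatives: the tangential derivative of the
vector field `∇_Γ f (·, t)`. -/
noncomputable def tangHess (f : E3 → ℝ → ℝ) (x : E3) (t : ℝ) : E3 →L[ℝ] E3 :=
  (fderivWithin ℝ (fun y => S.tangGrad f y t) (S.Γ t) x).comp (S.P x t)

/-- The material derivative `∂• f (Φ(X, t), t) = d/dt (f (Φ(X, t), t))`, one-sided at `t = 0` and at
`t = T`. -/
noncomputable def matDeriv (f : E3 → ℝ → ℝ) (x : E3) (t : ℝ) : ℝ :=
  derivWithin (fun s => f (S.Φ (Function.invFunOn (fun X => S.Φ X t) S.Γ₀ x) s) s) (Icc 0 S.T) t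

/-- The supremum norm over the closed space-time surface. -/
noncomputable def supNorm {F : Type*} [NormedAddCommGroup F] (g : E3 → ℝ → F) : ℝ :=
  ⨆ p : S.spaceTime, ‖g p.1.1 p.1.2‖

/-- `φ` is of class `C²` on the closed space-time surface. -/
def IsC2 (φ : E3 → ℝ → ℝ) : Prop :=
  ContDiffOn ℝ 2 (fun p : E3 × ℝ => φ p.1 p.2) S.spaceTime

/-- The Lipschitz conditions on the Hamiltonian `H : (closed space-time surface) × ℝ³ → ℝ`. -/
structure IsHamiltonian (L₁ L₂ : ℝ) (H : E3 → ℝ → E3 → ℝ) : Prop where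
  lip_xt : ∀ x t y s, (x, t) ∈ S.spaceTime → (y, s) ∈ S.spaceTime → ∀ p : E3,
    |H x t p - H y s p| ≤ L₁ * (‖x - y‖ + |t - s|) * (1 + ‖p‖)
  lip_p : ∀ x t, (x, t) ∈ S.spaceTime → ∀ p q : E3, |H x t p - H x t q| ≤ L₂ * ‖p - q‖

end EvolvingSurface

/-- `y` is a closest point of `A` to `x`. -/
def IsClosestPoint (A : Set E3) (x y : E3) : Prop := y ∈ A ∧ dist x y = Metric.infDist x A

/-- The flat triangle with vertices `p`, `q`, `r`. -/
def triangle (p q r : E3) : Set E3 := convexHull ℝ {p, q, r}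

open Classical in
/-- The radius of the inscribed (that is, largest contained) circle of a non-degenerate triangle. -/
noncomputable def triInradius (p q r : E3) : ℝ :=
  if h : AffineIndependent ℝ ![p, q, r] then
    (⟨![p, q, r], h⟩ : Affine.Triangle ℝ E3).inradius
  else 0

open Classical in
/-- The distance from the vertex `p` of a non-degenerate triangle `p q r` to the point at which the
inscribed circle touches the edge `p q` (the edge opposite to `r`). -/
noncomputable def contactLength (p q r : E3) : ℝ :=
  if h : AffineIndependent ℝ ![p, q, r] then
    dist p ((⟨![p, q, r], h⟩ : Affine.Triangle ℝ E3).touchpoint ∅ 2)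
  else 0

/-- The union of the triangles whose vertex sets are the members of `faces`, when the vertex `k` has the
position `pos k`. -/
def polyhedron {M : ℕ} (faces : Finset (Finset (Fin M))) (pos : Fin M → E3) : Set E3 :=
  ⋃ K ∈ faces, convexHull ℝ (pos '' (K : Set (Fin M)))

/-- An evolving triangulation of `Γ(t)`, `t ∈ [0, T]`: a combinatorial closed surface with `M`
vertices, whose vertices start on `Γ(0)` and are transported by the flow. -/
structure Triangulation (S : EvolvingSurface) where
  /-- The number of vertices. -/
  M : ℕ
  /-- The initial positions of the vertices. -/
  x₀ : Fin M → E3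
  x₀_mem : ∀ i, x₀ i ∈ S.Γ₀
  /-- The triangles, as sets of three vertices. -/
  faces : Finset (Finset (Fin M))
  faces_card : ∀ K ∈ faces, K.card = 3
  /-- The number of triangles that have the vertex `i` in common. -/
  Υ : Fin M → ℕ
  three_le : ∀ i, 3 ≤ Υ i
  /-- The neighbours `nbr i 0, nbr i 1, …, nbr i (Υ i - 1)` of `i` in cyclic order, continued
  periodically. -/
  nbr : Fin M → ℕ → Fin M
  nbr_periodic : ∀ i j, nbr i (j + Υ i) = nbr i j
  nbr_inj : ∀ i, InjOn (nbr i) (Iio (Υ i))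
  nbr_ne : ∀ i j, nbr i j ≠ i
  /-- The triangles with vertex `i` are exactly those with vertices `i`, `nbr i j`, `nbr i (j + 1)`. -/
  star : ∀ i K, (K ∈ faces ∧ i ∈ K) ↔ ∃ j, K = {i, nbr i j, nbr i (j + 1)}
  /-- The triangles are not degenerate. -/
  nondegenerate : ∀ t ∈ Icc 0 S.T, ∀ i j, AffineIndependent ℝ
    ![S.Φ (x₀ i) t, S.Φ (x₀ (nbr i j)) t, S.Φ (x₀ (nbr i (j + 1))) t]
  /-- Two triangles meet in their common face (a common edge, a common vertex, or not at all). -/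
  inter : ∀ t ∈ Icc 0 S.T, ∀ K ∈ faces, ∀ L ∈ faces,
    convexHull ℝ ((fun k => S.Φ (x₀ k) t) '' K) ∩ convexHull ℝ ((fun k => S.Φ (x₀ k) t) '' L) =
      convexHull ℝ ((fun k => S.Φ (x₀ k) t) '' ((K ∩ L : Finset (Fin M)) : Set (Fin M)))
  /-- Every point of the polyhedral surface `Γ_h(t)` has a unique closest point on `Γ(t)`, and the
  closest point map is a homeomorphism of `Γ_h(t)` onto `Γ(t)`. -/
  closestPoint : ∀ t ∈ Icc 0 S.T,
    ∃ e : polyhedron faces (fun k => S.Φ (x₀ k) t) ≃ₜ S.Γ t,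
      ∀ (z : polyhedron faces (fun k => S.Φ (x₀ k) t)) (y : E3),
        IsClosestPoint (S.Γ t) z y ↔ y = e z

namespace Triangulation

variable {S : EvolvingSurface} (𝒯 : Triangulation S)

/-- The position `x_i(t) = Φ(x_i⁰, t)` of the vertex `i`. -/
def x (i : Fin 𝒯.M) (t : ℝ) : E3 := S.Φ (𝒯.x₀ i) t

/-- The triangle `T_j` at the vertex `i`, with vertices `i`, `i_j` and `i_{j+1}`. -/
def T (t : ℝ) (i : Fin 𝒯.M) (j : ℕ) : Set E3 :=
  triangle (𝒯.x i t) (𝒯.x (𝒯.nbr i j) t) (𝒯.x (𝒯.nbr i (j + 1)) t)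

/-- The mesh size `h`: the largest diameter of a triangle, over all times in `[0, T]`. -/
noncomputable def meshSize : ℝ :=
  sSup {r | ∃ t ∈ Icc 0 S.T, ∃ i j, r = Metric.diam (𝒯.T t i j)}

/-- Regularity with constant `γ`: the diameter of every triangle is at most `γ` times its inradius. -/
def Regular (γ : ℝ) : Prop :=
  ∀ t ∈ Icc 0 S.T, ∀ i j, Metric.diam (𝒯.T t i j) ≤
    γ * triInradius (𝒯.x i t) (𝒯.x (𝒯.nbr i j) t) (𝒯.x (𝒯.nbr i (j + 1)) t)

/-- `w` are the barycentric coordinates of the point `y` of `Γ_h(t)`, with respect to the vertices of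
a triangle containing `y` (and zero at all other vertices). -/
def IsBary (t : ℝ) (y : E3) (w : Fin 𝒯.M → ℝ) : Prop :=
  (∃ K ∈ 𝒯.faces, ∀ k ∉ K, w k = 0) ∧ (∀ k, 0 ≤ w k) ∧ ∑ k, w k = 1 ∧ ∑ k, w k • 𝒯.x k t = y

open Classical in
/-- The nodal basis function `χ_i(·, t)`: continuous on `Γ_h(t)`, affine on every triangle, equal to
`1` at the vertex `i` and to `0` at all other vertices. -/
noncomputable def χ (i : Fin 𝒯.M) (y : E3) (t : ℝ) : ℝ :=
  if h : ∃ w, 𝒯.IsBary t y w then h.choose i else 0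

/-- The finite element function `∑ u_i χ_i(·, t)` with nodal values `u_i`. -/
noncomputable def fe (u : Fin 𝒯.M → ℝ) (t : ℝ) (y : E3) : ℝ := ∑ i, u i * 𝒯.χ i y t

/-- The (constant) tangential gradient on the triangle `T_j` at `i` of the finite element function
with nodal values `u`: the gradient of (any extension of) its restriction to the triangle, taken at
the vertex `i`, projected orthogonally to the plane of the triangle by `I - ν_h ⊗ ν_h`, where `ν_h` is
the unit normal of the triangle. -/
noncomputable def feGrad (u : Fin 𝒯.M → ℝ) (t : ℝ) (i : Fin 𝒯.M) (j : ℕ) : E3 :=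
  (vectorSpan ℝ {𝒯.x i t, 𝒯.x (𝒯.nbr i j) t, 𝒯.x (𝒯.nbr i (j + 1)) t}).starProjection
    (gradientWithin (𝒯.fe u t) (𝒯.T t i j) (𝒯.x i t))

/-- The length `|E_j|` of the edge from `i` to `i_j`. -/
noncomputable def edgeLen (t : ℝ) (i : Fin 𝒯.M) (j : ℕ) : ℝ :=
  dist (𝒯.x i t) (𝒯.x (𝒯.nbr i j) t)

/-- The unit vector in the direction of the edge `E_j` from `i` to `i_j`. -/
noncomputable def edgeDir (t : ℝ) (i : Fin 𝒯.M) (j : ℕ) : E3 :=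
  (𝒯.edgeLen t i j)⁻¹ • (𝒯.x (𝒯.nbr i j) t - 𝒯.x i t)

/-- The largest diameter of a triangle with vertex `i`. -/
noncomputable def starDiam (t : ℝ) (i : Fin 𝒯.M) : ℝ :=
  ⨆ j : Fin (𝒯.Υ i), Metric.diam (𝒯.T t i j)

/-- The minimum `d` over `j` of the distances from the vertex `i` to the point at which the inscribed
circle of `T_j` touches `E_j`. -/
noncomputable def d (t : ℝ) (i : Fin 𝒯.M) : ℝ :=
  ⨅ j : Fin (𝒯.Υ i),
    contactLength (𝒯.x i t) (𝒯.x (𝒯.nbr i j) t) (𝒯.x (𝒯.nbr i (j + 1)) t)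

/-- The volume around the vertex `i`: the polygonal region of `Γ_h(t)` cut out of the triangles with
vertex `i` by the lines perpendicular to the edges `E_j` at distance `d` from `i`. -/
def V (t : ℝ) (i : Fin 𝒯.M) : Set E3 :=
  ⋃ j : ℕ, {y ∈ 𝒯.T t i j | inner ℝ (y - 𝒯.x i t) (𝒯.edgeDir t i j) ≤ 𝒯.d t i ∧
    inner ℝ (y - 𝒯.x i t) (𝒯.edgeDir t i (j + 1)) ≤ 𝒯.d t i}

/-- The length of the part of the boundary of `V` that is perpendicular to `E_j` and lies in the
triangle `T_k` (a line segment). -/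
noncomputable def sideLen (t : ℝ) (i : Fin 𝒯.M) (j k : ℕ) : ℝ :=
  Metric.diam {y ∈ 𝒯.V t i ∩ 𝒯.T t i k | inner ℝ (y - 𝒯.x i t) (𝒯.edgeDir t i j) = 𝒯.d t i}

/-- The length of the part of the boundary of `V` that is perpendicular to `E_j` and lies in
`T_{j-1}` (indices modulo `Υ i`). -/
noncomputable def hL (t : ℝ) (i : Fin 𝒯.M) (j : ℕ) : ℝ := 𝒯.sideLen t i j (j + 𝒯.Υ i - 1)

/-- The length of the part of the boundary of `V` that is perpendicular to `E_j` and lies in `T_j`. -/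
noncomputable def hR (t : ℝ) (i : Fin 𝒯.M) (j : ℕ) : ℝ := 𝒯.sideLen t i j j

/-- The area: the two-dimensional Hausdorff measure, normalized to agree with Lebesgue measure on
planes. -/
noncomputable def area (A : Set E3) : ℝ := (Measure.euclideanHausdorffMeasure 2 : Measure E3).real A

/-- The numerical Hamiltonian at the vertex `i` and time `t`, with diffusion coefficient `ε`, as a
function of the nodal values `u`. -/
noncomputable def numHam (H : E3 → ℝ → E3 → ℝ) (ε t : ℝ) (u : Fin 𝒯.M → ℝ) (i : Fin 𝒯.M) : ℝ :=
  ∑ j ∈ Finset.range (𝒯.Υ i), area (𝒯.V t i ∩ 𝒯.T t i j) / area (𝒯.V t i) *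
      H (𝒯.x i t) t (𝒯.feGrad u t i j) -
    ε / area (𝒯.V t i) * ∑ j ∈ Finset.range (𝒯.Υ i),
      (u (𝒯.nbr i j) - u i) / 𝒯.edgeLen t i j * (𝒯.hL t i j + 𝒯.hR t i j)

/-- One step of the scheme from time `t` with step size `τ` and vertex dependent diffusion coefficients
`ε i`: the nodal values of the new finite element function as a function of those of the old one. -/
noncomputable def step (H : E3 → ℝ → E3 → ℝ) (ε : Fin 𝒯.M → ℝ) (t τ : ℝ) (u : Fin 𝒯.M → ℝ)
    (i : Fin 𝒯.M) : ℝ :=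
  u i - τ * 𝒯.numHam H (ε i) t u i

/-- The nodal values of the linear interpolation of `φ(·, t)`. -/
def interp (φ : E3 → ℝ → ℝ) (t : ℝ) (i : Fin 𝒯.M) : ℝ := φ (𝒯.x i t) t

/-- The times `t 0 < t 1 < … < t N` are a partition of `[0, T]`. -/
structure IsPartition (T : ℝ) (N : ℕ) (t : ℕ → ℝ) : Prop where
  zero : t 0 = 0
  last : t N = T
  lt : ∀ n < N, t n < t (n + 1)

/-- The constraints on the diffusion coefficients and on the time steps. -/
structure StepCondition (C₀ C₁ C₂ : ℝ) (N : ℕ) (t : ℕ → ℝ) (ε : ℕ → Fin 𝒯.M → ℝ) : Prop where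
  lower : ∀ n < N, ∀ i, C₀ * 𝒯.starDiam (t n) i ≤ ε n i
  upper : ∀ n < N, ∀ i, ε n i ≤ C₁ * 𝒯.starDiam (t n) i
  time : ∀ n < N, ∀ i j, t (n + 1) - t n ≤ C₂ * 𝒯.edgeLen (t n) i j

end Triangulation

end SurfaceHJ

open SurfaceHJ

open Filter Topology

/-! The error splits into a part in time and a part in space. In time, Taylor's formula along a
trajectory leaves at most τ‖(∂•)²φ‖, and τ ≤ C₂h. In space, the weights |V ∩ T_j|/|V| sum to one and
H is Lipschitz in p, so it suffices that every triangle gradient is within O(h) of ∇_Γφ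
(`exists_feGrad_sub_le`). Such a gradient is determined by the difference quotients along two edges.
These agree with directional derivatives up to O(h) by the second order Taylor estimate on the
surface; shape regularity keeps the two edges uniformly independent; and the plane of the triangle
is O(h)-close to the tangent plane, because a surface leaves its tangent planes only quadratically.

The delicate term is the artificial diffusion (`exists_diffusion_le`). Its factor ε/|V| is of order
1/h and the sides of V are of order h, so its summands are only O(1) and must cancel. Once the
quotients are replaced by ∇_Γφ · e_j, the vector Σ (h_L + h_R) e_j remains. In a flat star it
vanishes, as the sum of the outward normals of a closed polygon weighted by side lengths. In general
it is d times the sum, over the edges, of the two conormals of the adjacent triangles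
(`sum_side_smul_edgeDir`). The two are unit vectors orthogonal to the edge and nearly tangential,
hence nearly equal or nearly opposite; opposite is what is needed (`exists_conormal_add_le`).

Nearly equal conormals would mean that the star folds over, which `exists_no_fold` excludes: a short
segment normal to Γ(t) would join a point of one triangle to a point of the other, both with the
same closest point on Γ(t), against the injectivity of the closest point map. The same fact
separates the directions of small triangles at a vertex, so only boundedly many consecutive ones are
small. Hence the diameter of a star is comparable to d (`exists_starDiam_le`); this is needed
because ε is measured by that diameter and |V| by d².

All constants are uniform, and h is not assumed small. Local estimates come from charts on compact
sets; pairs of distant points and large stars are absorbed into the constants by compactness of Γ₀ ×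
[0, T] and connectedness of Γ₀. -/

namespace SurfaceHJ

/-! ### Charts of the moving surface -/

/-- A local parametrization `ψ` of `Γ₀` on an open set `U` that contains the compact ball `B` with centre `c`
and radius `r`, whose image covers the part of `Γ₀` in an open set `W`. -/
structure Chart (S : EvolvingSurface) where
  U : Set E2
  ψ : E2 → E3
  c : E2
  r : ℝ
  W : Set E3
  isOpen_U : IsOpen U
  r_pos : 0 < r
  ball_subset : Metric.closedBall c r ⊆ U
  smooth : ContDiffOn ℝ ∞ ψ U
  mapsTo : MapsTo ψ U S.Γ₀
  injOn : InjOn ψ U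
  immersion : ∀ u ∈ U, Function.Injective (fderiv ℝ ψ u)
  isOpen_W : IsOpen W
  cover : S.Γ₀ ∩ W ⊆ ψ '' Metric.closedBall c r

/-- The continuity of the inverse parametrization makes the preimage of a small parameter ball
relatively open, so the image of the closed ball covers a neighbourhood of `X` in `Γ₀`. -/
theorem exists_chart (S : EvolvingSurface) {X : E3} (hX : X ∈ S.Γ₀) : ∃ C : Chart S, X ∈ C.W := by
  obtain ⟨V, U, ψ, χ, hV, hXV, hU, hψ, him, hinj, hχ, hχψ⟩ := S.smooth X hX
  have hXm : X ∈ ψ '' U := him ▸ ⟨hX, hXV⟩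
  obtain ⟨u, hu, rfl⟩ := hXm
  obtain ⟨r, hr, hrU⟩ := Metric.nhds_basis_closedBall.mem_iff.1 (hU.mem_nhds hu)
  obtain ⟨W, hW, hWeq⟩ := continuousOn_iff'.1 hχ (Metric.ball u r) Metric.isOpen_ball
  refine ⟨⟨U, ψ, u, r, W ∩ V, hU, hr, hrU, hψ, ?_, ?_, hinj, hW.inter hV, ?_⟩, ?_, hXV⟩
  · intro v hv
    exact (him ▸ mem_image_of_mem ψ hv : ψ v ∈ S.Γ₀ ∩ V).1
  · intro v hv w hw h
    rw [← hχψ v hv, ← hχψ w hw, h]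
  · rintro Y ⟨hY, hYW, hYV⟩
    have hYm : Y ∈ ψ '' U := him ▸ ⟨hY, hYV⟩
    obtain ⟨v, hv, rfl⟩ := hYm
    refine ⟨v, ?_, rfl⟩
    have : ψ v ∈ χ ⁻¹' Metric.ball u r ∩ (S.Γ₀ ∩ V) := hWeq ▸ ⟨hYW, hY, hYV⟩
    have h2 := this.1
    rw [mem_preimage, hχψ v hv] at h2
    exact Metric.ball_subset_closedBall h2
  · have : ψ u ∈ χ ⁻¹' Metric.ball u r ∩ (S.Γ₀ ∩ V) :=
      ⟨by rw [mem_preimage, hχψ u hu]; exact Metric.mem_ball_self hr, hX, hXV⟩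
    rw [hWeq] at this
    exact this.1

namespace Chart

variable {S : EvolvingSurface} (C : Chart S)

/-- The compact parameter ball. -/
def B : Set E2 := Metric.closedBall C.c C.r

/-- The domain of the moving parametrization. -/
def dom : Set (E2 × ℝ) := C.U ×ˢ Icc 0 S.T

/-- The compact part of the domain. -/
def K : Set (E2 × ℝ) := C.B ×ˢ Icc 0 S.T

/-- The moving parametrization `F(u, t) = Φ(ψ(u), t)`. -/
def F (p : E2 × ℝ) : E3 := S.Φ (C.ψ p.1) p.2

/-- The spatial derivative of a function on the parameter domain. -/
noncomputable def DU {E : Type*} [NormedAddCommGroup E] [NormedSpace ℝ E] (g : E2 × ℝ → E)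
    (p : E2 × ℝ) : E2 →L[ℝ] E :=
  (fderivWithin ℝ g C.dom p).comp (ContinuousLinearMap.inl ℝ E2 ℝ)

theorem B_subset : C.B ⊆ C.U := C.ball_subset
theorem K_subset : C.K ⊆ C.dom := prod_mono C.B_subset le_rfl
theorem isCompact_B : IsCompact C.B := isCompact_closedBall _ _
theorem convex_B : Convex ℝ C.B := convex_closedBall _ _
theorem isCompact_K : IsCompact C.K := C.isCompact_B.prod isCompact_Icc
theorem convex_K : Convex ℝ C.K := C.convex_B.prod (convex_Icc _ _)

theorem uniqueDiffOn_dom : UniqueDiffOn ℝ C.dom :=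
  C.isOpen_U.uniqueDiffOn.prod (uniqueDiffOn_Icc S.T_pos)

theorem contDiffOn_F : ContDiffOn ℝ ∞ C.F C.dom := by
  have h : ContDiffOn ℝ ∞ (fun p : E2 × ℝ => (C.ψ p.1, p.2)) C.dom :=
    (C.smooth.comp contDiff_fst.contDiffOn fun p hp => hp.1).prodMk contDiff_snd.contDiffOn
  exact S.Φ_smooth.comp h fun p hp => ⟨C.mapsTo hp.1, hp.2⟩

theorem F_mem {p : E2 × ℝ} (hp : p ∈ C.dom) : C.F p ∈ S.Γ p.2 :=
  mem_image_of_mem _ (C.mapsTo hp.1)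

theorem contDiffOn_DU {E : Type*} [NormedAddCommGroup E] [NormedSpace ℝ E] {g : E2 × ℝ → E}
    {m n : ℕ∞ω} (hg : ContDiffOn ℝ n g C.dom) (hmn : m + 1 ≤ n) : ContDiffOn ℝ m (C.DU g) C.dom :=
  (hg.fderivWithin C.uniqueDiffOn_dom hmn).clm_comp contDiffOn_const

theorem hasFDerivAt_slice {E : Type*} [NormedAddCommGroup E] [NormedSpace ℝ E] {g : E2 × ℝ → E}
    {u : E2} {t : ℝ} (hg : DifferentiableWithinAt ℝ g C.dom (u, t)) (hu : u ∈ C.U)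
    (ht : t ∈ Icc 0 S.T) : HasFDerivAt (fun v => g (v, t)) (C.DU g (u, t)) u := by
  have h1 : HasFDerivWithinAt (fun v : E2 => (v, t)) (ContinuousLinearMap.inl ℝ E2 ℝ) C.U u :=
    (hasFDerivAt_prodMk_left u t).hasFDerivWithinAt
  have hmaps : MapsTo (fun v : E2 => (v, t)) C.U C.dom := fun v hv => ⟨hv, ht⟩
  have h2 := hg.hasFDerivWithinAt.comp u h1 hmaps
  exact h2.hasFDerivAt (C.isOpen_U.mem_nhds hu)

theorem hasFDerivAt_F {u : E2} {t : ℝ} (hu : u ∈ C.U) (ht : t ∈ Icc 0 S.T) :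
    HasFDerivAt (fun v => C.F (v, t)) (C.DU C.F (u, t)) u :=
  C.hasFDerivAt_slice (C.contDiffOn_F.differentiableOn (by simp) _ ⟨hu, ht⟩) hu ht

/-- The smooth inverse of the flow map composed with `F (·, t)` is `ψ`, so by the chain rule the
injective derivative of `ψ` factors through `DU F`. -/
theorem DU_injective {u : E2} {t : ℝ} (hu : u ∈ C.U) (ht : t ∈ Icc 0 S.T) :
    Function.Injective (C.DU C.F (u, t)) := by
  have hmaps : MapsTo (fun v => C.F (v, t)) C.U ((fun X => S.Φ X t) '' S.Γ₀) :=
    fun v hv => C.F_mem (p := (v, t)) ⟨hv, ht⟩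
  have h1 := ((S.Φ_inv_smooth t ht).differentiableOn (by simp) _ (hmaps hu)).hasFDerivWithinAt.comp u
    (C.hasFDerivAt_F hu ht).hasFDerivWithinAt hmaps
  have h2 : HasFDerivWithinAt C.ψ _ C.U u := HasFDerivWithinAt.congr' h1 (fun v hv => by
    simp only [Function.comp, F]
    exact ((S.Φ_inj t ht).leftInvOn_invFunOn (C.mapsTo hv)).symm) hu
  have h3 := (h2.hasFDerivAt (C.isOpen_U.mem_nhds hu)).fderiv
  have h4 := C.immersion u hu
  rw [h3] at h4
  exact Function.Injective.of_comp h4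

theorem F_injOn {t : ℝ} (ht : t ∈ Icc 0 S.T) : InjOn (fun u => C.F (u, t)) C.U :=
  (S.Φ_inj t ht).comp C.injOn C.mapsTo

/-- A continuous function on the compact set `K × M` that is positive has a positive lower bound. -/
theorem exists_lower_bound {α : Type*} [TopologicalSpace α] {f : α → ℝ} {s : Set α} (hs : IsCompact s)
    (hf : ContinuousOn f s) (hpos : ∀ x ∈ s, 0 < f x) : ∃ m > 0, ∀ x ∈ s, m ≤ f x := by
  rcases s.eq_empty_or_nonempty with rfl | hne
  · exact ⟨1, one_pos, by simp⟩
  · obtain ⟨x, hx, hmin⟩ := hs.exists_isMinOn hne hf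
    exact ⟨f x, hpos x hx, fun y hy => hmin hy⟩

theorem exists_DU_lower : ∃ m > 0, ∀ u ∈ C.B, ∀ t ∈ Icc 0 S.T, ∀ w, m * ‖w‖ ≤ ‖C.DU C.F (u, t) w‖ := by
  have hc : ContinuousOn (fun q : (E2 × ℝ) × E2 => ‖C.DU C.F q.1 q.2‖)
      (C.K ×ˢ Metric.sphere (0 : E2) 1) := by
    have := (C.contDiffOn_DU C.contDiffOn_F (m := 0) (by simp)).continuousOn.mono C.K_subset
    exact ((this.comp continuousOn_fst fun q hq => hq.1).clm_apply continuousOn_snd).norm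
  obtain ⟨m, hm, h⟩ := exists_lower_bound (C.isCompact_K.prod (isCompact_sphere _ _)) hc (by
    rintro ⟨⟨u, t⟩, w⟩ ⟨⟨hu, ht⟩, hw⟩
    rw [norm_pos_iff]
    intro h0
    have := C.DU_injective (C.B_subset hu) ht (h0.trans (map_zero _).symm)
    simp only at this
    simp [this] at hw)
  refine ⟨m, hm, fun u hu t ht w => ?_⟩
  rcases eq_or_ne w 0 with rfl | hw
  · simp
  have := h ((u, t), ‖w‖⁻¹ • w) ⟨⟨hu, ht⟩, by simp [norm_smul, hw]⟩
  simp only [map_smul, norm_smul, norm_inv, norm_norm] at this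
  rwa [le_inv_mul_iff₀ (norm_pos_iff.2 hw), mul_comm] at this

theorem exists_lipschitz {E : Type*} [NormedAddCommGroup E] [NormedSpace ℝ E] {g : E2 × ℝ → E}
    (hg : ContDiffOn ℝ 1 g C.dom) : ∃ L > 0, ∀ p ∈ C.K, ∀ q ∈ C.K, ‖g p - g q‖ ≤ L * ‖p - q‖ := by
  obtain ⟨L, hL⟩ := (hg.mono C.K_subset).exists_lipschitzOnWith one_ne_zero C.convex_K C.isCompact_K
  refine ⟨L + 1, by positivity, fun p hp q hq => ?_⟩
  refine (hL.norm_sub_le hp hq).trans ?_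
  gcongr
  linarith

theorem exists_bound {E : Type*} [NormedAddCommGroup E] {g : E2 × ℝ → E}
    (hg : ContinuousOn g C.dom) : ∃ L > 0, ∀ p ∈ C.K, ‖g p‖ ≤ L := by
  obtain ⟨L, hL⟩ := C.isCompact_K.exists_bound_of_continuousOn (hg.mono C.K_subset)
  exact ⟨max L 1, by positivity, fun p hp => (hL p hp).trans (le_max_left _ _)⟩

/-- The spatial Taylor estimate for the moving parametrization. -/
theorem exists_taylor : ∃ L > 0, ∀ u ∈ C.B, ∀ v ∈ C.B, ∀ t ∈ Icc 0 S.T,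
    ‖C.F (v, t) - C.F (u, t) - C.DU C.F (u, t) (v - u)‖ ≤ L * ‖v - u‖ ^ 2 := by
  -- The spatial derivative is `C¹`, hence Lipschitz on the compact convex set `K`. Freezing it at
  -- `u` in the mean value inequality on the segment yields the second factor `‖v - u‖`.
  obtain ⟨L, hL0, hL⟩ := C.exists_lipschitz (C.contDiffOn_DU C.contDiffOn_F (m := 1) (by norm_cast))
  refine ⟨L, hL0, fun u hu v hv t ht => ?_⟩
  have hseg : segment ℝ u v ⊆ C.B := C.convex_B.segment_subset hu hv
  have := (convex_segment (𝕜 := ℝ) u v).norm_image_sub_le_of_norm_hasFDerivWithin_le'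
    (f := fun w => C.F (w, t)) (f' := fun w => C.DU C.F (w, t)) (φ := C.DU C.F (u, t))
    (C := L * ‖v - u‖)
    (fun w hw => (C.hasFDerivAt_F (C.B_subset (hseg hw)) ht).hasFDerivWithinAt) (fun w hw => by
      refine (hL (w, t) ⟨hseg hw, ht⟩ (u, t) ⟨hu, ht⟩).trans ?_
      gcongr
      simp only [Prod.mk_sub_mk, sub_self, Prod.norm_mk, norm_zero]
      rw [max_eq_left (norm_nonneg _)]
      exact norm_sub_le_of_mem_segment hw) (left_mem_segment _ _ _) (right_mem_segment _ _ _)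
  refine this.trans (le_of_eq (by ring))

/-- The moving parametrization is expanding on the parameter ball, uniformly in time. -/
theorem exists_expanding : ∃ m > 0, ∀ u ∈ C.B, ∀ v ∈ C.B, ∀ t ∈ Icc 0 S.T,
    m * ‖v - u‖ ≤ ‖C.F (v, t) - C.F (u, t)‖ := by
  obtain ⟨m, hm, hDU⟩ := C.exists_DU_lower
  obtain ⟨L, hL, hT⟩ := C.exists_taylor
  -- Below the distance `ρ` the Taylor remainder is at most half of the linear lower bound. Pairs at
  -- distance at least `ρ` form a compact set, on which injectivity gives a positive minimum `m'`;
  -- it is divided by the diameter `2r` of the parameter ball.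
  set ρ := m / (2 * L) with hρ
  have hρ0 : 0 < ρ := by positivity
  have hFc := C.contDiffOn_F.continuousOn.mono C.K_subset
  set M : Set ((E2 × E2) × ℝ) := ((C.B ×ˢ C.B) ∩ {q | ρ ≤ ‖q.2 - q.1‖}) ×ˢ Icc 0 S.T
  have hM : IsCompact M := by
    refine IsCompact.prod ?_ isCompact_Icc
    exact (C.isCompact_B.prod C.isCompact_B).inter_right (isClosed_le continuous_const (by fun_prop))
  obtain ⟨m', hm', hfar⟩ := exists_lower_bound (f := fun q : (E2 × E2) × ℝ =>
      ‖C.F (q.1.2, q.2) - C.F (q.1.1, q.2)‖) hM (by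
    refine ContinuousOn.norm (ContinuousOn.sub ?_ ?_)
    · exact hFc.comp (f := fun q : (E2 × E2) × ℝ => (q.1.2, q.2)) (by fun_prop)
        fun q hq => ⟨hq.1.1.2, hq.2⟩
    · exact hFc.comp (f := fun q : (E2 × E2) × ℝ => (q.1.1, q.2)) (by fun_prop)
        fun q hq => ⟨hq.1.1.1, hq.2⟩) (by
    rintro ⟨⟨u, v⟩, t⟩ ⟨⟨⟨hu, hv⟩, huv⟩, ht⟩
    rw [norm_pos_iff, sub_ne_zero]
    intro h
    have := C.F_injOn ht (C.B_subset hv) (C.B_subset hu) h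
    simp only at this
    simp only [mem_ofPred_eq, this, sub_self, norm_zero] at huv
    linarith)
  refine ⟨min (m / 2) (m' / (2 * C.r)), lt_min (by positivity) (div_pos hm' (by linarith [C.r_pos])), fun u hu v hv t ht => ?_⟩
  rcases le_or_gt ρ ‖v - u‖ with h | h
  · have h1 := hfar ((u, v), t) ⟨⟨⟨hu, hv⟩, h⟩, ht⟩
    have h2 : ‖v - u‖ ≤ 2 * C.r := by
      have := dist_triangle_right v u C.c
      rw [← dist_eq_norm]
      have h3 : dist v C.c ≤ C.r := hv
      have h4 : dist u C.c ≤ C.r := hu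
      linarith
    calc min (m / 2) (m' / (2 * C.r)) * ‖v - u‖ ≤ m' / (2 * C.r) * (2 * C.r) := by
          gcongr
          · exact div_nonneg hm'.le (by linarith [C.r_pos])
          · exact min_le_right _ _
      _ = m' := div_mul_cancel₀ _ (by linarith [C.r_pos])
      _ ≤ _ := h1
  · have h1 := hT u hu v hv t ht
    have h2 := hDU u hu t ht (v - u)
    have h3 : L * ‖v - u‖ ^ 2 ≤ m / 2 * ‖v - u‖ := by
      have : L * ‖v - u‖ ≤ m / 2 := by
        calc L * ‖v - u‖ ≤ L * ρ := by gcongr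
          _ = m / 2 := by rw [hρ]; field_simp
      nlinarith [norm_nonneg (v - u)]
    have h4 := norm_sub_norm_le (C.DU C.F (u, t) (v - u)) (C.F (v, t) - C.F (u, t))
    rw [norm_sub_rev (C.DU C.F (u, t) (v - u))] at h4
    calc min (m / 2) (m' / (2 * C.r)) * ‖v - u‖ ≤ m / 2 * ‖v - u‖ := by
          gcongr
          exact min_le_left _ _
      _ ≤ _ := by linarith

end Chart

/-! ### Tangential gradient and Hessian in charts -/

namespace EvolvingSurface

variable (S : EvolvingSurface)

theorem P_apply (x : E3) (t : ℝ) (w : E3) : S.P x t w = w - inner ℝ (S.ν x t) w • S.ν x t := by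
  simp [P]

theorem inner_ν_P {x : E3} {t : ℝ} (hν : ‖S.ν x t‖ = 1) (w : E3) : inner ℝ (S.ν x t) (S.P x t w) = 0 := by
  rw [P_apply, inner_sub_right, inner_smul_right, real_inner_self_eq_norm_sq, hν]
  ring

theorem inner_P_left (x : E3) (t : ℝ) (v w : E3) (hw : inner ℝ (S.ν x t) w = 0) :
    inner ℝ (S.P x t v) w = inner ℝ v w := by
  rw [P_apply, inner_sub_left, inner_smul_left, hw]
  simp

theorem P_eq_self {x : E3} {t : ℝ} {w : E3} (hw : inner ℝ (S.ν x t) w = 0) : S.P x t w = w := by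
  rw [P_apply, hw]
  simp

theorem norm_P_le {x : E3} {t : ℝ} (hν : ‖S.ν x t‖ = 1) (w : E3) : ‖S.P x t w‖ ≤ 2 * ‖w‖ := by
  rw [P_apply]
  refine (norm_sub_le _ _).trans ?_
  rw [norm_smul, hν]
  have := norm_inner_le_norm (𝕜 := ℝ) (S.ν x t) w
  rw [hν] at this
  linarith

theorem exists_param {x : E3} {t : ℝ} (hx : x ∈ S.Γ t) : ∃ X ∈ S.Γ₀, S.Φ X t = x := hx

theorem invFunOn_Φ {X : E3} {t : ℝ} (ht : t ∈ Icc 0 S.T) (hX : X ∈ S.Γ₀) :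
    Function.invFunOn (fun X => S.Φ X t) S.Γ₀ (S.Φ X t) = X :=
  (S.Φ_inj t ht).leftInvOn_invFunOn hX

variable {S} in
theorem IsC2.differentiableWithinAt {φ : E3 → ℝ → ℝ} (hφ : S.IsC2 φ) {x : E3} {t : ℝ}
    (ht : t ∈ Icc 0 S.T) (hx : x ∈ S.Γ t) : DifferentiableWithinAt ℝ (fun y => φ y t) (S.Γ t) x := by
  have h1 := ContDiffOn.differentiableOn hφ (by simp) (x, t) ⟨ht, hx⟩
  exact DifferentiableWithinAt.comp x (f := fun y => (y, t)) h1
    (by fun_prop) (fun y hy => ⟨ht, hy⟩)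

theorem tangGrad_normal (φ : E3 → ℝ → ℝ) {x : E3} {t : ℝ} (ht : t ∈ Icc 0 S.T) (hx : x ∈ S.Γ t) :
    inner ℝ (S.ν x t) (S.tangGrad φ x t) = 0 :=
  S.inner_ν_P (S.ν_unit t ht x hx) _

end EvolvingSurface

namespace Chart

variable {S : EvolvingSurface} (C : Chart S)

theorem inner_ν_DU {u : E2} {t : ℝ} (hu : u ∈ C.U) (ht : t ∈ Icc 0 S.T) (w : E2) :
    inner ℝ (S.ν (C.F (u, t)) t) (C.DU C.F (u, t) w) = 0 := by
  have h1 := (C.hasFDerivAt_F hu ht).hasFDerivWithinAt (s := C.U)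
  have hw : w ∈ tangentConeAt ℝ C.U u := by
    rw [tangentConeAt_of_mem_nhds (C.isOpen_U.mem_nhds hu)]
    trivial
  have h2 := HasFDerivWithinAt.mapsTo_tangent_cone h1 hw
  refine S.ν_normal t ht _ (C.F_mem (p := (u, t)) ⟨hu, ht⟩) _ (tangentConeAt_mono ?_ h2)
  rintro _ ⟨v, hv, rfl⟩
  exact C.F_mem (p := (v, t)) ⟨hv, ht⟩

/-- Dimension count: the injective image of the plane lies in the two-dimensional orthogonal
complement of the normal, hence fills it. -/
theorem exists_DU_eq {u : E2} {t : ℝ} (hu : u ∈ C.U) (ht : t ∈ Icc 0 S.T) {w : E3}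
    (hw : inner ℝ (S.ν (C.F (u, t)) t) w = 0) : ∃ w', C.DU C.F (u, t) w' = w := by
  set n := S.ν (C.F (u, t)) t
  have hn : n ≠ 0 := by
    have := S.ν_unit t ht _ (C.F_mem (p := (u, t)) ⟨hu, ht⟩)
    intro h
    simp only [n] at h
    simp [h] at this
  have hle : LinearMap.range (C.DU C.F (u, t)).toLinearMap ≤ (Submodule.span ℝ {n})ᗮ := by
    rintro _ ⟨v, rfl⟩
    rw [Submodule.mem_orthogonal_singleton_iff_inner_right]
    exact C.inner_ν_DU hu ht v
  have heq : LinearMap.range (C.DU C.F (u, t)).toLinearMap = (Submodule.span ℝ {n})ᗮ := by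
    refine Submodule.eq_of_le_of_finrank_eq hle ?_
    have : Fact (Module.finrank ℝ E3 = 2 + 1) := ⟨by simp⟩
    rw [Submodule.finrank_orthogonal_span_singleton (n := 2) hn,
      LinearMap.finrank_range_of_inj (C.DU_injective hu ht)]
    simp
  have : w ∈ LinearMap.range (C.DU C.F (u, t)).toLinearMap := by
    rw [heq, Submodule.mem_orthogonal_singleton_iff_inner_right]
    exact hw
  exact this

/-- The pull-back of a function on the space-time surface. -/
def pull (φ : E3 → ℝ → ℝ) (p : E2 × ℝ) : ℝ := φ (C.F p) p.2

theorem contDiffOn_pull {φ : E3 → ℝ → ℝ} (hφ : S.IsC2 φ) : ContDiffOn ℝ 2 (C.pull φ) C.dom := by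
  have h : ContDiffOn ℝ 2 (fun p => (C.F p, p.2)) C.dom :=
    (C.contDiffOn_F.of_le (by norm_cast)).prodMk contDiff_snd.contDiffOn
  exact ContDiffOn.comp hφ h fun p hp => ⟨hp.2, C.F_mem hp⟩

/-- The chain rule within `Γ(t)`. Together with orthogonality to the normal these identities
determine the tangential gradient, whichever derivative `gradientWithin` picks. -/
theorem inner_tangGrad_DU {φ : E3 → ℝ → ℝ} (hφ : S.IsC2 φ) {u : E2} {t : ℝ} (hu : u ∈ C.U)
    (ht : t ∈ Icc 0 S.T) (w : E2) :
    inner ℝ (S.tangGrad φ (C.F (u, t)) t) (C.DU C.F (u, t) w) = C.DU (C.pull φ) (u, t) w := by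
  have hx := C.F_mem (p := (u, t)) ⟨hu, ht⟩
  have h1 := C.hasFDerivAt_slice ((C.contDiffOn_pull hφ).differentiableOn (by simp) (u, t) ⟨hu, ht⟩) hu ht
  have hmaps : MapsTo (fun v => C.F (v, t)) C.U (S.Γ t) := fun v hv => C.F_mem (p := (v, t)) ⟨hv, ht⟩
  have h2 := ((hφ.differentiableWithinAt ht hx).hasFDerivWithinAt.comp u
    (C.hasFDerivAt_F hu ht).hasFDerivWithinAt hmaps).hasFDerivAt (C.isOpen_U.mem_nhds hu)
  rw [h1.unique h2, EvolvingSurface.tangGrad, S.inner_P_left _ _ _ _ (C.inner_ν_DU hu ht w), gradientWithin,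
    InnerProductSpace.toDual_symm_apply]
  rfl

/-- The two coordinate tangent vectors and their Gram determinant. -/
noncomputable def tv (i : Fin 2) (p : E2 × ℝ) : E3 := C.DU C.F p (EuclideanSpace.single i 1)

noncomputable def gram (p : E2 × ℝ) : ℝ :=
  ‖C.tv 0 p‖ ^ 2 * ‖C.tv 1 p‖ ^ 2 - inner ℝ (C.tv 0 p) (C.tv 1 p) ^ 2

/-- The solution of the normal equations for the tangential gradient, in coordinates. -/
noncomputable def gradCoord (φ : E3 → ℝ → ℝ) (p : E2 × ℝ) : E2 :=
  ((C.gram p)⁻¹ * (‖C.tv 1 p‖ ^ 2 * C.DU (C.pull φ) p (EuclideanSpace.single 0 1) -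
      inner ℝ (C.tv 0 p) (C.tv 1 p) * C.DU (C.pull φ) p (EuclideanSpace.single 1 1))) •
      EuclideanSpace.single 0 1 +
    ((C.gram p)⁻¹ * (‖C.tv 0 p‖ ^ 2 * C.DU (C.pull φ) p (EuclideanSpace.single 1 1) -
      inner ℝ (C.tv 0 p) (C.tv 1 p) * C.DU (C.pull φ) p (EuclideanSpace.single 0 1))) •
      EuclideanSpace.single 1 1

/-- The tangential gradient as a function on the parameter domain. -/
noncomputable def gradParam (φ : E3 → ℝ → ℝ) (p : E2 × ℝ) : E3 := C.DU C.F p (C.gradCoord φ p)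

theorem E2_eq (w : E2) : w = w 0 • EuclideanSpace.single 0 1 + w 1 • EuclideanSpace.single 1 1 := by
  ext i
  fin_cases i <;> simp

theorem gram_ne_zero {p : E2 × ℝ} (hp : p ∈ C.dom) : C.gram p ≠ 0 := by
  intro h0
  have hinj := C.DU_injective hp.1 hp.2
  have h1 : ‖‖C.tv 1 p‖ ^ 2 • C.tv 0 p - inner ℝ (C.tv 0 p) (C.tv 1 p) • C.tv 1 p‖ ^ 2 = 0 := by
    rw [@norm_sub_sq_real, norm_smul, norm_smul, inner_smul_left, inner_smul_right, mul_pow, mul_pow,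
      Real.norm_eq_abs, Real.norm_eq_abs, sq_abs, sq_abs]
    simp only [conj_trivial]
    have : ‖C.tv 1 p‖ ^ 2 * C.gram p = 0 := by rw [h0, mul_zero]
    rw [gram] at this
    linarith
  have h2 := norm_eq_zero.1 (pow_eq_zero_iff (two_ne_zero) |>.1 h1)
  have h3 : C.DU C.F p (‖C.tv 1 p‖ ^ 2 • EuclideanSpace.single 0 1 -
      inner ℝ (C.tv 0 p) (C.tv 1 p) • EuclideanSpace.single 1 1) = C.DU C.F p 0 := by
    rw [map_sub, map_smul, map_smul, map_zero]
    exact h2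
  have h4 := congrArg (fun w : E2 => w 0) (hinj h3)
  simp at h4
  have h5 : (EuclideanSpace.single 1 1 : E2) = 0 := by
    apply hinj
    rw [map_zero]
    exact h4
  simpa using congrArg (fun w : E2 => w 1) h5

/-- Cramer's rule for the normal equations involves only first derivatives of `F` and of the
pull-back, and a nonvanishing denominator. The regularity of the gradient can be read off from it.
-/
theorem contDiffOn_gradParam {φ : E3 → ℝ → ℝ} (hφ : S.IsC2 φ) :
    ContDiffOn ℝ 1 (C.gradParam φ) C.dom := by
  have hD : ContDiffOn ℝ 1 (C.DU C.F) C.dom := C.contDiffOn_DU C.contDiffOn_F (by norm_cast)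
  have hg : ContDiffOn ℝ 1 (C.DU (C.pull φ)) C.dom := C.contDiffOn_DU (C.contDiffOn_pull hφ) (by norm_num)
  have ht : ∀ i, ContDiffOn ℝ 1 (C.tv i) C.dom := fun i => hD.clm_apply contDiffOn_const
  have hgram : ContDiffOn ℝ 1 (fun p => (C.gram p)⁻¹) C.dom :=
    ((((ht 0).norm_sq ℝ).mul ((ht 1).norm_sq ℝ)).sub (((ht 0).inner ℝ (ht 1)).pow 2)).inv
      fun p hp => C.gram_ne_zero hp
  have hg' : ∀ i, ContDiffOn ℝ 1 (fun p => C.DU (C.pull φ) p (EuclideanSpace.single i 1)) C.dom :=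
    fun i => hg.clm_apply contDiffOn_const
  refine hD.clm_apply (ContDiffOn.add ?_ ?_)
  · exact (hgram.mul ((((ht 1).norm_sq ℝ).mul (hg' 0)).sub (((ht 0).inner ℝ (ht 1)).mul (hg' 1)))).smul
      contDiffOn_const
  · exact (hgram.mul ((((ht 0).norm_sq ℝ).mul (hg' 1)).sub (((ht 0).inner ℝ (ht 1)).mul (hg' 0)))).smul
      contDiffOn_const

/-- Both vectors lie in the range of `DU F` and have the same inner products with that range, so
their difference is orthogonal to itself. -/
theorem tangGrad_eq {φ : E3 → ℝ → ℝ} (hφ : S.IsC2 φ) {u : E2} {t : ℝ} (hu : u ∈ C.U)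
    (ht : t ∈ Icc 0 S.T) : S.tangGrad φ (C.F (u, t)) t = C.gradParam φ (u, t) := by
  have hx := C.F_mem (p := (u, t)) ⟨hu, ht⟩
  obtain ⟨w', hw'⟩ := C.exists_DU_eq hu ht (S.tangGrad_normal φ ht hx)
  have hG := C.gram_ne_zero (p := (u, t)) ⟨hu, ht⟩
  have key : ∀ w, inner ℝ (C.gradParam φ (u, t)) (C.DU C.F (u, t) w) = C.DU (C.pull φ) (u, t) w := by
    intro w
    have hb : ∀ i, inner ℝ (C.gradParam φ (u, t)) (C.tv i (u, t)) =
        C.DU (C.pull φ) (u, t) (EuclideanSpace.single i 1) := by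
      intro i
      rw [gradParam, gradCoord, map_add, map_smul, map_smul]
      change inner ℝ (_ • C.tv 0 (u, t) + _ • C.tv 1 (u, t)) _ = _
      rw [inner_add_left, inner_smul_left, inner_smul_left]
      fin_cases i
      · simp only [conj_trivial, real_inner_self_eq_norm_sq, Fin.zero_eta,
          real_inner_comm (C.tv 0 (u, t)) (C.tv 1 (u, t))]
        field_simp
        rw [gram]
        ring
      · simp only [conj_trivial, real_inner_self_eq_norm_sq, Fin.mk_one]
        field_simp
        rw [gram]
        ring
    conv_lhs => rw [E2_eq w]
    conv_rhs => rw [E2_eq w]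
    simp only [map_add, map_smul, inner_add_right, inner_smul_right, smul_eq_mul]
    rw [← hb 0, ← hb 1]
    rfl
  have h0 : ∀ w, inner ℝ (S.tangGrad φ (C.F (u, t)) t - C.gradParam φ (u, t)) (C.DU C.F (u, t) w) = 0 := by
    intro w
    rw [inner_sub_left, key, C.inner_tangGrad_DU hφ hu ht, sub_self]
  have h1 : S.tangGrad φ (C.F (u, t)) t - C.gradParam φ (u, t) =
      C.DU C.F (u, t) (w' - C.gradCoord φ (u, t)) := by
    rw [map_sub, hw']
    rfl
  have h2 := h0 (w' - C.gradCoord φ (u, t))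
  rw [← h1, inner_self_eq_zero] at h2
  exact sub_eq_zero.1 h2

/-- Without this, the `fderivWithin` in `tangHess` could be the default value zero. The gradient is
`gradParam` composed with an inverse `ζ` of the chart, and `ζ` is differentiable within `Γ(t)` at
the given point. -/
theorem differentiableWithinAt_tangGrad {φ : E3 → ℝ → ℝ} (hφ : S.IsC2 φ) {X : E3} {t : ℝ}
    (hX : X ∈ S.Γ₀) (hXW : X ∈ C.W) (ht : t ∈ Icc 0 S.T) :
    DifferentiableWithinAt ℝ (fun y => S.tangGrad φ y t) (S.Γ t) (S.Φ X t) := by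
  obtain ⟨u, hu, rfl⟩ := C.cover ⟨hX, hXW⟩
  change u ∈ C.B at hu
  have huU := C.B_subset hu
  set x := S.Φ (C.ψ u) t with hx
  have hxF : C.F (u, t) = x := rfl
  have hxm : x ∈ S.Γ t := C.F_mem (p := (u, t)) ⟨huU, ht⟩
  set ζ : E3 → E2 := Function.invFunOn (fun v => C.F (v, t)) C.B with hζ
  -- The inverse flow map is continuous and `W` is open, so surface points near `x` come from the
  -- parameter ball.
  have hnear : ∀ᶠ y in 𝓝[S.Γ t] x, ζ y ∈ C.B ∧ C.F (ζ y, t) = y := by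
    have hcont := (S.Φ_inv_smooth t ht).continuousOn x hxm
    have hv : Function.invFunOn (fun X => S.Φ X t) S.Γ₀ x = C.ψ u := S.invFunOn_Φ ht hX
    have h1 : ∀ᶠ y in 𝓝[S.Γ t] x, Function.invFunOn (fun X => S.Φ X t) S.Γ₀ y ∈ C.W :=
      hcont (C.isOpen_W.mem_nhds (by rw [hv]; exact hXW))
    filter_upwards [h1, self_mem_nhdsWithin] with y hy hyΓ
    obtain ⟨Y, hY, rfl⟩ := S.exists_param hyΓ
    rw [S.invFunOn_Φ ht hY] at hy
    obtain ⟨v, hv, rfl⟩ := C.cover ⟨hY, hy⟩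
    have hex : ∃ a ∈ C.B, C.F (a, t) = S.Φ (C.ψ v) t := ⟨v, hv, rfl⟩
    exact ⟨Function.invFunOn_mem hex, Function.invFunOn_eq hex⟩
  have hζx : ζ x = u := ((C.F_injOn ht).mono C.B_subset).leftInvOn_invFunOn hu
  obtain ⟨Li, hLi⟩ := LinearMap.exists_leftInverse_of_injective (C.DU C.F (u, t)).toLinearMap
    (LinearMap.ker_eq_bot.2 (C.DU_injective huU ht))
  obtain ⟨m, hm, hexp⟩ := C.exists_expanding
  obtain ⟨L, hL, hT⟩ := C.exists_taylor
  have hLi' : ∀ w, Li (C.DU C.F (u, t) w) = w := fun w => by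
    have := congrArg (fun f => f w) hLi
    exact this
  set Lc := LinearMap.toContinuousLinearMap Li
  have hLc : ∀ w, Lc (C.DU C.F (u, t) w) = w := hLi'
  -- A left inverse `Lc` of `DU F` is a derivative of `ζ`: the Taylor remainder of `F` is quadratic
  -- in `‖ζ y - u‖`, which the expanding property bounds by `‖y - x‖ / m`.
  have hO : (fun y => ζ y - ζ x - Lc (y - x)) =O[𝓝[S.Γ t] x] fun y => ‖y - x‖ ^ 2 := by
    refine Asymptotics.IsBigO.of_bound (‖Lc‖ * (L / m ^ 2)) ?_
    filter_upwards [hnear] with y hy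
    have h1 : ζ y - ζ x - Lc (y - x) =
        - Lc (C.F (ζ y, t) - C.F (u, t) - C.DU C.F (u, t) (ζ y - u)) := by
      rw [hy.2, map_sub _ (y - C.F (u, t)), hLc, hζx, hxF]
      abel
    rw [h1, norm_neg]
    have h2 := hT u hu (ζ y) hy.1 t ht
    have h3 := hexp u hu (ζ y) hy.1 t ht
    rw [hy.2, hxF] at h3
    have h4 : ‖ζ y - u‖ ≤ ‖y - x‖ / m := by rw [le_div_iff₀ hm, mul_comm]; exact h3
    calc _ ≤ ‖Lc‖ * (L * ‖ζ y - u‖ ^ 2) := (Lc.le_opNorm _).trans (by gcongr)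
      _ ≤ ‖Lc‖ * (L * (‖y - x‖ / m) ^ 2) := by gcongr
      _ = _ := by rw [norm_pow, norm_norm]; field_simp
  have hζd : HasFDerivWithinAt ζ Lc (S.Γ t) x := by
    have h1 := hO.hasFDerivWithinAt (𝕜 := ℝ) hxm one_lt_two
    have h2 : HasFDerivWithinAt (fun y => Lc (y - x)) Lc (S.Γ t) x :=
      (Lc.hasFDerivAt.comp x ((hasFDerivAt_id (𝕜 := ℝ) x).sub_const x)).hasFDerivWithinAt
    have h3 := (h1.add h2).add_const (ζ x)
    simpa using h3
  have hA := C.hasFDerivAt_slice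
    ((C.contDiffOn_gradParam hφ).differentiableOn (by simp) (u, t) ⟨huU, ht⟩) huU ht
  have h5 : HasFDerivWithinAt (fun y => C.gradParam φ (ζ y, t))
      ((C.DU (C.gradParam φ) (u, t)).comp Lc) (S.Γ t) x :=
    HasFDerivAt.comp_hasFDerivWithinAt (g := fun v => C.gradParam φ (v, t)) x (by rw [hζx]; exact hA) hζd
  refine (h5.differentiableWithinAt).congr_of_eventuallyEq ?_ ?_
  · filter_upwards [hnear] with y hy
    rw [← C.tangGrad_eq hφ (C.B_subset hy.1) ht, hy.2]
  · rw [hζx, ← C.tangGrad_eq hφ huU ht, hxF]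

end Chart

variable {S : EvolvingSurface}

theorem EvolvingSurface.IsC2.differentiableWithinAt_tangGrad {φ : E3 → ℝ → ℝ} (hφ : S.IsC2 φ) {x : E3} {t : ℝ}
    (ht : t ∈ Icc 0 S.T) (hx : x ∈ S.Γ t) :
    DifferentiableWithinAt ℝ (fun y => S.tangGrad φ y t) (S.Γ t) x := by
  obtain ⟨X, hX, rfl⟩ := S.exists_param hx
  obtain ⟨C, hC⟩ := exists_chart S hX
  exact C.differentiableWithinAt_tangGrad hφ hX hC ht

namespace Chart

variable (C : Chart S)

theorem hasFDerivAt_tangGrad {φ : E3 → ℝ → ℝ} (hφ : S.IsC2 φ) {u : E2} {t : ℝ} (hu : u ∈ C.U)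
    (ht : t ∈ Icc 0 S.T) : HasFDerivAt (fun v => S.tangGrad φ (C.F (v, t)) t)
      ((S.tangHess φ (C.F (u, t)) t).comp (C.DU C.F (u, t))) u := by
  have hx := C.F_mem (p := (u, t)) ⟨hu, ht⟩
  have hmaps : MapsTo (fun v => C.F (v, t)) C.U (S.Γ t) := fun v hv => C.F_mem (p := (v, t)) ⟨hv, ht⟩
  have h2 := ((hφ.differentiableWithinAt_tangGrad ht hx).hasFDerivWithinAt.comp u
    (C.hasFDerivAt_F hu ht).hasFDerivWithinAt hmaps).hasFDerivAt (C.isOpen_U.mem_nhds hu)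
  have h3 : (S.tangHess φ (C.F (u, t)) t).comp (C.DU C.F (u, t)) =
      (fderivWithin ℝ (fun y => S.tangGrad φ y t) (S.Γ t) (C.F (u, t))).comp (C.DU C.F (u, t)) := by
    ext1 w
    simp only [EvolvingSurface.tangHess, ContinuousLinearMap.comp_apply]
    rw [S.P_eq_self (C.inner_ν_DU hu ht w)]
  rw [h3]
  exact h2

/-- This writes the Hessian, up to the invertible-onto-tangent-plane factor `DU F`, as a continuous
function on the parameter domain, so that compactness can bound it. -/
theorem tangHess_comp_DU {φ : E3 → ℝ → ℝ} (hφ : S.IsC2 φ) {u : E2} {t : ℝ} (hu : u ∈ C.U)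
    (ht : t ∈ Icc 0 S.T) : (S.tangHess φ (C.F (u, t)) t).comp (C.DU C.F (u, t)) =
      C.DU (C.gradParam φ) (u, t) := by
  have h1 := C.hasFDerivAt_slice
    ((C.contDiffOn_gradParam hφ).differentiableOn (by simp) (u, t) ⟨hu, ht⟩) hu ht
  refine (C.hasFDerivAt_tangGrad hφ hu ht).unique (h1.congr_of_eventuallyEq ?_)
  filter_upwards [C.isOpen_U.mem_nhds hu] with v hv
  exact C.tangGrad_eq hφ hv ht

theorem exists_bound_tangGrad {φ : E3 → ℝ → ℝ} (hφ : S.IsC2 φ) :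
    ∃ L, ∀ u ∈ C.B, ∀ t ∈ Icc 0 S.T, ‖S.tangGrad φ (C.F (u, t)) t‖ ≤ L := by
  obtain ⟨L, -, hL⟩ := C.exists_bound (C.contDiffOn_gradParam hφ).continuousOn
  refine ⟨L, fun u hu t ht => ?_⟩
  rw [C.tangGrad_eq hφ (C.B_subset hu) ht]
  exact hL (u, t) ⟨hu, ht⟩

theorem exists_bound_tangHess {φ : E3 → ℝ → ℝ} (hφ : S.IsC2 φ) :
    ∃ L, ∀ u ∈ C.B, ∀ t ∈ Icc 0 S.T, ‖S.tangHess φ (C.F (u, t)) t‖ ≤ L := by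
  obtain ⟨L, hL0, hL⟩ := C.exists_bound (C.contDiffOn_DU (C.contDiffOn_gradParam hφ) (m := 0) (by simp)).continuousOn
  obtain ⟨m, hm, hlow⟩ := C.exists_DU_lower
  refine ⟨L / m * 2, fun u hu t ht => ?_⟩
  have huU := C.B_subset hu
  have hν := S.ν_unit t ht _ (C.F_mem (p := (u, t)) ⟨huU, ht⟩)
  refine ContinuousLinearMap.opNorm_le_bound _ (by positivity) fun w => ?_
  obtain ⟨w', hw'⟩ := C.exists_DU_eq huU ht (S.inner_ν_P hν w)
  have h1 : S.tangHess φ (C.F (u, t)) t w = C.DU (C.gradParam φ) (u, t) w' := by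
    rw [← C.tangHess_comp_DU hφ huU ht, ContinuousLinearMap.comp_apply, hw']
    simp only [EvolvingSurface.tangHess, ContinuousLinearMap.comp_apply]
    rw [S.P_eq_self (S.inner_ν_P hν w)]
  have h2 := hlow u hu t ht w'
  rw [hw'] at h2
  have h3 := S.norm_P_le hν w
  have h4 : ‖w'‖ ≤ 2 * ‖w‖ / m := by rw [le_div_iff₀ hm, mul_comm]; linarith
  rw [h1]
  calc _ ≤ L * ‖w'‖ := (ContinuousLinearMap.le_opNorm _ _).trans (by gcongr; exact hL (u, t) ⟨hu, ht⟩)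
    _ ≤ L * (2 * ‖w‖ / m) := by gcongr
    _ = _ := by ring

end Chart

/-! ### From local to uniform estimates by compactness -/

namespace EvolvingSurface

variable (S : EvolvingSurface)

/-- A local estimate on `Γ₀` holds with one constant for all pairs of points at small distance. -/
theorem uniform_of_local {Q : ℝ → E3 → E3 → Prop}
    (hmono : ∀ K K' Y Z, K ≤ K' → Q K Y Z → Q K' Y Z)
    (hloc : ∀ X ∈ S.Γ₀, ∃ W, IsOpen W ∧ X ∈ W ∧ ∃ K, ∀ Y ∈ S.Γ₀ ∩ W, ∀ Z ∈ S.Γ₀ ∩ W, Q K Y Z) :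
    ∃ K > 0, ∃ δ > 0, ∀ Y ∈ S.Γ₀, ∀ Z ∈ S.Γ₀, dist Y Z < δ → Q K Y Z := by
  choose W hW hXW K hK using hloc
  obtain ⟨s, hs⟩ := S.compact.elim_finite_subcover (fun X : S.Γ₀ => W X.1 X.2) (fun X => hW _ _)
    fun X hX => mem_iUnion.2 ⟨⟨X, hX⟩, hXW X hX⟩
  -- The Lebesgue number puts any two points at distance less than `δ` into one member of the finite
  -- subcover.
  obtain ⟨δ, hδ, hleb⟩ := lebesgue_number_lemma_of_metric S.compact
    (c := fun X : s => W X.1.1 X.1.2) (fun X => hW _ _) fun X hX => by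
      obtain ⟨i, hi, h⟩ := mem_iUnion₂.1 (hs hX)
      exact mem_iUnion.2 ⟨⟨i, hi⟩, h⟩
  refine ⟨∑ X ∈ s, |K X.1 X.2| + 1, by positivity, δ, hδ, fun Y hY Z hZ hYZ => ?_⟩
  obtain ⟨i, hi⟩ := hleb Y hY
  refine hmono (K i.1.1 i.1.2) _ Y Z ?_ (hK _ _ Y ⟨hY, hi (Metric.mem_ball_self hδ)⟩ Z
    ⟨hZ, hi (by rwa [Metric.mem_ball, dist_comm])⟩)
  have := Finset.single_le_sum (f := fun X : S.Γ₀ => |K X.1 X.2|) (fun _ _ => abs_nonneg _) i.2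
  have h2 := le_abs_self (K i.1.1 i.1.2)
  linarith

theorem continuousOn_Φ : ContinuousOn (fun p : E3 × ℝ => S.Φ p.1 p.2) (S.Γ₀ ×ˢ Icc 0 S.T) :=
  S.Φ_smooth.continuousOn

/-- Injectivity of each `Φ(·, t)` and compactness. It handles the pairs that `uniform_of_local`
leaves out: for them the right-hand sides of quadratic estimates are bounded below. -/
theorem exists_separation {δ : ℝ} (hδ : 0 < δ) : ∃ δ' > 0, ∀ X ∈ S.Γ₀, ∀ Y ∈ S.Γ₀, ∀ t ∈ Icc 0 S.T,
    δ ≤ dist X Y → δ' ≤ ‖S.Φ X t - S.Φ Y t‖ := by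
  have hM : IsCompact (((S.Γ₀ ×ˢ S.Γ₀) ∩ {q : E3 × E3 | δ ≤ dist q.1 q.2}) ×ˢ Icc 0 S.T) :=
    ((S.compact.prod S.compact).inter_right
      (isClosed_le continuous_const (by fun_prop))).prod isCompact_Icc
  obtain ⟨m, hm, h⟩ := Chart.exists_lower_bound (f := fun q : (E3 × E3) × ℝ =>
      ‖S.Φ q.1.1 q.2 - S.Φ q.1.2 q.2‖) hM (by
    refine ContinuousOn.norm (ContinuousOn.sub ?_ ?_)
    · exact S.continuousOn_Φ.comp (f := fun q : (E3 × E3) × ℝ => (q.1.1, q.2)) (by fun_prop)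
        fun q hq => ⟨hq.1.1.1, hq.2⟩
    · exact S.continuousOn_Φ.comp (f := fun q : (E3 × E3) × ℝ => (q.1.2, q.2)) (by fun_prop)
        fun q hq => ⟨hq.1.1.2, hq.2⟩) (by
    rintro ⟨⟨X, Y⟩, t⟩ ⟨⟨⟨hX, hY⟩, hXY⟩, ht⟩
    rw [norm_pos_iff, sub_ne_zero]
    intro h
    have := S.Φ_inj t ht hX hY h
    simp only at this
    simp only [mem_ofPred_eq, this, dist_self] at hXY
    linarith)
  exact ⟨m, hm, fun X hX Y hY t ht hXY => h ((X, Y), t) ⟨⟨⟨hX, hY⟩, hXY⟩, ht⟩⟩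

theorem exists_diam_bound : ∃ R > 0, ∀ t ∈ Icc 0 S.T, ∀ x ∈ S.Γ t, ∀ y ∈ S.Γ t, ‖x - y‖ ≤ R := by
  obtain ⟨R, hR⟩ := (S.compact.prod isCompact_Icc).exists_bound_of_continuousOn S.continuousOn_Φ
  refine ⟨2 * |R| + 1, by positivity, ?_⟩
  rintro t ht _ ⟨X, hX, rfl⟩ _ ⟨Y, hY, rfl⟩
  have h1 := hR (X, t) ⟨hX, ht⟩
  have h2 := hR (Y, t) ⟨hY, ht⟩
  have h3 := norm_sub_le (S.Φ X t) (S.Φ Y t)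
  have h4 := le_abs_self R
  simp only at h1 h2 ⊢
  linarith

/-- A function that is bounded in every chart is bounded by its supremum norm. -/
theorem norm_le_supNorm {E : Type*} [NormedAddCommGroup E] {g : E3 → ℝ → E}
    (hg : ∀ C : Chart S, ∃ L, ∀ u ∈ C.B, ∀ t ∈ Icc 0 S.T, ‖g (C.F (u, t)) t‖ ≤ L)
    {x : E3} {t : ℝ} (ht : t ∈ Icc 0 S.T) (hx : x ∈ S.Γ t) : ‖g x t‖ ≤ S.supNorm g := by
  obtain ⟨K, -, δ, hδ, h⟩ := S.uniform_of_local
    (Q := fun K Y _ => ∀ t ∈ Icc 0 S.T, ‖g (S.Φ Y t) t‖ ≤ K)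
    (fun K K' Y Z hKK h t ht => (h t ht).trans hKK) (fun X hX => by
      obtain ⟨C, hC⟩ := exists_chart S hX
      obtain ⟨L, hL⟩ := hg C
      refine ⟨C.W, C.isOpen_W, hC, L, fun Y hY _ _ t ht => ?_⟩
      obtain ⟨u, hu, rfl⟩ := C.cover hY
      exact hL u hu t ht)
  -- A real supremum over an unbounded family is zero by default, so boundedness must be proved
  -- before `supNorm` bounds anything.
  have hb : BddAbove (range fun p : S.spaceTime => ‖g p.1.1 p.1.2‖) := by
    refine ⟨K, ?_⟩
    rintro _ ⟨⟨⟨y, s⟩, hs, hy⟩, rfl⟩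
    change y ∈ S.Γ s at hy
    obtain ⟨Y, hY, rfl⟩ := S.exists_param hy
    exact h Y hY Y hY (by rwa [dist_self]) s hs
  exact le_ciSup hb ⟨(x, t), ht, hx⟩

theorem supNorm_nonneg {E : Type*} [NormedAddCommGroup E] (g : E3 → ℝ → E) : 0 ≤ S.supNorm g :=
  Real.iSup_nonneg fun _ => norm_nonneg _

end EvolvingSurface

/-! ### The material derivative and Taylor's formula in time -/

namespace Chart

variable {S : EvolvingSurface} (C : Chart S)

/-- The time derivative of a function on the parameter domain. -/
noncomputable def DT (g : E2 × ℝ → ℝ) (p : E2 × ℝ) : ℝ := fderivWithin ℝ g C.dom p (0, 1)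

theorem contDiffOn_DT {g : E2 × ℝ → ℝ} {m n : ℕ∞ω} (hg : ContDiffOn ℝ n g C.dom) (hmn : m + 1 ≤ n) :
    ContDiffOn ℝ m (C.DT g) C.dom :=
  (hg.fderivWithin C.uniqueDiffOn_dom hmn).clm_apply contDiffOn_const

theorem hasDerivWithinAt_slice {g : E2 × ℝ → ℝ} {u : E2} {t : ℝ}
    (hg : DifferentiableWithinAt ℝ g C.dom (u, t)) (hu : u ∈ C.U) :
    HasDerivWithinAt (fun s => g (u, s)) (C.DT g (u, t)) (Icc 0 S.T) t := by
  have h1 : HasFDerivWithinAt (fun s : ℝ => (u, s)) (ContinuousLinearMap.inr ℝ E2 ℝ) (Icc 0 S.T) t :=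
    (hasFDerivAt_prodMk_right u t).hasFDerivWithinAt
  have hmaps : MapsTo (fun s : ℝ => (u, s)) (Icc 0 S.T) C.dom := fun s hs => ⟨hu, hs⟩
  have h2 := (hg.hasFDerivWithinAt.comp t h1 hmaps).hasDerivWithinAt
  have h3 : ((fderivWithin ℝ g C.dom (u, t)).comp (ContinuousLinearMap.inr ℝ E2 ℝ)) 1 = C.DT g (u, t) := by
    simp [DT]
  rw [h3] at h2
  exact h2

/-- The label recovered from `F (u, t)` is `ψ u`, so the trajectory in the definition is `s ↦ F (u,
s)`. -/
theorem matDeriv_eq {φ : E3 → ℝ → ℝ} (hφ : S.IsC2 φ) {u : E2} {t : ℝ} (hu : u ∈ C.U) (ht : t ∈ Icc 0 S.T) :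
    S.matDeriv φ (C.F (u, t)) t = C.DT (C.pull φ) (u, t) := by
  have h := C.hasDerivWithinAt_slice ((C.contDiffOn_pull hφ).differentiableOn (by simp) (u, t) ⟨hu, ht⟩) hu
  rw [← h.derivWithin (uniqueDiffOn_Icc S.T_pos t ht), EvolvingSurface.matDeriv]
  simp only [F, S.invFunOn_Φ ht (C.mapsTo hu)]
  rfl

theorem matDeriv_matDeriv_eq {φ : E3 → ℝ → ℝ} (hφ : S.IsC2 φ) {u : E2} {t : ℝ} (hu : u ∈ C.U)
    (ht : t ∈ Icc 0 S.T) : S.matDeriv (S.matDeriv φ) (C.F (u, t)) t = C.DT (C.DT (C.pull φ)) (u, t) := by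
  have hd : ContDiffOn ℝ 1 (C.DT (C.pull φ)) C.dom := C.contDiffOn_DT (C.contDiffOn_pull hφ) (by norm_num)
  have h := C.hasDerivWithinAt_slice (hd.differentiableOn (by simp) (u, t) ⟨hu, ht⟩) hu
  rw [← h.derivWithin (uniqueDiffOn_Icc S.T_pos t ht)]
  change derivWithin (fun s => S.matDeriv φ _ s) _ _ = _
  simp only [F, S.invFunOn_Φ ht (C.mapsTo hu)]
  exact derivWithin_congr (fun s hs => C.matDeriv_eq hφ hu hs) (C.matDeriv_eq hφ hu ht)

theorem exists_bound_matDeriv {φ : E3 → ℝ → ℝ} (hφ : S.IsC2 φ) :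
    ∃ L, ∀ u ∈ C.B, ∀ t ∈ Icc 0 S.T, ‖S.matDeriv (S.matDeriv φ) (C.F (u, t)) t‖ ≤ L := by
  have hd : ContDiffOn ℝ 1 (C.DT (C.pull φ)) C.dom := C.contDiffOn_DT (C.contDiffOn_pull hφ) (by norm_num)
  obtain ⟨L, -, hL⟩ := C.exists_bound (C.contDiffOn_DT hd (m := 0) (by simp)).continuousOn
  refine ⟨L, fun u hu t ht => ?_⟩
  rw [C.matDeriv_matDeriv_eq hφ (C.B_subset hu) ht]
  exact hL (u, t) ⟨hu, ht⟩

end Chart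

variable {S : EvolvingSurface}

namespace EvolvingSurface

theorem IsC2.norm_tangGrad_le {φ : E3 → ℝ → ℝ} (hφ : S.IsC2 φ) {x : E3} {t : ℝ} (ht : t ∈ Icc 0 S.T)
    (hx : x ∈ S.Γ t) : ‖S.tangGrad φ x t‖ ≤ S.supNorm (S.tangGrad φ) :=
  S.norm_le_supNorm (fun C => C.exists_bound_tangGrad hφ) ht hx

theorem IsC2.norm_tangHess_le {φ : E3 → ℝ → ℝ} (hφ : S.IsC2 φ) {x : E3} {t : ℝ} (ht : t ∈ Icc 0 S.T)
    (hx : x ∈ S.Γ t) : ‖S.tangHess φ x t‖ ≤ S.supNorm (S.tangHess φ) :=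
  S.norm_le_supNorm (fun C => C.exists_bound_tangHess hφ) ht hx

theorem IsC2.abs_matDeriv_le {φ : E3 → ℝ → ℝ} (hφ : S.IsC2 φ) {x : E3} {t : ℝ} (ht : t ∈ Icc 0 S.T)
    (hx : x ∈ S.Γ t) : |S.matDeriv (S.matDeriv φ) x t| ≤ S.supNorm (S.matDeriv (S.matDeriv φ)) :=
  S.norm_le_supNorm (fun C => C.exists_bound_matDeriv hφ) ht hx

/-- Taylor's formula along the trajectories of the flow. -/
theorem IsC2.abs_time_taylor_le {φ : E3 → ℝ → ℝ} (hφ : S.IsC2 φ) {X : E3} (hX : X ∈ S.Γ₀) {t t' : ℝ}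
    (ht : t ∈ Icc 0 S.T) (ht' : t' ∈ Icc 0 S.T) (htt : t ≤ t') :
    |φ (S.Φ X t') t' - φ (S.Φ X t) t - S.matDeriv φ (S.Φ X t) t * (t' - t)| ≤
      S.supNorm (S.matDeriv (S.matDeriv φ)) * (t' - t) ^ 2 := by
  obtain ⟨C, hC⟩ := exists_chart S hX
  obtain ⟨u, hu, rfl⟩ := C.cover ⟨hX, hC⟩
  replace hu : u ∈ C.U := C.B_subset hu
  set M := S.supNorm (S.matDeriv (S.matDeriv φ))
  have hM : 0 ≤ M := S.supNorm_nonneg _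
  have hd : ContDiffOn ℝ 1 (C.DT (C.pull φ)) C.dom := C.contDiffOn_DT (C.contDiffOn_pull hφ) (by norm_num)
  have hsub : Icc t t' ⊆ Icc 0 S.T := Icc_subset_Icc ht.1 ht'.2
  have h1 : ∀ s ∈ Icc t t', ‖C.DT (C.pull φ) (u, s) - C.DT (C.pull φ) (u, t)‖ ≤ M * (t' - t) := by
    intro s hs
    have := (convex_Icc t t').norm_image_sub_le_of_norm_hasDerivWithin_le
      (f := fun s => C.DT (C.pull φ) (u, s)) (f' := fun s => C.DT (C.DT (C.pull φ)) (u, s)) (C := M)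
      (fun s hs => (C.hasDerivWithinAt_slice (hd.differentiableOn (by simp) (u, s) ⟨hu, hsub hs⟩) hu).mono hsub)
      (fun s hs => by
        rw [← C.matDeriv_matDeriv_eq hφ hu (hsub hs)]
        exact hφ.abs_matDeriv_le (hsub hs) (C.F_mem (p := (u, s)) ⟨hu, hsub hs⟩))
      (left_mem_Icc.2 htt) hs
    refine this.trans ?_
    gcongr
    rw [Real.norm_eq_abs, abs_of_nonneg (by linarith [hs.1])]
    linarith [hs.2]
  -- Mean value inequality for the function minus its linearization at `t`; by `h1` the derivative
  -- of the difference is at most `M * (t' - t)`.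
  have h2 := (convex_Icc t t').norm_image_sub_le_of_norm_hasDerivWithin_le
      (f := fun s => C.pull φ (u, s) - C.DT (C.pull φ) (u, t) * s)
      (f' := fun s => C.DT (C.pull φ) (u, s) - C.DT (C.pull φ) (u, t)) (C := M * (t' - t))
      (fun s hs => by
        have h := (C.hasDerivWithinAt_slice ((C.contDiffOn_pull hφ).differentiableOn (by simp)
          (u, s) ⟨hu, hsub hs⟩) hu).mono hsub
        have h' := h.sub ((hasDerivWithinAt_id s (Icc t t')).const_mul (C.DT (C.pull φ) (u, t)))
        rw [mul_one] at h'
        exact h') h1 (left_mem_Icc.2 htt) (right_mem_Icc.2 htt)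
  rw [Real.norm_eq_abs, Real.norm_eq_abs, abs_of_nonneg (by linarith : 0 ≤ t' - t)] at h2
  have h3 : S.matDeriv φ (S.Φ (C.ψ u) t) t = C.DT (C.pull φ) (u, t) := C.matDeriv_eq hφ hu ht
  rw [h3]
  calc _ = |C.pull φ (u, t') - C.DT (C.pull φ) (u, t) * t' -
        (C.pull φ (u, t) - C.DT (C.pull φ) (u, t) * t)| := by
        simp only [Chart.pull, Chart.F]
        ring_nf
    _ ≤ _ := h2.trans (le_of_eq (by ring))

end EvolvingSurface

/-! ### Taylor estimates in space and deviation from the tangent plane -/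

namespace Chart

variable (C : Chart S)

theorem hasFDerivAt_pull {φ : E3 → ℝ → ℝ} (hφ : S.IsC2 φ) {u : E2} {t : ℝ} (hu : u ∈ C.U)
    (ht : t ∈ Icc 0 S.T) : HasFDerivAt (fun v => φ (C.F (v, t)) t)
      ((innerSL ℝ (S.tangGrad φ (C.F (u, t)) t)).comp (C.DU C.F (u, t))) u := by
  have h1 := C.hasFDerivAt_slice ((C.contDiffOn_pull hφ).differentiableOn (by simp) (u, t) ⟨hu, ht⟩) hu ht
  have h2 : (innerSL ℝ (S.tangGrad φ (C.F (u, t)) t)).comp (C.DU C.F (u, t)) = C.DU (C.pull φ) (u, t) := by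
    ext1 w
    simpa using C.inner_tangGrad_DU hφ hu ht w
  rw [h2]
  exact h1

theorem exists_bound_DU : ∃ L > 0, ∀ u ∈ C.B, ∀ t ∈ Icc 0 S.T, ‖C.DU C.F (u, t)‖ ≤ L := by
  obtain ⟨L, hL0, hL⟩ := C.exists_bound (C.contDiffOn_DU C.contDiffOn_F (m := 0) (by simp)).continuousOn
  exact ⟨L, hL0, fun u hu t ht => hL (u, t) ⟨hu, ht⟩⟩

/-- First and second order Taylor estimates on the surface, in a chart. -/
theorem exists_space_taylor : ∃ L > 0, ∀ φ, S.IsC2 φ → ∀ u ∈ C.B, ∀ v ∈ C.B, ∀ t ∈ Icc 0 S.T,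
    |φ (C.F (v, t)) t - φ (C.F (u, t)) t| ≤ L * S.supNorm (S.tangGrad φ) ∧
    |φ (C.F (v, t)) t - φ (C.F (u, t)) t -
        inner ℝ (S.tangGrad φ (C.F (u, t)) t) (C.F (v, t) - C.F (u, t))| ≤
      L * S.supNorm (S.tangHess φ) * ‖C.F (v, t) - C.F (u, t)‖ ^ 2 := by
  obtain ⟨L, hL0, hL⟩ := C.exists_bound_DU
  obtain ⟨m, hm, hexp⟩ := C.exists_expanding
  obtain ⟨D, hD⟩ := Metric.isBounded_iff.1 C.isCompact_B.isBounded
  refine ⟨L * |D| + L ^ 2 / m ^ 2 , by positivity, fun φ hφ u hu v hv t ht => ⟨?_, ?_⟩⟩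
  · have := C.convex_B.norm_image_sub_le_of_norm_hasFDerivWithin_le
      (C := S.supNorm (S.tangGrad φ) * L)
      (fun w hw => (C.hasFDerivAt_pull hφ (C.B_subset hw) ht).hasFDerivWithinAt) (fun w hw => by
        refine (ContinuousLinearMap.opNorm_comp_le _ _).trans ?_
        rw [innerSL_apply_norm]
        gcongr
        · exact S.supNorm_nonneg _
        · exact hφ.norm_tangGrad_le ht (C.F_mem (p := (w, t)) ⟨C.B_subset hw, ht⟩)
        · exact hL w hw t ht) hu hv
    refine this.trans ?_
    have h1 : ‖v - u‖ ≤ |D| := by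
      rw [← dist_eq_norm]
      exact (hD hv hu).trans (le_abs_self _)
    have h2 := S.supNorm_nonneg (S.tangGrad φ)
    calc _ ≤ S.supNorm (S.tangGrad φ) * L * |D| := by gcongr
      _ = L * |D| * S.supNorm (S.tangGrad φ) := by ring
      _ ≤ _ := by gcongr; simp; positivity
  · set M := S.supNorm (S.tangHess φ)
    have hM : 0 ≤ M := S.supNorm_nonneg _
    set G := S.tangGrad φ (C.F (u, t)) t
    -- The gradient moves by at most `M L ‖w - u‖` over the chart. In `h2` this bounds the
    -- derivative of `φ - G · F`, whose increment is the Taylor remainder.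
    have h1 : ∀ w ∈ C.B, ‖S.tangGrad φ (C.F (w, t)) t - G‖ ≤ M * L * ‖w - u‖ := fun w hw =>
      C.convex_B.norm_image_sub_le_of_norm_hasFDerivWithin_le
        (f := fun w => S.tangGrad φ (C.F (w, t)) t)
        (f' := fun w => (S.tangHess φ (C.F (w, t)) t).comp (C.DU C.F (w, t))) (C := M * L)
        (fun w hw => (C.hasFDerivAt_tangGrad hφ (C.B_subset hw) ht).hasFDerivWithinAt) (fun w hw => by
          refine (ContinuousLinearMap.opNorm_comp_le _ _).trans ?_
          gcongr
          · exact hφ.norm_tangHess_le ht (C.F_mem (p := (w, t)) ⟨C.B_subset hw, ht⟩)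
          · exact hL w hw t ht) hu hw
    have hseg : segment ℝ u v ⊆ C.B := C.convex_B.segment_subset hu hv
    have h2 := (convex_segment (𝕜 := ℝ) u v).norm_image_sub_le_of_norm_hasFDerivWithin_le
      (f := fun w => φ (C.F (w, t)) t - inner ℝ G (C.F (w, t)))
      (f' := fun w => (innerSL ℝ (S.tangGrad φ (C.F (w, t)) t - G)).comp (C.DU C.F (w, t)))
      (C := M * L * ‖v - u‖ * L)
      (fun w hw => by
        have h3 := (C.hasFDerivAt_pull hφ (C.B_subset (hseg hw)) ht).sub
          ((innerSL ℝ G).hasFDerivAt.comp w (C.hasFDerivAt_F (C.B_subset (hseg hw)) ht))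
        rw [← ContinuousLinearMap.sub_comp, ← map_sub] at h3
        exact h3.hasFDerivWithinAt) (fun w hw => by
        refine (ContinuousLinearMap.opNorm_comp_le _ _).trans ?_
        rw [innerSL_apply_norm]
        gcongr
        · refine (h1 w (hseg hw)).trans ?_
          gcongr
          exact norm_sub_le_of_mem_segment hw
        · exact hL w (hseg hw) t ht) (left_mem_segment _ _ _) (right_mem_segment _ _ _)
    have h4 := hexp u hu v hv t ht
    have h5 : ‖v - u‖ ≤ ‖C.F (v, t) - C.F (u, t)‖ / m := by rw [le_div_iff₀ hm, mul_comm]; exact h4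
    calc _ = ‖φ (C.F (v, t)) t - inner ℝ G (C.F (v, t)) -
          (φ (C.F (u, t)) t - inner ℝ G (C.F (u, t)))‖ := by
          rw [Real.norm_eq_abs, inner_sub_right]
          ring_nf
      _ ≤ M * L * ‖v - u‖ * L * ‖v - u‖ := h2
      _ = M * L ^ 2 * ‖v - u‖ ^ 2 := by ring
      _ ≤ M * L ^ 2 * (‖C.F (v, t) - C.F (u, t)‖ / m) ^ 2 := by gcongr
      _ = L ^ 2 / m ^ 2 * M * ‖C.F (v, t) - C.F (u, t)‖ ^ 2 := by ring
      _ ≤ _ := by gcongr; simp; positivity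

/-- The increment of `F` differs from a tangent vector, which the normal does not see, by a
quadratic remainder. -/
theorem exists_normal_estimate : ∃ L > 0, ∀ u ∈ C.B, ∀ v ∈ C.B, ∀ t ∈ Icc 0 S.T,
    |inner ℝ (S.ν (C.F (u, t)) t) (C.F (v, t) - C.F (u, t))| ≤ L * ‖C.F (v, t) - C.F (u, t)‖ ^ 2 := by
  obtain ⟨L, hL0, hL⟩ := C.exists_taylor
  obtain ⟨m, hm, hexp⟩ := C.exists_expanding
  refine ⟨L / m ^ 2, by positivity, fun u hu v hv t ht => ?_⟩
  have h4 := hexp u hu v hv t ht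
  have h5 : ‖v - u‖ ≤ ‖C.F (v, t) - C.F (u, t)‖ / m := by rw [le_div_iff₀ hm, mul_comm]; exact h4
  have hν := S.ν_unit t ht _ (C.F_mem (p := (u, t)) ⟨C.B_subset hu, ht⟩)
  have h1 : inner ℝ (S.ν (C.F (u, t)) t) (C.F (v, t) - C.F (u, t)) =
      inner ℝ (S.ν (C.F (u, t)) t) (C.F (v, t) - C.F (u, t) - C.DU C.F (u, t) (v - u)) := by
    rw [inner_sub_right _ _ (C.DU C.F (u, t) (v - u)), C.inner_ν_DU (C.B_subset hu) ht, sub_zero]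
  rw [h1]
  refine (abs_real_inner_le_norm _ _).trans ?_
  rw [hν, one_mul]
  calc _ ≤ L * ‖v - u‖ ^ 2 := hL u hu v hv t ht
    _ ≤ L * (‖C.F (v, t) - C.F (u, t)‖ / m) ^ 2 := by gcongr
    _ = _ := by ring

end Chart

namespace EvolvingSurface

variable (S)

/-- The surfaces deviate from their tangent planes quadratically, uniformly in time. -/
theorem exists_normal_estimate : ∃ L > 0, ∀ t ∈ Icc 0 S.T, ∀ x ∈ S.Γ t, ∀ y ∈ S.Γ t,
    |inner ℝ (S.ν x t) (y - x)| ≤ L * ‖y - x‖ ^ 2 := by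
  obtain ⟨K, hK, δ, hδ, h⟩ := S.uniform_of_local (Q := fun K X Y => ∀ t ∈ Icc 0 S.T,
      |inner ℝ (S.ν (S.Φ X t) t) (S.Φ Y t - S.Φ X t)| ≤ K * ‖S.Φ Y t - S.Φ X t‖ ^ 2)
    (fun K K' Y Z hKK h t ht => (h t ht).trans (by gcongr)) (fun X hX => by
      obtain ⟨C, hC⟩ := exists_chart S hX
      obtain ⟨L, -, hL⟩ := C.exists_normal_estimate
      refine ⟨C.W, C.isOpen_W, hC, L, fun Y hY Z hZ t ht => ?_⟩
      obtain ⟨u, hu, rfl⟩ := C.cover hY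
      obtain ⟨v, hv, rfl⟩ := C.cover hZ
      exact hL u hu v hv t ht)
  obtain ⟨δ', hδ', hsep⟩ := S.exists_separation hδ
  -- The term `1 / δ'` serves the distant pairs: there `‖y - x‖ ≤ ‖y - x‖² / δ'`.
  refine ⟨K + 1 / δ', by positivity, ?_⟩
  rintro t ht _ ⟨X, hX, rfl⟩ _ ⟨Y, hY, rfl⟩
  simp only
  rcases lt_or_ge (dist X Y) δ with hd | hd
  · refine (h X hX Y hY hd t ht).trans ?_
    gcongr
    simp
    positivity
  · have h1 := hsep X hX Y hY t ht hd
    rw [norm_sub_rev] at h1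
    refine (abs_real_inner_le_norm _ _).trans ?_
    rw [S.ν_unit t ht _ (mem_image_of_mem _ hX), one_mul]
    calc ‖S.Φ Y t - S.Φ X t‖ = 1 / δ' * (δ' * ‖S.Φ Y t - S.Φ X t‖) := by field_simp
      _ ≤ 1 / δ' * (‖S.Φ Y t - S.Φ X t‖ * ‖S.Φ Y t - S.Φ X t‖) := by gcongr
      _ ≤ (K + 1 / δ') * (‖S.Φ Y t - S.Φ X t‖ * ‖S.Φ Y t - S.Φ X t‖) := by
        gcongr
        linarith
      _ = _ := by ring

/-- Oscillations are controlled by the tangential gradient. -/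
theorem exists_oscillation : ∃ L > 0, ∀ φ, S.IsC2 φ → ∀ t ∈ Icc 0 S.T, ∀ x ∈ S.Γ t, ∀ y ∈ S.Γ t,
    |φ y t - φ x t| ≤ L * S.supNorm (S.tangGrad φ) := by
  obtain ⟨K, hK, δ, hδ, h⟩ := S.uniform_of_local (Q := fun K X Y => ∀ φ, S.IsC2 φ → ∀ t ∈ Icc 0 S.T,
      |φ (S.Φ Y t) t - φ (S.Φ X t) t| ≤ K * S.supNorm (S.tangGrad φ))
    (fun K K' Y Z hKK h φ hφ t ht => (h φ hφ t ht).trans (by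
      gcongr
      exact S.supNorm_nonneg _)) (fun X hX => by
      obtain ⟨C, hC⟩ := exists_chart S hX
      obtain ⟨L, -, hL⟩ := C.exists_space_taylor
      refine ⟨C.W, C.isOpen_W, hC, L, fun Y hY Z hZ φ hφ t ht => ?_⟩
      obtain ⟨u, hu, rfl⟩ := C.cover hY
      obtain ⟨v, hv, rfl⟩ := C.cover hZ
      exact (hL φ hφ u hu v hv t ht).1)
  obtain ⟨X₀, hX₀⟩ := S.connected.nonempty
  -- Straight segments leave the surface, so the bound is passed along chains of nearby points: it
  -- holds locally and is transitive, hence holds for all pairs by connectedness. The constant may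
  -- still depend on `X`, but not on `φ` or `t`.
  have hall : ∀ X ∈ S.Γ₀, ∃ K, ∀ φ, S.IsC2 φ → ∀ t ∈ Icc 0 S.T,
      |φ (S.Φ X t) t - φ (S.Φ X₀ t) t| ≤ K * S.supNorm (S.tangGrad φ) := by
    intro X hX
    refine S.connected.isPreconnected.induction₂' (fun Y Z => ∃ K, ∀ φ, S.IsC2 φ → ∀ t ∈ Icc 0 S.T,
      |φ (S.Φ Z t) t - φ (S.Φ Y t) t| ≤ K * S.supNorm (S.tangGrad φ)) ?_ ?_ hX₀ hX
    · intro Y hY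
      filter_upwards [self_mem_nhdsWithin, mem_nhdsWithin_of_mem_nhds (Metric.ball_mem_nhds Y hδ)] with Z hZ hYZ
      exact ⟨⟨K, h Y hY Z hZ (by rwa [dist_comm])⟩, ⟨K, h Z hZ Y hY hYZ⟩⟩
    · rintro Y Z A - - - ⟨K₁, h₁⟩ ⟨K₂, h₂⟩
      refine ⟨K₁ + K₂, fun φ hφ t ht => ?_⟩
      have := abs_sub_le (φ (S.Φ A t) t) (φ (S.Φ Z t) t) (φ (S.Φ Y t) t)
      have a1 := h₁ φ hφ t ht
      have a2 := h₂ φ hφ t ht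
      linarith
  -- A second compactness argument removes the dependence of the constant on the point.
  obtain ⟨K', hK', δ', hδ', h'⟩ := S.uniform_of_local (Q := fun K X _ => ∀ φ, S.IsC2 φ → ∀ t ∈ Icc 0 S.T,
      |φ (S.Φ X t) t - φ (S.Φ X₀ t) t| ≤ K * S.supNorm (S.tangGrad φ))
    (fun K K' Y Z hKK h φ hφ t ht => (h φ hφ t ht).trans (by
      gcongr
      exact S.supNorm_nonneg _)) (fun X hX => by
      obtain ⟨K₁, h₁⟩ := hall X hX
      refine ⟨Metric.ball X δ, Metric.isOpen_ball, Metric.mem_ball_self hδ, K₁ + K,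
        fun Y hY _ _ φ hφ t ht => ?_⟩
      have := abs_sub_le (φ (S.Φ Y t) t) (φ (S.Φ X t) t) (φ (S.Φ X₀ t) t)
      have a1 := h₁ φ hφ t ht
      have hYX : dist Y X < δ := hY.2
      have a2 := h X hX Y hY.1 (by rwa [dist_comm]) φ hφ t ht
      linarith)
  refine ⟨K' + K', by positivity, ?_⟩
  rintro φ hφ t ht _ ⟨X, hX, rfl⟩ _ ⟨Y, hY, rfl⟩
  have a1 := h' X hX X hX (by rwa [dist_self]) φ hφ t ht
  have a2 := h' Y hY Y hY (by rwa [dist_self]) φ hφ t ht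
  have := abs_sub_le (φ (S.Φ Y t) t) (φ (S.Φ X₀ t) t) (φ (S.Φ X t) t)
  rw [abs_sub_comm (φ (S.Φ X₀ t) t)] at this
  simp only
  linarith

/-- The second order Taylor estimate on the surface. -/
theorem exists_space_taylor : ∃ L > 0, ∀ φ, S.IsC2 φ → ∀ t ∈ Icc 0 S.T, ∀ x ∈ S.Γ t, ∀ y ∈ S.Γ t,
    |φ y t - φ x t - inner ℝ (S.tangGrad φ x t) (y - x)| ≤
      L * (S.supNorm (S.tangGrad φ) + S.supNorm (S.tangHess φ)) * ‖y - x‖ ^ 2 := by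
  obtain ⟨K, hK, δ, hδ, h⟩ := S.uniform_of_local (Q := fun K X Y => ∀ φ, S.IsC2 φ → ∀ t ∈ Icc 0 S.T,
      |φ (S.Φ Y t) t - φ (S.Φ X t) t - inner ℝ (S.tangGrad φ (S.Φ X t) t) (S.Φ Y t - S.Φ X t)| ≤
        K * S.supNorm (S.tangHess φ) * ‖S.Φ Y t - S.Φ X t‖ ^ 2)
    (fun K K' Y Z hKK h φ hφ t ht => (h φ hφ t ht).trans (by
      gcongr
      exact S.supNorm_nonneg _)) (fun X hX => by
      obtain ⟨C, hC⟩ := exists_chart S hX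
      obtain ⟨L, -, hL⟩ := C.exists_space_taylor
      refine ⟨C.W, C.isOpen_W, hC, L, fun Y hY Z hZ φ hφ t ht => ?_⟩
      obtain ⟨u, hu, rfl⟩ := C.cover hY
      obtain ⟨v, hv, rfl⟩ := C.cover hZ
      exact (hL φ hφ u hu v hv t ht).2)
  obtain ⟨δ', hδ', hsep⟩ := S.exists_separation hδ
  obtain ⟨L, hL, hosc⟩ := S.exists_oscillation
  -- For distant pairs no expansion is used: the oscillation and the linear term are bounded by `L
  -- G` and `G ‖y - x‖`, and `‖y - x‖ ≥ δ'` turns both into multiples of `‖y - x‖²`.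
  refine ⟨K + (L / δ' ^ 2 + 1 / δ'), by positivity, ?_⟩
  rintro φ hφ t ht _ ⟨X, hX, rfl⟩ _ ⟨Y, hY, rfl⟩
  have hG := S.supNorm_nonneg (S.tangGrad φ)
  have hH := S.supNorm_nonneg (S.tangHess φ)
  simp only
  rcases lt_or_ge (dist X Y) δ with hd | hd
  · refine (h X hX Y hY hd φ hφ t ht).trans ?_
    gcongr
    · simp
      positivity
    · linarith
  · have h1 := hsep X hX Y hY t ht hd
    rw [norm_sub_rev] at h1
    have h2 := hosc φ hφ t ht (S.Φ X t) (mem_image_of_mem _ hX) (S.Φ Y t) (mem_image_of_mem _ hY)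
    have h3 := abs_real_inner_le_norm (S.tangGrad φ (S.Φ X t) t) (S.Φ Y t - S.Φ X t)
    have h4 := hφ.norm_tangGrad_le ht (x := S.Φ X t) (mem_image_of_mem _ hX)
    set G := S.supNorm (S.tangGrad φ)
    set D := ‖S.Φ Y t - S.Φ X t‖
    have h5 := abs_sub (φ (S.Φ Y t) t - φ (S.Φ X t) t) (inner ℝ (S.tangGrad φ (S.Φ X t) t) (S.Φ Y t - S.Φ X t))
    have h6 : ‖S.tangGrad φ (S.Φ X t) t‖ * D ≤ G * D := by gcongr
    have h7 : L * G ≤ L / δ' ^ 2 * G * D ^ 2 := by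
      calc L * G = L / δ' ^ 2 * G * δ' ^ 2 := by field_simp
        _ ≤ _ := by gcongr
    have h8 : G * D ≤ 1 / δ' * G * D ^ 2 := by
      calc G * D = 1 / δ' * G * (δ' * D) := by field_simp
        _ ≤ 1 / δ' * G * (D * D) := by gcongr
        _ = _ := by ring
    calc _ ≤ (L / δ' ^ 2 + 1 / δ') * G * D ^ 2 := by linarith
      _ ≤ _ := by
        refine mul_le_mul_of_nonneg_right (mul_le_mul ?_ ?_ hG (by positivity)) (by positivity)
        · linarith
        · linarith

variable {S} in
/-- The connecting vector to a closest point is normal. -/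
theorem exists_closest_eq {t : ℝ} (ht : t ∈ Icc 0 S.T) {x z : E3} (h : IsClosestPoint (S.Γ t) z x) :
    ∃ σ : ℝ, z - x = σ • S.ν x t := by
  obtain ⟨X, hX, rfl⟩ := S.exists_param h.1
  obtain ⟨C, hC⟩ := exists_chart S hX
  obtain ⟨u, hu, rfl⟩ := C.cover ⟨hX, hC⟩
  replace hu : u ∈ C.U := C.B_subset hu
  change ∃ σ : ℝ, z - C.F (u, t) = σ • S.ν (C.F (u, t)) t
  -- First order condition: in a chart the squared distance to `z` has a local minimum at `u`, so `z
  -- - x` is orthogonal to all tangent vectors, including its own tangential projection.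
  have hmin : IsLocalMin (fun v => ‖C.F (v, t) - z‖ ^ 2) u := by
    filter_upwards [C.isOpen_U.mem_nhds hu] with v hv
    have h1 := Metric.infDist_le_dist_of_mem (x := z) (C.F_mem (p := (v, t)) ⟨hv, ht⟩)
    rw [← h.2, dist_comm, dist_comm z, dist_eq_norm, dist_eq_norm] at h1
    change ‖S.Φ (C.ψ u) t - z‖ ^ 2 ≤ _
    gcongr
  have hd := hmin.hasFDerivAt_eq_zero (((C.hasFDerivAt_F hu ht).sub_const z).norm_sq)
  have h0 : ∀ w, inner ℝ (C.F (u, t) - z) (C.DU C.F (u, t) w) = 0 := by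
    intro w
    have := congrArg (fun f : E2 →L[ℝ] ℝ => f w) hd
    simp only [smul_apply, ContinuousLinearMap.comp_apply, innerSL_apply_apply,
      zero_apply, smul_eq_zero, OfNat.ofNat_ne_zero, false_or] at this
    exact this
  have hν := S.ν_unit t ht _ (C.F_mem (p := (u, t)) ⟨hu, ht⟩)
  obtain ⟨w', hw'⟩ := C.exists_DU_eq hu ht (S.inner_ν_P hν (z - C.F (u, t)))
  have h1 := h0 w'
  rw [hw', ← neg_sub z, inner_neg_left, neg_eq_zero, ← S.inner_P_left _ _ _ _ (S.inner_ν_P hν _),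
    inner_self_eq_zero, S.P_apply, sub_eq_zero] at h1
  exact ⟨_, h1⟩

end EvolvingSurface

/-! ### Linear algebra of two uniformly independent unit vectors -/

/-- Two unit vectors whose angle has a sine of at least `σ`. -/
structure IsCorner (σ : ℝ) (e f : E3) : Prop where
  norm_left : ‖e‖ = 1
  norm_right : ‖f‖ = 1
  pos : 0 < σ
  sin : σ ^ 2 ≤ 1 - inner ℝ e f ^ 2

namespace IsCorner

variable {σ : ℝ} {e f : E3} (h : IsCorner σ e f)
include h

theorem symm : IsCorner σ f e := ⟨h.norm_right, h.norm_left, h.pos, by rw [real_inner_comm]; exact h.sin⟩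

theorem abs_inner_le : |inner ℝ e f| ≤ 1 := by
  have := abs_real_inner_le_norm e f
  rwa [h.norm_left, h.norm_right, one_mul] at this

theorem le_one_add : σ ^ 2 / 2 ≤ 1 + inner ℝ e f := by
  have h1 := abs_le.1 h.abs_inner_le
  nlinarith [h.sin]

theorem le_one_sub : σ ^ 2 / 2 ≤ 1 - inner ℝ e f := by
  have h1 := abs_le.1 h.abs_inner_le
  nlinarith [h.sin]

theorem one_add_pos : 0 < 1 + inner ℝ e f := by
  have := h.le_one_add
  have := h.pos
  nlinarith

theorem le_one : σ ≤ 1 := by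
  have := h.sin
  have := h.pos
  nlinarith [sq_nonneg (inner ℝ e f : ℝ)]

theorem norm_sq_comb (μ μ' : ℝ) :
    ‖μ • e + μ' • f‖ ^ 2 = (μ + inner ℝ e f * μ') ^ 2 + (1 - inner ℝ e f ^ 2) * μ' ^ 2 := by
  rw [@norm_add_sq_real, norm_smul, norm_smul, h.norm_left, h.norm_right, inner_smul_left, inner_smul_right,
    mul_one, mul_one, Real.norm_eq_abs, Real.norm_eq_abs, sq_abs, sq_abs]
  simp only [conj_trivial]
  ring

theorem inner_left_comb (μ μ' : ℝ) : inner ℝ (μ • e + μ' • f) e = μ + inner ℝ e f * μ' := by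
  rw [inner_add_left, inner_smul_left, inner_smul_left, real_inner_self_eq_norm_sq, h.norm_left,
    real_inner_comm]
  simp only [conj_trivial]
  ring

theorem inner_right_comb (μ μ' : ℝ) : inner ℝ (μ • e + μ' • f) f = inner ℝ e f * μ + μ' := by
  rw [inner_add_left, inner_smul_left, inner_smul_left, real_inner_self_eq_norm_sq, h.norm_right]
  simp only [conj_trivial]
  ring

/-- In `norm_sq_comb` the second square alone is at least `σ² μ'²`. -/
theorem abs_right_coeff_le (μ μ' : ℝ) : |μ'| ≤ ‖μ • e + μ' • f‖ / σ := by
  have hσ := h.pos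
  rw [le_div_iff₀ hσ]
  refine abs_le_of_sq_le_sq' ?_ (norm_nonneg _) |>.2
  rw [h.norm_sq_comb, mul_pow, sq_abs]
  nlinarith [h.sin, sq_nonneg (μ + inner ℝ e f * μ'), sq_nonneg μ']

theorem abs_left_coeff_le (μ μ' : ℝ) : |μ| ≤ ‖μ • e + μ' • f‖ / σ := by
  rw [add_comm]
  exact h.symm.abs_right_coeff_le μ' μ

theorem coeff_eq_zero {μ μ' : ℝ} (h0 : μ • e + μ' • f = 0) : μ = 0 ∧ μ' = 0 := by
  have h1 := h.abs_left_coeff_le μ μ'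
  have h2 := h.abs_right_coeff_le μ μ'
  rw [h0, norm_zero, zero_div] at h1 h2
  exact ⟨abs_nonpos_iff.1 h1, abs_nonpos_iff.1 h2⟩

/-- Expand `‖w‖²` as the combination of the two inner products, bound each coefficient by `‖w‖ / σ`,
and cancel one factor `‖w‖`. -/
theorem norm_comb_le {μ μ' a : ℝ} (h1 : |inner ℝ (μ • e + μ' • f) e| ≤ a)
    (h2 : |inner ℝ (μ • e + μ' • f) f| ≤ a) : ‖μ • e + μ' • f‖ ≤ 2 * a / σ := by
  have hσ := h.pos
  set w := μ • e + μ' • f with hw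
  have h3 : ‖w‖ ^ 2 = μ * inner ℝ w e + μ' * inner ℝ w f := by
    rw [← real_inner_self_eq_norm_sq, ← inner_smul_right, ← inner_smul_right, ← inner_add_right]
  have h4 : μ * inner ℝ w e ≤ ‖w‖ / σ * a := by
    refine (le_abs_self _).trans ?_
    rw [abs_mul]
    exact mul_le_mul (h.abs_left_coeff_le μ μ') h1 (abs_nonneg _) (by positivity)
  have h5 : μ' * inner ℝ w f ≤ ‖w‖ / σ * a := by
    refine (le_abs_self _).trans ?_
    rw [abs_mul]
    exact mul_le_mul (h.abs_right_coeff_le μ μ') h2 (abs_nonneg _) (by positivity)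
  have h6 : ‖w‖ * ‖w‖ ≤ ‖w‖ * (2 * a / σ) := by
    have : ‖w‖ * (2 * a / σ) = ‖w‖ / σ * a + ‖w‖ / σ * a := by ring
    rw [this]
    nlinarith
  rcases (norm_nonneg w).eq_or_lt with h7 | h7
  · rw [← h7]
    have := (abs_nonneg _).trans h1
    positivity
  · exact le_of_mul_le_mul_left h6 h7

/-- A unit normal to the plane of the corner, with the resulting decomposition of all vectors. -/
theorem exists_normal : ∃ N : E3, ‖N‖ = 1 ∧ inner ℝ N e = 0 ∧ inner ℝ N f = 0 ∧
    ∀ v, ∃ μ μ' : ℝ, v = μ • e + μ' • f + inner ℝ N v • N := by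
  set s := Submodule.span ℝ {e, f} with hs
  have hfin : Module.finrank ℝ s = 2 := by
    have hli : LinearIndependent ℝ ![e, f] := by
      rw [LinearIndependent.pair_iff]
      intro μ μ' h0
      exact h.coeff_eq_zero h0
    have := finrank_span_eq_card hli
    have hr : range ![e, f] = {e, f} := by
      ext x
      simp only [Matrix.range_cons, Matrix.range_empty, union_empty, singleton_union]
    rw [hs, ← hr, this]
    simp
  have horth : Module.finrank ℝ sᗮ = 1 := by
    have := s.finrank_add_finrank_orthogonal
    rw [hfin] at this
    simp at this
    omega
  obtain ⟨⟨N₀, hN₀⟩, hN₀0, -⟩ := finrank_eq_one_iff'.1 horth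
  have hN₀' : N₀ ≠ 0 := fun h0 => hN₀0 (by simp [h0])
  set N := ‖N₀‖⁻¹ • N₀ with hN
  have hN1 : ‖N‖ = 1 := by simp [hN, norm_smul, hN₀']
  have hNs : N ∈ sᗮ := sᗮ.smul_mem _ hN₀
  refine ⟨N, hN1, ?_, ?_, fun v => ?_⟩
  · rw [real_inner_comm]
    exact hNs e (Submodule.subset_span (by simp))
  · rw [real_inner_comm]
    exact hNs f (Submodule.subset_span (by simp))
  · have hle : s ≤ (Submodule.span ℝ {N})ᗮ := by
      intro w hw
      rw [Submodule.mem_orthogonal_singleton_iff_inner_left]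
      exact hNs w hw
    have heq : s = (Submodule.span ℝ {N})ᗮ := by
      refine Submodule.eq_of_le_of_finrank_eq hle ?_
      have : Fact (Module.finrank ℝ E3 = 2 + 1) := ⟨by simp⟩
      rw [Submodule.finrank_orthogonal_span_singleton (n := 2) (by
        intro h0
        rw [h0] at hN1
        simp at hN1), hfin]
    have hv : v - inner ℝ N v • N ∈ s := by
      rw [heq, Submodule.mem_orthogonal_singleton_iff_inner_right, inner_sub_right, inner_smul_right,
        real_inner_self_eq_norm_sq, hN1]
      ring
    obtain ⟨μ, μ', h1⟩ := Submodule.mem_span_pair.1 hv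
    exact ⟨μ, μ', by rw [h1]; abel⟩

/-- A unit vector that is nearly orthogonal to the plane of a corner is nearly parallel to the normal. -/
theorem le_abs_inner_normal {N n : E3} (hN : ‖N‖ = 1) (hNe : inner ℝ N e = 0) (hNf : inner ℝ N f = 0)
    (hdec : ∀ v, ∃ μ μ' : ℝ, v = μ • e + μ' • f + inner ℝ N v • N) (hn : ‖n‖ = 1) {a : ℝ}
    (h1 : |inner ℝ n e| ≤ a) (h2 : |inner ℝ n f| ≤ a) : 1 - 2 * a / σ ≤ |inner ℝ N n| := by
  obtain ⟨μ, μ', h3⟩ := hdec n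
  have h4 : ‖μ • e + μ' • f‖ ≤ 2 * a / σ := by
    have h5 : μ • e + μ' • f = n - inner ℝ N n • N := by
      conv_rhs => rw [h3]
      rw [inner_add_right, inner_add_right, inner_smul_right, inner_smul_right, hNe, hNf, inner_smul_right,
        real_inner_self_eq_norm_sq, hN]
      simp
    refine h.norm_comb_le ?_ ?_
    · rw [h5, inner_sub_left, inner_smul_left, hNe]
      simpa using h1
    · rw [h5, inner_sub_left, inner_smul_left, hNf]
      simpa using h2
  have h6 : ‖n‖ ≤ ‖μ • e + μ' • f‖ + ‖(inner ℝ N n : ℝ) • N‖ := by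
    conv_lhs => rw [h3]
    exact norm_add_le _ _
  rw [norm_smul, hN, hn, Real.norm_eq_abs] at h6
  linarith

/-- Comparison of a vector in the plane of a corner with a vector orthogonal to an approximate normal. -/
theorem norm_sub_le {n G : E3} {μ μ' a b : ℝ} (hn : ‖n‖ = 1) (hG : inner ℝ n G = 0)
    (h1 : |inner ℝ n e| ≤ b) (h2 : |inner ℝ n f| ≤ b)
    (h3 : |inner ℝ (μ • e + μ' • f - G) e| ≤ a) (h4 : |inner ℝ (μ • e + μ' • f - G) f| ≤ a) :
    ‖μ • e + μ' • f - G‖ ≤ 2 * a / σ + 4 * b / σ * ‖G‖ := by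
  obtain ⟨N, hN, hNe, hNf, hdec⟩ := h.exists_normal
  have hσ := h.pos
  have hb : 0 ≤ b := (abs_nonneg _).trans h1
  obtain ⟨α, α', hα⟩ := hdec G
  obtain ⟨β, β', hβ⟩ := hdec n
  have hNpar : ∀ x y : ℝ, inner ℝ N (x • e + y • f) = 0 := fun x y => by
    rw [inner_add_right, inner_smul_right, inner_smul_right, hNe, hNf]
    simp
  -- In-plane part: removing the component along `N` does not change the inner products with `e` and
  -- `f`.
  have hw : ‖(μ - α) • e + (μ' - α') • f‖ ≤ 2 * a / σ := by
    have h5 : (μ - α) • e + (μ' - α') • f = μ • e + μ' • f - G + inner ℝ N G • N := by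
      conv_rhs => rw [sub_eq_add_neg, add_assoc, add_comm (-G)]
      conv_rhs => enter [2]; rw [← sub_eq_add_neg]; enter [2]; rw [hα]
      module
    refine h.norm_comb_le ?_ ?_
    · rw [h5, inner_add_left, inner_smul_left, hNe]
      simpa using h3
    · rw [h5, inner_add_left, inner_smul_left, hNf]
      simpa using h4
  have hnp : ‖β • e + β' • f‖ ≤ 2 * b / σ := by
    have h5 : β • e + β' • f = n - inner ℝ N n • N := by
      rw [eq_sub_iff_add_eq]
      exact hβ.symm
    refine h.norm_comb_le ?_ ?_
    · rw [h5, inner_sub_left, inner_smul_left, hNe]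
      simpa using h1
    · rw [h5, inner_sub_left, inner_smul_left, hNf]
      simpa using h2
  -- Normal part: `n · G = 0` expresses `(N · n)(N · G)` through the small in-plane part of `n`. If
  -- `b` is small, `|N · n| ≥ 1/2` can be divided out; otherwise `4b/σ ≥ 1` and the trivial bound
  -- suffices.
  have hNG : |inner ℝ N G| ≤ 4 * b / σ * ‖G‖ := by
    have hle : |inner ℝ N G| ≤ ‖G‖ := by
      have := abs_real_inner_le_norm N G
      rwa [hN, one_mul] at this
    rcases le_or_gt (2 * b / σ) (1 / 2) with hs | hs
    · have h5 := h.le_abs_inner_normal hN hNe hNf hdec hn h1 h2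
      have h6 : inner ℝ N n * inner ℝ N G = - inner ℝ (β • e + β' • f) G := by
        have h7 : inner ℝ n G = inner ℝ (β • e + β' • f) G + inner ℝ N n * inner ℝ N G := by
          conv_lhs => rw [hβ]
          rw [inner_add_left, inner_smul_left]
          simp
        linarith
      have h8 : |inner ℝ N n| * |inner ℝ N G| ≤ 2 * b / σ * ‖G‖ := by
        rw [← abs_mul, h6, abs_neg]
        exact (abs_real_inner_le_norm _ _).trans (by gcongr)
      have h9 : 1 / 2 * |inner ℝ N G| ≤ |inner ℝ N n| * |inner ℝ N G| := by
        gcongr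
        linarith
      have h10 : 4 * b / σ * ‖G‖ = 2 * (2 * b / σ * ‖G‖) := by ring
      rw [h10]
      linarith
    · refine hle.trans ?_
      have : (1 : ℝ) ≤ 4 * b / σ := by
        have : 4 * b / σ = 2 * (2 * b / σ) := by ring
        rw [this]
        linarith
      nlinarith [norm_nonneg G]
  have hfin : μ • e + μ' • f - G = ((μ - α) • e + (μ' - α') • f) - inner ℝ N G • N := by
    conv_lhs => rw [hα]
    module
  rw [hfin]
  refine (_root_.norm_sub_le _ _).trans ?_
  rw [norm_smul, hN, mul_one, Real.norm_eq_abs]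
  linarith

end IsCorner

/-- Two unit vectors orthogonal to `e` and nearly orthogonal to `n` are nearly opposite unless they are close. -/
theorem norm_add_le_of_conormals {e p q n : E3} {a η : ℝ} (he : ‖e‖ = 1) (hp : ‖p‖ = 1) (hq : ‖q‖ = 1)
    (hn : ‖n‖ = 1) (hep : inner ℝ e p = 0) (heq : inner ℝ e q = 0) (hne : |inner ℝ n e| ≤ a)
    (hnp : |inner ℝ n p| ≤ a) (hnq : |inner ℝ n q| ≤ a) (ha : a ≤ 1 / 4) (hη : 0 < η) (hpq : η ≤ ‖p - q‖) :
    ‖p + q‖ ≤ 8 * a / η := by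
  have hc : IsCorner 1 e p := ⟨he, hp, one_pos, by rw [hep]; norm_num⟩
  obtain ⟨N, hN, hNe, hNp, hdec⟩ := hc.exists_normal
  have ha0 : 0 ≤ a := (abs_nonneg _).trans hne
  have h1 := hc.le_abs_inner_normal hN hNe hNp hdec hn hne hnp
  obtain ⟨μ, μ', hμ⟩ := hdec q
  have hμ0 : μ = 0 := by
    have := congrArg (fun v => inner ℝ e v) hμ
    simp only [inner_add_right, inner_smul_right, heq, hep, real_inner_self_eq_norm_sq, he,
      real_inner_comm N e, hNe] at this
    linarith
  have hμ1 : μ' = inner ℝ p q := by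
    have := congrArg (fun v => inner ℝ p v) hμ
    rw [real_inner_comm] at hNp
    simp only [inner_add_right, inner_smul_right, hμ0, real_inner_self_eq_norm_sq, hp, hNp] at this
    linarith
  rw [hμ0, hμ1, zero_smul, zero_add] at hμ
  set k : ℝ := inner ℝ p q
  set m : ℝ := inner ℝ N q
  -- Now `q = k p + m N`, where `N` is nearly parallel to `n`, and `q` and `p` are nearly orthogonal
  -- to `n`; so `m` is small and `q` is nearly `± p`.
  have hm : |m| ≤ 4 * a := by
    have h2 : inner ℝ n q = k * inner ℝ n p + m * inner ℝ n N := by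
      conv_lhs => rw [hμ]
      rw [inner_add_right, inner_smul_right, inner_smul_right]
    have hk : |k| ≤ 1 := by
      have := abs_real_inner_le_norm p q
      rwa [hp, hq, one_mul] at this
    have h3 : |m| * |inner ℝ N n| ≤ a + a := by
      rw [real_inner_comm n N, ← abs_mul]
      have : m * inner ℝ n N = inner ℝ n q - k * inner ℝ n p := by linarith
      rw [this]
      refine (abs_sub _ _).trans ?_
      rw [abs_mul]
      have : |k| * |inner ℝ n p| ≤ 1 * a := by gcongr
      linarith
    have h4 : (1 : ℝ) / 2 ≤ |inner ℝ N n| := by linarith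
    nlinarith [abs_nonneg m]
  have hkm : k ^ 2 + m ^ 2 = 1 := by
    have h5 : ‖q‖ ^ 2 = k ^ 2 + m ^ 2 := by
      conv_lhs => rw [hμ]
      rw [@norm_add_sq_real, norm_smul, norm_smul, hp, hN, inner_smul_left, inner_smul_right,
        real_inner_comm, hNp]
      simp
    rw [← h5, hq]
    norm_num
  have h6 : ‖p + q‖ ^ 2 * ‖p - q‖ ^ 2 = 4 * m ^ 2 := by
    -- The product is `(2 + 2k)(2 - 2k) = 4(1 - k²) = 4m²`, so a lower bound for one factor is an
    -- upper bound for the other.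
    rw [@norm_add_sq_real, @norm_sub_sq_real, hp, hq]
    change (1 ^ 2 + 2 * k + 1 ^ 2) * (1 ^ 2 - 2 * k + 1 ^ 2) = _
    linarith [hkm]
  have h7 : ‖p + q‖ * ‖p - q‖ ≤ 8 * a := by
    refine abs_le_of_sq_le_sq' ?_ (by positivity) |>.2
    rw [mul_pow, h6]
    have : m ^ 2 ≤ (4 * a) ^ 2 := sq_le_sq' (by linarith [(abs_le.1 hm).1]) (abs_le.1 hm).2
    nlinarith
  rw [le_div_iff₀ hη]
  calc ‖p + q‖ * η ≤ ‖p + q‖ * ‖p - q‖ := by gcongr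
    _ ≤ 8 * a := h7

/-! ### Triangles: incenter, contact length, kites -/

theorem mem_triangle_iff {p q r y : E3} : y ∈ triangle p q r ↔
    ∃ a b : ℝ, 0 ≤ a ∧ 0 ≤ b ∧ a + b ≤ 1 ∧ y = p + a • (q - p) + b • (r - p) := by
  constructor
  · intro hy
    have hconv : Convex ℝ {y : E3 | ∃ a b : ℝ, 0 ≤ a ∧ 0 ≤ b ∧ a + b ≤ 1 ∧ y = p + a • (q - p) + b • (r - p)} := by
      rintro _ ⟨a, b, ha, hb, hab, rfl⟩ _ ⟨a', b', ha', hb', hab', rfl⟩ s t hs ht hst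
      refine ⟨s * a + t * a', s * b + t * b', by positivity, by positivity, by nlinarith, ?_⟩
      have : s = 1 - t := by linarith
      subst this
      module
    refine convexHull_min ?_ hconv hy
    rintro z (rfl | rfl | rfl)
    · exact ⟨0, 0, le_rfl, le_rfl, by norm_num, by simp⟩
    · exact ⟨1, 0, by norm_num, le_rfl, by norm_num, by simp⟩
    · exact ⟨0, 1, le_rfl, by norm_num, by norm_num, by simp⟩
  · rintro ⟨a, b, ha, hb, hab, rfl⟩
    have hc : Convex ℝ (triangle p q r) := convex_convexHull ℝ _
    have hsub : ({p, q, r} : Set E3) ⊆ triangle p q r := subset_convexHull ℝ _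
    have := hc.sum_mem (t := Finset.univ) (w := ![1 - a - b, a, b]) (z := ![p, q, r])
      (by intro i _; fin_cases i <;> simp <;> linarith) (by simp [Fin.sum_univ_three]; ring)
      (by intro i _; apply hsub; fin_cases i <;> simp)
    simp only [Fin.sum_univ_three, Matrix.cons_val_zero, Matrix.cons_val_one, Matrix.cons_val] at this
    convert this using 1
    module

/-- The unit vector pointing from `p` to `q`. -/
noncomputable def dir (p q : E3) : E3 := (dist p q)⁻¹ • (q - p)

theorem norm_dir {p q : E3} (h : p ≠ q) : ‖dir p q‖ = 1 := by
  have : ‖q - p‖ ≠ 0 := norm_ne_zero_iff.2 (sub_ne_zero.2 h.symm)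
  rw [dir, norm_smul, dist_comm, dist_eq_norm, norm_inv, norm_norm, inv_mul_cancel₀ this]

theorem dist_smul_dir (p q : E3) : dist p q • dir p q = q - p := by
  rcases eq_or_ne p q with rfl | h
  · simp
  · rw [dir, smul_smul, mul_inv_cancel₀ (dist_ne_zero.2 h), one_smul]

/-- Coordinates in units of length along the two edges at `p`; the computations with kites are
carried out in them. -/
theorem mem_triangle_iff_dir {p q r y : E3} (hq : p ≠ q) (hr : p ≠ r) : y ∈ triangle p q r ↔
    ∃ a b : ℝ, 0 ≤ a ∧ 0 ≤ b ∧ a / dist p q + b / dist p r ≤ 1 ∧ y = p + a • dir p q + b • dir p r := by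
  have h1 := dist_pos.2 hq
  have h2 := dist_pos.2 hr
  rw [mem_triangle_iff]
  constructor
  · rintro ⟨a, b, ha, hb, hab, rfl⟩
    refine ⟨a * dist p q, b * dist p r, by positivity, by positivity, ?_, ?_⟩
    · rwa [mul_div_cancel_right₀ _ h1.ne', mul_div_cancel_right₀ _ h2.ne']
    · rw [mul_smul, mul_smul, dist_smul_dir, dist_smul_dir]
  · rintro ⟨a, b, ha, hb, hab, rfl⟩
    refine ⟨a / dist p q, b / dist p r, by positivity, by positivity, hab, ?_⟩
    rw [dir, dir, smul_smul, smul_smul, div_eq_mul_inv, div_eq_mul_inv]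

theorem ne_of_affineIndependent {p q r : E3} (h : AffineIndependent ℝ ![p, q, r]) : p ≠ q ∧ p ≠ r ∧ q ≠ r :=
  ⟨fun h0 => absurd (h.injective (a₁ := 0) (a₂ := 1) h0) (by decide),
    fun h0 => absurd (h.injective (a₁ := 0) (a₂ := 2) h0) (by decide),
    fun h0 => absurd (h.injective (a₁ := 1) (a₂ := 2) h0) (by decide)⟩

/-- The foot of the perpendicular from the incenter to a side through the first vertex. -/
theorem exists_touchpoint (t : Affine.Triangle ℝ E3) {q : E3} {i k : Fin 3}
    (hset : ({i}ᶜ : Set (Fin 3)) = {0, k}) (hq : t.points k = q) (hne : t.points 0 ≠ q) :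
    ∃ x : ℝ, t.touchpoint ∅ i = t.points 0 + x • dir (t.points 0) q ∧
      inner ℝ (t.incenter - t.points 0) (dir (t.points 0) q) = x ∧
      ‖t.incenter - t.points 0‖ ^ 2 = x ^ 2 + t.inradius ^ 2 := by
  set p := t.points 0
  have h1 := t.touchpoint_mem_affineSpan ∅ i
  have hrange : range (t.faceOpposite i).points = {p, q} := by
    rw [Affine.Simplex.range_faceOpposite_points, hset, image_pair, hq]
  have h2 : t.incenter - t.touchpoint ∅ i ∈ (affineSpan ℝ (range (t.faceOpposite i).points)).directionᗮ := by
    rw [← Affine.Simplex.excenter_empty]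
    exact EuclideanGeometry.vsub_orthogonalProjection_mem_direction_orthogonal _ _
  rw [hrange] at h1 h2
  have h3 : inner ℝ (q - p) (t.incenter - t.touchpoint ∅ i) = 0 := by
    refine h2 (q - p) ?_
    exact AffineSubspace.vsub_mem_direction (right_mem_affineSpan_pair ℝ p q) (left_mem_affineSpan_pair ℝ p q)
  obtain ⟨c, hc⟩ := mem_affineSpan_pair_iff_exists_lineMap_eq.1 h1
  have hτ : t.touchpoint ∅ i = p + (c * dist p q) • dir p q := by
    rw [← hc, mul_smul, dist_smul_dir, AffineMap.lineMap_apply]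
    simp [add_comm]
  have h4 : inner ℝ (dir p q) (t.incenter - t.touchpoint ∅ i) = 0 := by
    rw [dir, inner_smul_left, h3, mul_zero]
  have hn := norm_dir hne
  have h5 : t.incenter - p = (t.incenter - t.touchpoint ∅ i) + (c * dist p q) • dir p q := by
    rw [hτ]
    abel
  refine ⟨c * dist p q, hτ, ?_, ?_⟩
  · rw [h5, inner_add_left, inner_smul_left, real_inner_self_eq_norm_sq, hn, real_inner_comm, h4]
    simp
  · rw [h5, @norm_add_sq_real, inner_smul_right, real_inner_comm, h4, norm_smul, hn, ← t.dist_incenter i,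
      dist_eq_norm t.incenter, Real.norm_eq_abs, mul_one, sq_abs]
    ring

/-- The incenter, the inradius and the contact length of a triangle in terms of its corner. -/
theorem exists_incenter {p q r : E3} (h : AffineIndependent ℝ ![p, q, r]) : ∃ β > 0,
    contactLength p q r = β * (1 + inner ℝ (dir p q) (dir p r)) ∧
    triInradius p q r ^ 2 = β ^ 2 * (1 - inner ℝ (dir p q) (dir p r) ^ 2) ∧ 0 < triInradius p q r ∧
    β / dist p q + β / dist p r ≤ 1 ∧ contactLength p q r ≤ dist p q ∧ contactLength p q r ≤ dist p r := by
  obtain ⟨hpq, hpr, -⟩ := ne_of_affineIndependent h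
  set t : Affine.Triangle ℝ E3 := ⟨![p, q, r], h⟩ with ht
  have hℓ := dist_pos.2 hpq
  have hℓ' := dist_pos.2 hpr
  set e := dir p q
  set f := dir p r
  have he : ‖e‖ = 1 := norm_dir hpq
  have hf : ‖f‖ = 1 := norm_dir hpr
  have hr : triInradius p q r = t.inradius := by rw [triInradius, dif_pos h]
  have hc : contactLength p q r = dist p (t.touchpoint ∅ 2) := by rw [contactLength, dif_pos h]
  have hrpos : 0 < t.inradius := t.inradius_pos
  -- The touchpoint with index 2 lies on the side opposite to the third vertex `r`, that is, on `p
  -- q`; index 1 gives the side `p r`.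
  obtain ⟨x, hx, hIx, hnx⟩ := exists_touchpoint t (q := q) (i := 2) (k := 1)
    (by ext j; fin_cases j <;> simp) rfl hpq
  obtain ⟨y, hy, hIy, hny⟩ := exists_touchpoint t (q := r) (i := 1) (k := 2)
    (by ext j; fin_cases j <;> simp) rfl hpr
  change t.touchpoint ∅ 2 = p + x • e at hx
  change inner ℝ (t.incenter - p) e = x at hIx
  change ‖t.incenter - p‖ ^ 2 = _ at hnx
  change t.touchpoint ∅ 1 = p + y • f at hy
  change inner ℝ (t.incenter - p) f = y at hIy
  change ‖t.incenter - p‖ ^ 2 = _ at hny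
  set w := t.excenterWeights ∅
  have hw : ∀ i, 0 < w i := t.excenterWeights_empty_pos
  have hwsum : ∑ i, w i = 1 := t.sum_excenterWeights_eq_one_iff.2 t.excenterExists_empty
  have hI : t.incenter - p = (w 1 * dist p q) • e + (w 2 * dist p r) • f := by
    rw [t.incenter_eq_affineCombination, Finset.affineCombination_eq_linear_combination _ _ _ hwsum,
      mul_smul, mul_smul, dist_smul_dir, dist_smul_dir]
    rw [Fin.sum_univ_three] at hwsum ⊢
    change w 0 • p + w 1 • q + w 2 • r - p = _
    have : w 0 = 1 - w 1 - w 2 := by linarith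
    rw [this]
    module
  set β := w 1 * dist p q
  set β' := w 2 * dist p r
  have hβ : 0 < β := mul_pos (hw 1) hℓ
  have hβ' : 0 < β' := mul_pos (hw 2) hℓ'
  set c : ℝ := inner ℝ e f
  have hxe : x = β + c * β' := by
    rw [← hIx, hI, inner_add_left, inner_smul_left, inner_smul_left, real_inner_self_eq_norm_sq, he,
      real_inner_comm]
    simp only [conj_trivial]
    ring
  have hye : y = c * β + β' := by
    rw [← hIy, hI, inner_add_left, inner_smul_left, inner_smul_left, real_inner_self_eq_norm_sq, hf]
    simp only [conj_trivial]
    ring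
  have hI2 : ‖t.incenter - p‖ ^ 2 = β ^ 2 + 2 * (c * (β * β')) + β' ^ 2 := by
    rw [hI, @norm_add_sq_real, norm_smul, norm_smul, he, hf, inner_smul_left, inner_smul_right,
      Real.norm_eq_abs, Real.norm_eq_abs, mul_one, mul_one, sq_abs, sq_abs]
    simp only [conj_trivial]
    ring
  -- Pythagoras at both touchpoints computes the inradius from either edge. Comparison gives `β =
  -- β'`: the incenter lies on the bisector.
  have h1 : t.inradius ^ 2 = β' ^ 2 * (1 - c ^ 2) := by
    rw [hI2, hxe] at hnx
    linarith
  have h2 : t.inradius ^ 2 = β ^ 2 * (1 - c ^ 2) := by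
    rw [hI2, hye] at hny
    linarith
  have hc1 : 0 < 1 - c ^ 2 := by
    by_contra hneg
    nlinarith [sq_nonneg β, pow_pos hrpos 2]
  have hββ : β = β' := by
    have h3 : β ^ 2 = β' ^ 2 := mul_right_cancel₀ hc1.ne' (h2.symm.trans h1)
    exact (sq_eq_sq₀ hβ.le hβ'.le).1 h3
  have hc0 : 0 < 1 + c := by nlinarith
  have hcβ : contactLength p q r = β * (1 + c) := by
    rw [hc, hx, dist_self_add_right, norm_smul, he, mul_one, hxe, ← hββ, Real.norm_eq_abs, abs_of_pos]
    · ring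
    · nlinarith
  have hs1 := (t.sbtw_touchpoint_empty (i₁ := 0) (i₂ := 2) (i₃ := 1) (by decide) (by decide) (by decide)).wbtw.dist_add_dist
  have hs2 := (t.sbtw_touchpoint_empty (i₁ := 0) (i₂ := 1) (i₃ := 2) (by decide) (by decide) (by decide)).wbtw.dist_add_dist
  change dist p (t.touchpoint ∅ 2) + dist _ q = dist p q at hs1
  change dist p (t.touchpoint ∅ 1) + dist _ r = dist p r at hs2
  have hc' : dist p (t.touchpoint ∅ 1) = β * (1 + c) := by
    rw [hy, dist_self_add_right, norm_smul, hf, mul_one, hye, ← hββ, Real.norm_eq_abs, abs_of_pos]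
    · ring
    · nlinarith
  refine ⟨β, hβ, hcβ, by rw [hr]; exact h2, by rwa [hr], ?_, ?_, ?_⟩
  rotate_left
  · rw [hc, ← hs1]
    exact le_add_of_nonneg_right dist_nonneg
  · rw [hcβ, ← hc', ← hs2]
    exact le_add_of_nonneg_right dist_nonneg
  · have h3 : β / dist p q = w 1 := mul_div_cancel_right₀ _ hℓ.ne'
    have h4 : β / dist p r = w 2 := by rw [hββ]; exact mul_div_cancel_right₀ _ hℓ'.ne'
    rw [h3, h4]
    rw [Fin.sum_univ_three] at hwsum
    linarith [hw 0]

theorem isBounded_triangle (p q r : E3) : Bornology.IsBounded (triangle p q r) :=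
  isBounded_convexHull.2 (Set.toFinite _).isBounded

theorem dist_le_diam_triangle (p q r : E3) : dist p q ≤ Metric.diam (triangle p q r) ∧
    dist p r ≤ Metric.diam (triangle p q r) ∧ dist q r ≤ Metric.diam (triangle p q r) := by
  have hb := isBounded_triangle p q r
  have hsub : ({p, q, r} : Set E3) ⊆ triangle p q r := subset_convexHull ℝ _
  exact ⟨Metric.dist_le_diam_of_mem hb (hsub (by simp)) (hsub (by simp)),
    Metric.dist_le_diam_of_mem hb (hsub (by simp)) (hsub (by simp)),
    Metric.dist_le_diam_of_mem hb (hsub (by simp)) (hsub (by simp))⟩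

/-- What shape regularity says about the corner of a triangle. -/
theorem corner_of_regular {p q r : E3} {γ : ℝ} (hγ : 0 < γ) (h : AffineIndependent ℝ ![p, q, r])
    (hreg : Metric.diam (triangle p q r) ≤ γ * triInradius p q r) :
    IsCorner γ⁻¹ (dir p q) (dir p r) ∧ Metric.diam (triangle p q r) ≤ γ * dist p q ∧
    Metric.diam (triangle p q r) ≤ γ * dist p r ∧
    Metric.diam (triangle p q r) ≤ 2 * γ ^ 2 * contactLength p q r ∧
    (contactLength p q r ≤ dist p q ∧ contactLength p q r ≤ dist p r) ∧
    ∃ β > 0, contactLength p q r = β * (1 + inner ℝ (dir p q) (dir p r)) ∧ β / dist p q + β / dist p r ≤ 1 := by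
  obtain ⟨hpq, hpr, -⟩ := ne_of_affineIndependent h
  obtain ⟨β, hβ, hc, hr, hrpos, hsum, hcℓ, hcℓ'⟩ := exists_incenter h
  obtain ⟨hd1, hd2, -⟩ := dist_le_diam_triangle p q r
  have hℓ := dist_pos.2 hpq
  have hℓ' := dist_pos.2 hpr
  set e := dir p q
  set f := dir p r
  set c : ℝ := inner ℝ e f
  set ρ := triInradius p q r
  set D := Metric.diam (triangle p q r)
  have hb1 : β ≤ dist p q := by
    have : β / dist p q ≤ 1 := by
      have : 0 ≤ β / dist p r := by positivity
      linarith
    rwa [div_le_one hℓ] at this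
  have hb2 : β ≤ dist p r := by
    have : β / dist p r ≤ 1 := by
      have : 0 ≤ β / dist p q := by positivity
      linarith
    rwa [div_le_one hℓ'] at this
  have hρβ : ρ ≤ β := by
    refine abs_le_of_sq_le_sq' ?_ hβ.le |>.2
    rw [hr]
    nlinarith [sq_nonneg c, sq_nonneg β]
  -- Here `β ≤ |pq| ≤ diam ≤ γρ`, while `ρ = β sin θ` for the angle `θ` at `p`; hence `sin θ ≥ 1/γ`.
  have hsin : (γ⁻¹) ^ 2 ≤ 1 - c ^ 2 := by
    have h1 : β ≤ γ * ρ := hb1.trans (hd1.trans hreg)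
    have h2 : β ^ 2 ≤ (γ * ρ) ^ 2 := by gcongr
    rw [mul_pow, hr] at h2
    have h3 : 1 ≤ γ ^ 2 * (1 - c ^ 2) := by
      have : β ^ 2 * 1 ≤ β ^ 2 * (γ ^ 2 * (1 - c ^ 2)) := by linarith
      exact le_of_mul_le_mul_left this (by positivity)
    rw [inv_pow, inv_le_iff_one_le_mul₀ (by positivity)]
    linarith
  have hcorner : IsCorner γ⁻¹ e f := ⟨norm_dir hpq, norm_dir hpr, by positivity, hsin⟩
  refine ⟨hcorner, ?_, ?_, ?_, ⟨hcℓ, hcℓ'⟩, β, hβ, hc, hsum⟩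
  · refine hreg.trans ?_
    gcongr
    linarith
  · refine hreg.trans ?_
    gcongr
    linarith
  · refine hreg.trans ?_
    rw [hc]
    have h1 : (1 + c) ^ 2 ≤ 4 := by
      have := abs_le.1 hcorner.abs_inner_le
      nlinarith
    have h2 := hcorner.one_add_pos
    have h3 : ρ ≤ 2 * γ * (β * (1 + c)) := by
      refine abs_le_of_sq_le_sq' ?_ (by positivity) |>.2
      rw [hr]
      have h4 : 1 ≤ γ ^ 2 * (1 - c ^ 2) := by
        have := mul_le_mul_of_nonneg_left hsin (sq_nonneg γ)
        rwa [inv_pow, mul_inv_cancel₀ (by positivity)] at this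
      have h6 : 0 < 1 - c := by
        have := hcorner.le_one_sub
        have : 0 < γ⁻¹ := by positivity
        nlinarith
      -- With `ρ² = β²(1 - c)(1 + c)` this compares the inradius with the contact length `β(1 + c)`;
      -- it follows from the bound on the sine and `1 - c ≤ 2`.
      have h7 : 1 - c ≤ 4 * γ ^ 2 * (1 + c) := by
        have h8 : 1 ≤ γ ^ 2 * (1 + c) * (1 - c) := by linarith
        have h9 : 1 - c ≤ 2 := by
          have := abs_le.1 hcorner.abs_inner_le
          linarith [this.1]
        nlinarith [mul_pos (mul_pos (pow_pos hγ 2) h2) h6]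
      nlinarith [mul_pos (pow_pos hβ 2) h2]
    calc γ * ρ ≤ γ * (2 * γ * (β * (1 + c))) := by gcongr
      _ = _ := by ring

theorem triangle_swap (p q r : E3) : triangle p r q = triangle p q r := by
  rw [triangle, triangle, pair_comm]

/-- The side of the kite cut out of a triangle, perpendicular to the first edge. -/
theorem diam_kite_side {p q r : E3} {σ d β : ℝ} (hq : p ≠ q) (hr : p ≠ r)
    (h : IsCorner σ (dir p q) (dir p r)) (hd : 0 < d) (hdq : d ≤ dist p q) (hdβ : d ≤ β * (1 + inner ℝ (dir p q) (dir p r)))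
    (hβ : β / dist p q + β / dist p r ≤ 1) :
    Metric.diam {y | y ∈ triangle p q r ∧ (inner ℝ (y - p) (dir p q) ≤ d ∧ inner ℝ (y - p) (dir p r) ≤ d) ∧
      inner ℝ (y - p) (dir p q) = d} =
      d * √(1 - inner ℝ (dir p q) (dir p r) ^ 2) / (1 + inner ℝ (dir p q) (dir p r)) := by
  have hℓ := dist_pos.2 hq
  have hℓ' := dist_pos.2 hr
  set e := dir p q
  set f := dir p r
  set c : ℝ := inner ℝ e f
  have hc0 : 0 < 1 + c := h.one_add_pos
  have hc1 : 0 < 1 - c := by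
    have := h.le_one_sub
    have := h.pos
    nlinarith
  have hc2 := abs_le.1 h.abs_inner_le
  have hβd : d / (1 + c) ≤ β := by rwa [div_le_iff₀ hc0]
  have hdβ2 : d ≤ 2 * β := by nlinarith [hc2.2, div_pos hd hc0]
  -- The side runs from the point of the edge at distance `d` to the point of the bisector where the
  -- two perpendiculars meet. Its length is `d tan(θ/2) = d sin θ / (1 + cos θ)`.
  set a₀ := p + d • e with ha₀
  set b₀ := p + (d / (1 + c)) • e + (d / (1 + c)) • f with hb₀
  have hset : {y | y ∈ triangle p q r ∧ (inner ℝ (y - p) e ≤ d ∧ inner ℝ (y - p) f ≤ d) ∧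
      inner ℝ (y - p) e = d} = convexHull ℝ {a₀, b₀} := by
    rw [convexHull_pair]
    ext y
    constructor
    · rintro ⟨hy, ⟨-, hf⟩, he⟩
      obtain ⟨a, b, ha, hb, hab, rfl⟩ := (mem_triangle_iff_dir hq hr).1 hy
      rw [add_assoc, add_sub_cancel_left, h.inner_left_comb] at he
      rw [add_assoc, add_sub_cancel_left, h.inner_right_comb] at hf
      change a + c * b = d at he
      change c * a + b ≤ d at hf
      have h1 : b * (1 + c) ≤ d := by
        have h2 : (b * (1 + c)) * (1 - c) ≤ d * (1 - c) := by nlinarith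
        exact le_of_mul_le_mul_right h2 hc1
      refine ⟨1 - b * (1 + c) / d, b * (1 + c) / d, ?_, by positivity, by ring, ?_⟩
      · rw [sub_nonneg, div_le_one hd]
        exact h1
      · rw [ha₀, hb₀]
        have h3 : a = d - c * b := by linarith
        have h4 : b * (1 + c) / d * (d / (1 + c)) = b := by field_simp
        have h5 : (1 - b * (1 + c) / d) * d = d - b * (1 + c) := by field_simp
        have h6 : (1 - b * (1 + c) / d) • (p + d • e) + (b * (1 + c) / d) • (p + (d / (1 + c)) • e + (d / (1 + c)) • f) =
            p + ((1 - b * (1 + c) / d) * d + b * (1 + c) / d * (d / (1 + c))) • e +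
              (b * (1 + c) / d * (d / (1 + c))) • f := by module
        rw [h6, h5, h4, h3]
        congr 3
        ring
    · rintro ⟨s, t, hs, ht, hst, rfl⟩
      have hs1 : s = 1 - t := by linarith
      have h6 : s • a₀ + t • b₀ = p + (s * d + t * (d / (1 + c))) • e + (t * (d / (1 + c))) • f := by
        rw [ha₀, hb₀, hs1]
        module
      have hdc : d / (1 + c) + c * (d / (1 + c)) = d := by field_simp
      have h7 : s * d + t * (d / (1 + c)) + c * (t * (d / (1 + c))) = d := by
        have : s * d + t * (d / (1 + c)) + c * (t * (d / (1 + c))) =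
          s * d + t * (d / (1 + c) + c * (d / (1 + c))) := by ring
        rw [this, hdc, ← add_mul, hst, one_mul]
      have h8 : c * (s * d + t * (d / (1 + c))) + t * (d / (1 + c)) ≤ d := by
        have : c * (s * d + t * (d / (1 + c))) + t * (d / (1 + c)) =
          c * s * d + t * (d / (1 + c) + c * (d / (1 + c))) := by ring
        rw [this, hdc, ← add_mul]
        have : c * s + t ≤ 1 := by nlinarith
        nlinarith
      rw [h6]
      refine ⟨(mem_triangle_iff_dir hq hr).2 ⟨_, _, by positivity, by positivity, ?_, rfl⟩, ⟨?_, ?_⟩, ?_⟩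
      · have h9 : d / dist p q ≤ 1 := by
          rwa [div_le_one hℓ]
        have h10 : d / (1 + c) / dist p q + d / (1 + c) / dist p r ≤ 1 :=
          le_trans (by gcongr) hβ
        calc _ = s * (d / dist p q) + t * (d / (1 + c) / dist p q + d / (1 + c) / dist p r) := by ring
          _ ≤ s * 1 + t * 1 := by gcongr
          _ = 1 := by linarith
      · rw [add_assoc, add_sub_cancel_left, h.inner_left_comb]
        exact h7.le
      · rw [add_assoc, add_sub_cancel_left, h.inner_right_comb]
        exact h8
      · rw [add_assoc, add_sub_cancel_left, h.inner_left_comb]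
        exact h7
  rw [hset, convexHull_diam, Metric.diam_pair, dist_eq_norm]
  have h1 : a₀ - b₀ = (d / (1 + c)) • (c • e + (-1 : ℝ) • f) := by
    have : d = d / (1 + c) * (1 + c) := by field_simp
    rw [ha₀, hb₀]
    conv_lhs => enter [1, 2]; rw [this]
    module
  have h2 : ‖c • e + (-1 : ℝ) • f‖ = √(1 - c ^ 2) := by
    rw [← Real.sqrt_sq (norm_nonneg (c • e + (-1 : ℝ) • f)), h.norm_sq_comb]
    congr 1
    change (c + c * -1) ^ 2 + (1 - c ^ 2) * (-1) ^ 2 = _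
    ring
  rw [h1, norm_smul, h2, Real.norm_eq_abs, abs_of_pos (by positivity)]
  ring

/-! ### The star of a vertex and the region V -/

namespace Triangulation

variable {S : EvolvingSurface} (𝒯 : Triangulation S)

/-- The vertex set of the triangle `T_j` at the vertex `i`. -/
def face (i : Fin 𝒯.M) (j : ℕ) : Finset (Fin 𝒯.M) := {i, 𝒯.nbr i j, 𝒯.nbr i (j + 1)}

theorem face_mem (i : Fin 𝒯.M) (j : ℕ) : 𝒯.face i j ∈ 𝒯.faces := ((𝒯.star i _).2 ⟨j, rfl⟩).1

theorem nbr_ne_succ (i : Fin 𝒯.M) (j : ℕ) : 𝒯.nbr i j ≠ 𝒯.nbr i (j + 1) := by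
  intro h
  have := 𝒯.faces_card _ (𝒯.face_mem i j)
  rw [face, h, Finset.pair_eq_singleton] at this
  have h2 : ({i, 𝒯.nbr i (j + 1)} : Finset (Fin 𝒯.M)).card ≤ 2 := Finset.card_le_two
  omega

theorem Υ_pos (i : Fin 𝒯.M) : 0 < 𝒯.Υ i := lt_of_lt_of_le (by norm_num) (𝒯.three_le i)

theorem nbr_mod (i : Fin 𝒯.M) (j : ℕ) : 𝒯.nbr i (j % 𝒯.Υ i) = 𝒯.nbr i j :=
  Function.Periodic.map_mod_nat (𝒯.nbr_periodic i) j

theorem nbr_eq_iff (i : Fin 𝒯.M) (j k : ℕ) : 𝒯.nbr i j = 𝒯.nbr i k ↔ j % 𝒯.Υ i = k % 𝒯.Υ i := by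
  rw [← 𝒯.nbr_mod i j, ← 𝒯.nbr_mod i k]
  exact (𝒯.nbr_inj i).eq_iff (Nat.mod_lt _ (𝒯.Υ_pos i)) (Nat.mod_lt _ (𝒯.Υ_pos i))

/-- Different indices modulo `Υ i` give different triangles. -/
theorem face_eq_iff (i : Fin 𝒯.M) (j k : ℕ) : 𝒯.face i j = 𝒯.face i k ↔ j % 𝒯.Υ i = k % 𝒯.Υ i := by
  have h3 := 𝒯.three_le i
  constructor
  · intro h
    have hj : 𝒯.nbr i j ∈ 𝒯.face i k := h ▸ by simp [face]
    have hj' : 𝒯.nbr i (j + 1) ∈ 𝒯.face i k := h ▸ by simp [face]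
    simp only [face, Finset.mem_insert, Finset.mem_singleton, 𝒯.nbr_ne, false_or, 𝒯.nbr_eq_iff] at hj hj'
    rcases hj with hj | hj
    · exact hj
    · rcases hj' with hj' | hj'
      -- Equal triangles with the two neighbours exchanged would force `Υ i` to divide 2, against
      -- `three_le`.
      · exfalso
        have h1 : (j + 1 + 1) % 𝒯.Υ i = j % 𝒯.Υ i :=
          (Nat.ModEq.add_right 1 hj').trans hj.symm
        have h2 : 𝒯.Υ i ∣ 2 := by
          have := (Nat.modEq_iff_dvd' (n := 𝒯.Υ i) (by omega : j ≤ j + 1 + 1)).1 h1.symm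
          simpa [add_assoc] using this
        have := Nat.le_of_dvd (by norm_num) h2
        omega
      · exact Nat.ModEq.add_right_cancel' 1 hj'
  · intro h
    have h1 : (j + 1) % 𝒯.Υ i = (k + 1) % 𝒯.Υ i := Nat.ModEq.add_right 1 h
    rw [face, face, (𝒯.nbr_eq_iff i j k).2 h, (𝒯.nbr_eq_iff i _ _).2 h1]

theorem T_eq_convexHull (t : ℝ) (i : Fin 𝒯.M) (j : ℕ) :
    𝒯.T t i j = convexHull ℝ ((fun k => 𝒯.x k t) '' (𝒯.face i j : Set (Fin 𝒯.M))) := by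
  simp only [face, Finset.coe_insert, Finset.coe_singleton, image_insert_eq, image_singleton]
  rfl

theorem T_subset_polyhedron (t : ℝ) (i : Fin 𝒯.M) (j : ℕ) :
    𝒯.T t i j ⊆ polyhedron 𝒯.faces (fun k => S.Φ (𝒯.x₀ k) t) := by
  rw [T_eq_convexHull]
  exact subset_biUnion_of_mem (u := fun K : Finset (Fin 𝒯.M) => convexHull ℝ ((fun k => S.Φ (𝒯.x₀ k) t) '' (K : Set (Fin 𝒯.M))))
    (𝒯.face_mem i j)

theorem edgeDir_eq (t : ℝ) (i : Fin 𝒯.M) (j : ℕ) : 𝒯.edgeDir t i j = dir (𝒯.x i t) (𝒯.x (𝒯.nbr i j) t) := rfl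

theorem x_mem {t : ℝ} (i : Fin 𝒯.M) : 𝒯.x i t ∈ S.Γ t := mem_image_of_mem _ (𝒯.x₀_mem i)

variable {𝒯} {t : ℝ} (ht : t ∈ Icc 0 S.T)
include ht

theorem x_ne (i : Fin 𝒯.M) (j : ℕ) : 𝒯.x i t ≠ 𝒯.x (𝒯.nbr i j) t :=
  (ne_of_affineIndependent (𝒯.nondegenerate t ht i j)).1

theorem edgeLen_pos (i : Fin 𝒯.M) (j : ℕ) : 0 < 𝒯.edgeLen t i j := dist_pos.2 (x_ne ht i j)

theorem norm_edgeDir (i : Fin 𝒯.M) (j : ℕ) : ‖𝒯.edgeDir t i j‖ = 1 := norm_dir (x_ne ht i j)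

/-- The intersection of two different triangles of a star lies in a common edge. -/
theorem inter_subset_edge {i : Fin 𝒯.M} {j k : ℕ} (hjk : 𝒯.face i j ≠ 𝒯.face i k) {y : E3}
    (hj : y ∈ 𝒯.T t i j) (hk : y ∈ 𝒯.T t i k) :
    y = 𝒯.x i t ∨ ∃ l, (l = j ∨ l = j + 1) ∧ 𝒯.nbr i l ∈ 𝒯.face i k ∧
      ∃ s : ℝ, 0 ≤ s ∧ y = 𝒯.x i t + s • 𝒯.edgeDir t i l := by
  have hmem : y ∈ convexHull ℝ ((fun k => 𝒯.x k t) '' ((𝒯.face i j ∩ 𝒯.face i k : Finset (Fin 𝒯.M)) : Set (Fin 𝒯.M))) := by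
    rw [T_eq_convexHull] at hj hk
    exact (𝒯.inter t ht _ (𝒯.face_mem i j) _ (𝒯.face_mem i k)).subset ⟨hj, hk⟩
  have hpair : ∀ l, y ∈ convexHull ℝ ((fun k => 𝒯.x k t) '' ({i, 𝒯.nbr i l} : Set (Fin 𝒯.M))) →
      ∃ s : ℝ, 0 ≤ s ∧ y = 𝒯.x i t + s • 𝒯.edgeDir t i l := by
    intro l hl
    rw [image_pair, convexHull_pair, segment_eq_image'] at hl
    obtain ⟨s, hs, rfl⟩ := hl
    refine ⟨s * dist (𝒯.x i t) (𝒯.x (𝒯.nbr i l) t), mul_nonneg hs.1 dist_nonneg, ?_⟩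
    rw [edgeDir_eq, mul_smul, dist_smul_dir]
  by_cases h1 : 𝒯.nbr i j ∈ 𝒯.face i k
  · by_cases h2 : 𝒯.nbr i (j + 1) ∈ 𝒯.face i k
    · exfalso
      refine hjk (Finset.eq_of_subset_of_card_le ?_ ?_)
      · intro a ha
        simp only [face, Finset.mem_insert, Finset.mem_singleton] at ha
        rcases ha with rfl | rfl | rfl
        · simp [face]
        · exact h1
        · exact h2
      · rw [𝒯.faces_card _ (𝒯.face_mem i j), 𝒯.faces_card _ (𝒯.face_mem i k)]
    · refine Or.inr ⟨j, Or.inl rfl, h1, hpair j (convexHull_mono (image_mono ?_) hmem)⟩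
      intro a ha
      simp only [Finset.coe_inter, mem_inter_iff, Finset.mem_coe] at ha
      obtain ⟨ha1, ha2⟩ := ha
      simp only [face, Finset.mem_insert, Finset.mem_singleton] at ha1
      rcases ha1 with rfl | rfl | rfl
      · simp
      · simp
      · exact absurd ha2 h2
  · by_cases h2 : 𝒯.nbr i (j + 1) ∈ 𝒯.face i k
    · refine Or.inr ⟨j + 1, Or.inr rfl, h2, hpair (j + 1) (convexHull_mono (image_mono ?_) hmem)⟩
      intro a ha
      simp only [Finset.coe_inter, mem_inter_iff, Finset.mem_coe] at ha
      obtain ⟨ha1, ha2⟩ := ha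
      simp only [face, Finset.mem_insert, Finset.mem_singleton] at ha1
      rcases ha1 with rfl | rfl | rfl
      · simp
      · exact absurd ha2 h1
      · simp
    · left
      have : y ∈ convexHull ℝ ((fun k => 𝒯.x k t) '' ({i} : Set (Fin 𝒯.M))) := by
        refine convexHull_mono (image_mono ?_) hmem
        intro a ha
        simp only [Finset.coe_inter, mem_inter_iff, Finset.mem_coe] at ha
        obtain ⟨ha1, ha2⟩ := ha
        simp only [face, Finset.mem_insert, Finset.mem_singleton] at ha1
        rcases ha1 with rfl | rfl | rfl
        · simp
        · exact absurd ha2 h1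
        · exact absurd ha2 h2
      simpa using this

omit ht
variable {γ : ℝ} (hγ : 0 < γ) (hreg : 𝒯.Regular γ)

theorem contactLength_mod (i : Fin 𝒯.M) (j : ℕ) :
    contactLength (𝒯.x i t) (𝒯.x (𝒯.nbr i (j % 𝒯.Υ i)) t) (𝒯.x (𝒯.nbr i (j % 𝒯.Υ i + 1)) t) =
    contactLength (𝒯.x i t) (𝒯.x (𝒯.nbr i j) t) (𝒯.x (𝒯.nbr i (j + 1)) t) := by
  have h1 : 𝒯.nbr i (j % 𝒯.Υ i + 1) = 𝒯.nbr i (j + 1) := by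
    rw [𝒯.nbr_eq_iff]
    simp
  rw [𝒯.nbr_mod, h1]

theorem d_le (i : Fin 𝒯.M) (j : ℕ) :
    𝒯.d t i ≤ contactLength (𝒯.x i t) (𝒯.x (𝒯.nbr i j) t) (𝒯.x (𝒯.nbr i (j + 1)) t) := by
  rw [← contactLength_mod]
  exact ciInf_le (Set.finite_range _).bddBelow (⟨j % 𝒯.Υ i, Nat.mod_lt _ (𝒯.Υ_pos i)⟩ : Fin (𝒯.Υ i))

theorem exists_d_eq (t : ℝ) (i : Fin 𝒯.M) :
    ∃ j, 𝒯.d t i = contactLength (𝒯.x i t) (𝒯.x (𝒯.nbr i j) t) (𝒯.x (𝒯.nbr i (j + 1)) t) := by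
  have : Nonempty (Fin (𝒯.Υ i)) := ⟨⟨0, 𝒯.Υ_pos i⟩⟩
  obtain ⟨j, hj⟩ := exists_eq_ciInf_of_finite (f := fun j : Fin (𝒯.Υ i) =>
    contactLength (𝒯.x i t) (𝒯.x (𝒯.nbr i j) t) (𝒯.x (𝒯.nbr i (j + 1)) t))
  exact ⟨j, hj.symm⟩

include ht hγ hreg

/-- The geometric data of the corner of `T_j` at the vertex `i`. -/
theorem corner_data (i : Fin 𝒯.M) (j : ℕ) :
    IsCorner γ⁻¹ (𝒯.edgeDir t i j) (𝒯.edgeDir t i (j + 1)) ∧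
    Metric.diam (𝒯.T t i j) ≤ γ * 𝒯.edgeLen t i j ∧ Metric.diam (𝒯.T t i j) ≤ γ * 𝒯.edgeLen t i (j + 1) ∧
    Metric.diam (𝒯.T t i j) ≤
      2 * γ ^ 2 * contactLength (𝒯.x i t) (𝒯.x (𝒯.nbr i j) t) (𝒯.x (𝒯.nbr i (j + 1)) t) ∧
    (contactLength (𝒯.x i t) (𝒯.x (𝒯.nbr i j) t) (𝒯.x (𝒯.nbr i (j + 1)) t) ≤ 𝒯.edgeLen t i j ∧
      contactLength (𝒯.x i t) (𝒯.x (𝒯.nbr i j) t) (𝒯.x (𝒯.nbr i (j + 1)) t) ≤ 𝒯.edgeLen t i (j + 1)) ∧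
    ∃ β > 0, contactLength (𝒯.x i t) (𝒯.x (𝒯.nbr i j) t) (𝒯.x (𝒯.nbr i (j + 1)) t) =
        β * (1 + inner ℝ (𝒯.edgeDir t i j) (𝒯.edgeDir t i (j + 1))) ∧
      β / 𝒯.edgeLen t i j + β / 𝒯.edgeLen t i (j + 1) ≤ 1 :=
  corner_of_regular hγ (𝒯.nondegenerate t ht i j) (hreg t ht i j)

theorem d_pos (i : Fin 𝒯.M) : 0 < 𝒯.d t i := by
  obtain ⟨j, hj⟩ := exists_d_eq (𝒯 := 𝒯) t i
  obtain ⟨hc, -, -, -, -, β, hβ, h1, -⟩ := corner_data ht hγ hreg i j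
  rw [hj, h1]
  exact mul_pos hβ hc.one_add_pos

omit ht hγ hreg in
variable (𝒯) in
/-- The part of `V` that is defined by the triangle `T_j`. -/
def kite (t : ℝ) (i : Fin 𝒯.M) (j : ℕ) : Set E3 :=
  {y ∈ 𝒯.T t i j | inner ℝ (y - 𝒯.x i t) (𝒯.edgeDir t i j) ≤ 𝒯.d t i ∧
    inner ℝ (y - 𝒯.x i t) (𝒯.edgeDir t i (j + 1)) ≤ 𝒯.d t i}

/-- A point of another kite that lies in `T_j` is on a common edge at distance at most `d` from the
vertex, and by Cauchy–Schwarz such a point satisfies every half-space condition. -/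
theorem V_inter_T (i : Fin 𝒯.M) (j : ℕ) : 𝒯.V t i ∩ 𝒯.T t i j = 𝒯.kite t i j := by
  have hd := (d_pos ht hγ hreg i).le
  refine Subset.antisymm ?_ fun y hy => ⟨mem_iUnion.2 ⟨j, hy⟩, hy.1⟩
  rintro y ⟨hyV, hyT⟩
  obtain ⟨k, hyk, h1, h2⟩ := mem_iUnion.1 hyV
  by_cases hf : 𝒯.face i j = 𝒯.face i k
  · have h3 := (𝒯.face_eq_iff i j k).1 hf
    have h4 : 𝒯.nbr i j = 𝒯.nbr i k := (𝒯.nbr_eq_iff _ _ _).2 h3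
    have h5 : 𝒯.nbr i (j + 1) = 𝒯.nbr i (k + 1) :=
      (𝒯.nbr_eq_iff _ _ _).2 (Nat.ModEq.add_right 1 h3)
    refine ⟨hyT, ?_, ?_⟩
    · rw [edgeDir_eq, h4]
      exact h1
    · rw [edgeDir_eq, h5]
      exact h2
  · rcases inter_subset_edge ht hf hyT hyk with rfl | ⟨l, hl, hlk, s, hs, rfl⟩
    · exact ⟨hyT, by simpa using hd, by simpa using hd⟩
    · rw [add_sub_cancel_left, inner_smul_left] at h1 h2
      have hn := norm_edgeDir ht i l
      have hsd : s ≤ 𝒯.d t i := by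
        simp only [face, Finset.mem_insert, Finset.mem_singleton, 𝒯.nbr_ne, false_or] at hlk
        rcases hlk with hlk | hlk
        · have : 𝒯.edgeDir t i k = 𝒯.edgeDir t i l := by rw [edgeDir_eq, edgeDir_eq, hlk]
          rw [this, real_inner_self_eq_norm_sq, hn] at h1
          simpa using h1
        · have : 𝒯.edgeDir t i (k + 1) = 𝒯.edgeDir t i l := by rw [edgeDir_eq, edgeDir_eq, hlk]
          rw [this, real_inner_self_eq_norm_sq, hn] at h2
          simpa using h2
      have hle : ∀ m, inner ℝ (𝒯.x i t + s • 𝒯.edgeDir t i l - 𝒯.x i t) (𝒯.edgeDir t i m) ≤ 𝒯.d t i := by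
        intro m
        rw [add_sub_cancel_left, inner_smul_left]
        have h3 := real_inner_le_norm (𝒯.edgeDir t i l) (𝒯.edgeDir t i m)
        rw [hn, norm_edgeDir ht i m] at h3
        simp only [conj_trivial]
        nlinarith
      exact ⟨hyT, hle _, hle _⟩

omit ht hγ hreg in
variable (𝒯) in
/-- The length of the two sides of the kite in `T_j` that are opposite to the vertex `i`. -/
noncomputable def kiteSide (t : ℝ) (i : Fin 𝒯.M) (j : ℕ) : ℝ :=
  𝒯.d t i * √(1 - inner ℝ (𝒯.edgeDir t i j) (𝒯.edgeDir t i (j + 1)) ^ 2) /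
    (1 + inner ℝ (𝒯.edgeDir t i j) (𝒯.edgeDir t i (j + 1)))

theorem hR_eq (i : Fin 𝒯.M) (j : ℕ) : 𝒯.hR t i j = 𝒯.kiteSide t i j := by
  obtain ⟨hc, -, -, -, ⟨hℓ, -⟩, β, hβ, h1, h2⟩ := corner_data ht hγ hreg i j
  have hdle := d_le (t := t) i j
  rw [hR, sideLen, V_inter_T ht hγ hreg, kiteSide]
  refine (congrArg Metric.diam ?_).trans (diam_kite_side (x_ne ht i j) (x_ne ht i (j + 1)) hc
    (d_pos ht hγ hreg i) (hdle.trans hℓ) (hdle.trans h1.le) h2)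
  ext y
  exact and_assoc

theorem hL_eq (i : Fin 𝒯.M) (j : ℕ) : 𝒯.hL t i j = 𝒯.kiteSide t i (j + 𝒯.Υ i - 1) := by
  -- This is `j - 1` modulo `Υ i` without truncated subtraction at `j = 0`. In `T_k` the edge `E_j`
  -- is the second one, so the corner is used with its sides exchanged.
  set k := j + 𝒯.Υ i - 1 with hk
  have hk1 : 𝒯.nbr i (k + 1) = 𝒯.nbr i j := by
    have : k + 1 = j + 𝒯.Υ i := by
      have := 𝒯.Υ_pos i
      omega
    rw [this, 𝒯.nbr_periodic]
  obtain ⟨hc, -, -, -, ⟨-, hℓ⟩, β, hβ, h1, h2⟩ := corner_data ht hγ hreg i k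
  have hdle := d_le (t := t) i k
  have hed : 𝒯.edgeDir t i (k + 1) = 𝒯.edgeDir t i j := by rw [edgeDir_eq, edgeDir_eq, hk1]
  rw [hL, sideLen, V_inter_T ht hγ hreg, kiteSide, real_inner_comm]
  rw [add_comm] at h2
  rw [real_inner_comm] at h1
  refine (congrArg Metric.diam ?_).trans (diam_kite_side (x_ne ht i (k + 1)) (x_ne ht i k) hc.symm
    (d_pos ht hγ hreg i) (hdle.trans hℓ) (hdle.trans h1.le) h2)
  rw [triangle_swap]
  ext y
  change (y ∈ 𝒯.T t i k ∧ inner ℝ (y - 𝒯.x i t) (𝒯.edgeDir t i k) ≤ 𝒯.d t i ∧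
    inner ℝ (y - 𝒯.x i t) (𝒯.edgeDir t i (k + 1)) ≤ 𝒯.d t i) ∧
    inner ℝ (y - 𝒯.x i t) (𝒯.edgeDir t i j) = 𝒯.d t i ↔ y ∈ 𝒯.T t i k ∧
    (inner ℝ (y - 𝒯.x i t) (𝒯.edgeDir t i (k + 1)) ≤ 𝒯.d t i ∧
    inner ℝ (y - 𝒯.x i t) (𝒯.edgeDir t i k) ≤ 𝒯.d t i) ∧
    inner ℝ (y - 𝒯.x i t) (𝒯.edgeDir t i (k + 1)) = 𝒯.d t i
  rw [hed]
  tauto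

end Triangulation

/-! ### Areas of kites -/

theorem euclideanHausdorff_image_le {f : E2 → E3} {K : NNReal} (hf : LipschitzWith K f) (s : Set E2) :
    (Measure.euclideanHausdorffMeasure 2 : Measure E3) (f '' s) ≤
      (K : ENNReal) ^ ((2 : ℕ) : ℝ) * (Measure.euclideanHausdorffMeasure 2 : Measure E2) s := by
  rw [Measure.euclideanHausdorffMeasure_def, Measure.smul_apply, Measure.euclideanHausdorffMeasure_def,
    Measure.smul_apply, ENNReal.smul_def, ENNReal.smul_def, smul_eq_mul, smul_eq_mul, mul_left_comm]
  gcongr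
  exact hf.hausdorffMeasure_image_le (by norm_num) s

theorem le_euclideanHausdorff_image {f : E2 → E3} {K : NNReal} (hf : AntilipschitzWith K f) (s : Set E2) :
    (Measure.euclideanHausdorffMeasure 2 : Measure E2) s ≤
      (K : ENNReal) ^ ((2 : ℕ) : ℝ) * (Measure.euclideanHausdorffMeasure 2 : Measure E3) (f '' s) := by
  rw [Measure.euclideanHausdorffMeasure_def, Measure.smul_apply, Measure.euclideanHausdorffMeasure_def,
    Measure.smul_apply, ENNReal.smul_def, ENNReal.smul_def, smul_eq_mul, smul_eq_mul, mul_left_comm]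
  gcongr
  exact hf.le_hausdorffMeasure_image (by norm_num) s

/-- The affine parametrization of a plane. -/
def planeMap (p v w : E3) (u : E2) : E3 := p + (u 0 • v + u 1 • w)

theorem planeMap_sub (p v w : E3) (a b : E2) :
    planeMap p v w a - planeMap p v w b = (a 0 - b 0) • v + (a 1 - b 1) • w := by
  rw [planeMap, planeMap]
  module

theorem norm_le_abs_add_abs (u : E2) : ‖u‖ ≤ |u 0| + |u 1| := by
  rw [EuclideanSpace.norm_eq, Real.sqrt_le_left (by positivity)]
  simp only [Fin.sum_univ_two, Real.norm_eq_abs]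
  nlinarith [abs_nonneg (u 0), abs_nonneg (u 1)]

theorem abs_apply_le_norm (u : E2) (i : Fin 2) : |u i| ≤ ‖u‖ := PiLp.norm_apply_le u i

theorem lipschitz_planeMap (p v w : E3) : LipschitzWith (‖v‖₊ + ‖w‖₊) (planeMap p v w) := by
  refine LipschitzWith.of_dist_le_mul fun a b => ?_
  rw [dist_eq_norm, planeMap_sub, dist_eq_norm]
  refine (norm_add_le _ _).trans ?_
  rw [norm_smul, norm_smul]
  have h0 := abs_apply_le_norm (a - b) 0
  have h1 := abs_apply_le_norm (a - b) 1
  simp only [PiLp.sub_apply] at h0 h1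
  simp only [Real.norm_eq_abs, NNReal.coe_add, coe_nnnorm]
  nlinarith [norm_nonneg v, norm_nonneg w]

theorem euclideanHausdorff_lt_top_of_subset_triangle {p q r : E3} {A : Set E3} (hA : A ⊆ triangle p q r) :
    (Measure.euclideanHausdorffMeasure 2 : Measure E3) A < ⊤ := by
  have hsub : A ⊆ planeMap p (q - p) (r - p) '' Metric.closedBall 0 2 := by
    intro y hy
    obtain ⟨a, b, ha, hb, hab, rfl⟩ := mem_triangle_iff.1 (hA hy)
    refine ⟨!₂[a, b], ?_, by simp [planeMap, add_assoc]⟩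
    rw [mem_closedBall_zero_iff]
    refine (norm_le_abs_add_abs _).trans ?_
    simp only [Matrix.cons_val_zero, Matrix.cons_val_one, abs_of_nonneg ha, abs_of_nonneg hb]
    linarith
  refine (measure_mono hsub).trans_lt ((euclideanHausdorff_image_le (lipschitz_planeMap _ _ _) _).trans_lt ?_)
  rw [EuclideanSpace.euclideanHausdorffMeasure_eq_volume]
  exact ENNReal.mul_lt_top (by simp) measure_closedBall_lt_top

theorem euclideanHausdorff_line (p v : E3) :
    (Measure.euclideanHausdorffMeasure 2 : Measure E3) (range fun s : ℝ => p + s • v) = 0 := by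
  have hL : LipschitzWith ‖v‖₊ (fun s : ℝ => p + s • v) := by
    refine LipschitzWith.of_dist_le_mul fun a b => ?_
    rw [dist_add_left, dist_eq_norm, ← sub_smul, norm_smul, mul_comm, dist_eq_norm]
    rfl
  have hdim : dimH (range fun s : ℝ => p + s • v) < ((2 : ℕ) : NNReal) := by
    refine hL.dimH_range_le.trans_lt ?_
    rw [Real.dimH_univ]
    norm_num
  have h0 := hausdorffMeasure_of_dimH_lt hdim
  rw [NNReal.coe_natCast] at h0
  rw [Measure.euclideanHausdorffMeasure_def, Measure.smul_apply, h0, smul_zero]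

/-- A set that contains a parallelogram at a corner has an area that is not too small. -/
theorem exists_area_lower {σ : ℝ} (hσ : 0 < σ) : ∃ κ > 0, ∀ (p e f : E3) (d : ℝ) (A : Set E3),
    IsCorner σ e f → 0 < d →
    (∀ a b, 0 ≤ a → a ≤ d → 0 ≤ b → b ≤ d → p + a • e + b • f ∈ A) →
    (Measure.euclideanHausdorffMeasure 2 : Measure E3) A < ⊤ → κ * d ^ 2 ≤ Triangulation.area A := by
  -- A disc inside the unit square: its image lies in the parallelogram with sides `d e`, `d f`, and
  -- the coefficient bounds of a corner make the parametrization antilipschitz.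
  set m : E2 := !₂[1 / 2, 1 / 2] with hm
  set Q : Set E2 := Metric.ball m (1 / 2)
  set v := (volume Q).toReal
  have hv : 0 < v := ENNReal.toReal_pos (Metric.measure_ball_pos _ _ (by norm_num)).ne' measure_ball_lt_top.ne
  refine ⟨v * (σ / 2) ^ 2, by positivity, fun p e f d A hc hd hA hfin => ?_⟩
  have hanti : AntilipschitzWith (Real.toNNReal (2 / (d * σ))) (planeMap p (d • e) (d • f)) := by
    refine AntilipschitzWith.of_le_mul_dist fun a b => ?_
    rw [dist_eq_norm, dist_eq_norm, planeMap_sub, Real.coe_toNNReal _ (by positivity), smul_smul, smul_smul]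
    have h1 := hc.abs_left_coeff_le ((a 0 - b 0) * d) ((a 1 - b 1) * d)
    have h2 := hc.abs_right_coeff_le ((a 0 - b 0) * d) ((a 1 - b 1) * d)
    rw [abs_mul, abs_of_pos hd, ← le_div_iff₀ hd] at h1 h2
    have h3 := norm_le_abs_add_abs (a - b)
    simp only [PiLp.sub_apply] at h3
    refine h3.trans ((add_le_add h1 h2).trans (le_of_eq ?_))
    field_simp
    ring
  have hsub : planeMap p (d • e) (d • f) '' Q ⊆ A := by
    rintro _ ⟨u, hu, rfl⟩
    have h1 : ∀ i, 0 ≤ u i ∧ u i ≤ 1 := by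
      intro i
      have hu' : ‖u - m‖ < 1 / 2 := by rwa [← dist_eq_norm]
      have h2 := (abs_apply_le_norm (u - m) i).trans hu'.le
      have h3 : (u - m) i = u i - 1 / 2 := by fin_cases i <;> simp [hm]
      rw [h3] at h2
      have := abs_le.1 h2
      constructor <;> linarith
    have h2 := hA (u 0 * d) (u 1 * d) (mul_nonneg (h1 0).1 hd.le) (by nlinarith [h1 0])
      (mul_nonneg (h1 1).1 hd.le) (by nlinarith [h1 1])
    rw [planeMap, smul_smul, smul_smul, ← add_assoc]
    exact h2
  have h1 := (le_euclideanHausdorff_image hanti Q).trans (mul_le_mul_right (measure_mono hsub) _)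
  rw [EuclideanSpace.euclideanHausdorffMeasure_eq_volume] at h1
  have h2 := ENNReal.toReal_mono (ENNReal.mul_ne_top (by simp) hfin.ne) h1
  rw [ENNReal.toReal_mul] at h2
  have h3 : ((Real.toNNReal (2 / (d * σ)) : ENNReal) ^ ((2 : ℕ) : ℝ)).toReal = (2 / (d * σ)) ^ 2 := by
    rw [ENNReal.rpow_natCast, ENNReal.toReal_pow, ENNReal.coe_toReal, Real.coe_toNNReal _ (by positivity)]
  rw [h3] at h2
  change v ≤ (2 / (d * σ)) ^ 2 * Triangulation.area A at h2
  calc v * (σ / 2) ^ 2 * d ^ 2 ≤ ((2 / (d * σ)) ^ 2 * Triangulation.area A) * (σ / 2) ^ 2 * d ^ 2 := by gcongr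
    _ = Triangulation.area A := by field_simp

namespace Triangulation

variable {S : EvolvingSurface} {𝒯 : Triangulation S}

theorem measure_T_lt_top (t : ℝ) (i : Fin 𝒯.M) (j : ℕ) {A : Set E3} (hA : A ⊆ 𝒯.T t i j) :
    (Measure.euclideanHausdorffMeasure 2 : Measure E3) A < ⊤ :=
  euclideanHausdorff_lt_top_of_subset_triangle hA

theorem isClosed_T (t : ℝ) (i : Fin 𝒯.M) (j : ℕ) : IsClosed (𝒯.T t i j) :=
  (Set.Finite.isCompact_convexHull (𝕜 := ℝ) (s := {𝒯.x i t, 𝒯.x (𝒯.nbr i j) t, 𝒯.x (𝒯.nbr i (j + 1)) t})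
    (Set.toFinite _)).isClosed

theorem isClosed_kite (t : ℝ) (i : Fin 𝒯.M) (j : ℕ) : IsClosed (𝒯.kite t i j) := by
  have h : ∀ l, IsClosed {y | inner ℝ (y - 𝒯.x i t) (𝒯.edgeDir t i l) ≤ 𝒯.d t i} := fun l =>
    isClosed_le (by fun_prop) continuous_const
  exact (isClosed_T t i j).inter ((h j).inter (h (j + 1)))

theorem kite_mod (t : ℝ) (i : Fin 𝒯.M) (j : ℕ) : 𝒯.kite t i (j % 𝒯.Υ i) = 𝒯.kite t i j := by
  have h1 : 𝒯.nbr i (j % 𝒯.Υ i + 1) = 𝒯.nbr i (j + 1) := by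
    rw [𝒯.nbr_eq_iff]
    simp
  rw [kite, kite, T, T, edgeDir_eq, edgeDir_eq, edgeDir_eq, edgeDir_eq, 𝒯.nbr_mod, h1]

theorem V_eq (t : ℝ) (i : Fin 𝒯.M) : 𝒯.V t i = ⋃ j ∈ Finset.range (𝒯.Υ i), 𝒯.kite t i j := by
  refine Subset.antisymm (iUnion_subset fun j => ?_) (iUnion₂_subset fun j _ => subset_iUnion (𝒯.kite t i) j)
  have h : 𝒯.kite t i j ⊆ _ := (kite_mod t i j).symm.subset
  exact h.trans (subset_biUnion_of_mem (u := 𝒯.kite t i) (Finset.mem_range.2 (Nat.mod_lt _ (𝒯.Υ_pos i))))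

variable {t : ℝ} (ht : t ∈ Icc 0 S.T)
include ht

/-- Different triangles meet only along edges at the vertex, and lines have zero area. -/
theorem aedisjoint_kite {i : Fin 𝒯.M} {j k : ℕ} (hjk : 𝒯.face i j ≠ 𝒯.face i k) :
    AEDisjoint (Measure.euclideanHausdorffMeasure 2 : Measure E3) (𝒯.kite t i j) (𝒯.kite t i k) := by
  have hsub : 𝒯.kite t i j ∩ 𝒯.kite t i k ⊆ (range fun s : ℝ => 𝒯.x i t + s • 𝒯.edgeDir t i j) ∪
      (range fun s : ℝ => 𝒯.x i t + s • 𝒯.edgeDir t i (j + 1)) := by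
    rintro y ⟨hj, hk⟩
    rcases inter_subset_edge ht hjk hj.1 hk.1 with rfl | ⟨l, rfl | rfl, -, s, -, rfl⟩
    · exact Or.inl ⟨0, by simp⟩
    · exact Or.inl ⟨s, rfl⟩
    · exact Or.inr ⟨s, rfl⟩
  exact measure_mono_null hsub (measure_union_null (euclideanHausdorff_line _ _) (euclideanHausdorff_line _ _))

theorem sum_area_kite (i : Fin 𝒯.M) : ∑ j ∈ Finset.range (𝒯.Υ i), area (𝒯.kite t i j) = area (𝒯.V t i) := by
  rw [V_eq, area, Measure.real, measure_biUnion_finset₀]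
  · rw [ENNReal.toReal_sum fun j _ => (measure_T_lt_top t i j fun y hy => hy.1).ne]
    rfl
  · intro j hj k hk hjk
    refine aedisjoint_kite ht fun h => hjk ?_
    have := (𝒯.face_eq_iff i j k).1 h
    rwa [Nat.mod_eq_of_lt (by simpa using hj), Nat.mod_eq_of_lt (by simpa using hk)] at this
  · exact fun j _ => (isClosed_kite t i j).measurableSet.nullMeasurableSet

omit ht in
/-- The kites have areas comparable to `d²` from below. -/
theorem exists_area_kite_lower {γ : ℝ} (hγ : 0 < γ) : ∃ κ > 0, ∀ (S : EvolvingSurface) (𝒯 : Triangulation S),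
    𝒯.Regular γ → ∀ t ∈ Icc 0 S.T, ∀ i j, κ * 𝒯.d t i ^ 2 ≤ area (𝒯.kite t i j) := by
  obtain ⟨κ, hκ, h⟩ := exists_area_lower (σ := γ⁻¹) (by positivity)
  refine ⟨κ / 4, by positivity, fun S 𝒯 hreg t ht i j => ?_⟩
  obtain ⟨hc, -, -, -, -, β, hβ, h1, h2⟩ := corner_data ht hγ hreg i j
  have hd := d_pos ht hγ hreg i
  have hdle := d_le (𝒯 := 𝒯) (t := t) i j
  have hcabs := abs_le.1 hc.abs_inner_le
  set c : ℝ := inner ℝ (𝒯.edgeDir t i j) (𝒯.edgeDir t i (j + 1))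
  -- Half of `d` is the safe size for a parallelogram inside the kite: then `a + c b ≤ d` since `|c|
  -- ≤ 1`, and the triangle condition follows from `β / |E_j| + β / |E_{j+1}| ≤ 1`.
  have hdβ : 𝒯.d t i / 2 ≤ β := by
    rw [h1] at hdle
    nlinarith
  have hℓ := edgeLen_pos ht i j
  have hℓ' := edgeLen_pos ht i (j + 1)
  have := h (𝒯.x i t) _ _ (𝒯.d t i / 2) (𝒯.kite t i j) hc (by positivity) (fun a b ha had hb hbd => by
    refine ⟨?_, ?_, ?_⟩
    · refine (mem_triangle_iff_dir (x_ne ht i j) (x_ne ht i (j + 1))).2 ⟨a, b, ha, hb, le_trans ?_ h2, rfl⟩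
      change a / 𝒯.edgeLen t i j + b / 𝒯.edgeLen t i (j + 1) ≤ _
      gcongr <;> linarith
    · rw [add_assoc, add_sub_cancel_left, hc.inner_left_comb]
      change a + c * b ≤ _
      nlinarith
    · rw [add_assoc, add_sub_cancel_left, hc.inner_right_comb]
      change c * a + b ≤ _
      nlinarith) (measure_T_lt_top t i j fun y hy => hy.1)
  calc _ = κ * (𝒯.d t i / 2) ^ 2 := by ring
    _ ≤ _ := this

end Triangulation

/-! ### Finite element functions and their gradients -/

/-- The points of a convex hull of finitely many points, in terms of weights. -/
theorem exists_weights_of_mem_convexHull {M : ℕ} {pos : Fin M → E3} {K : Finset (Fin M)} {y : E3}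
    (hy : y ∈ convexHull ℝ (pos '' (K : Set (Fin M)))) :
    ∃ w : Fin M → ℝ, (∀ k ∉ K, w k = 0) ∧ (∀ k, 0 ≤ w k) ∧ ∑ k, w k = 1 ∧ ∑ k, w k • pos k = y := by
  have hconv : Convex ℝ {y : E3 | ∃ w : Fin M → ℝ, (∀ k ∉ K, w k = 0) ∧ (∀ k, 0 ≤ w k) ∧ ∑ k, w k = 1 ∧
      ∑ k, w k • pos k = y} := by
    rintro _ ⟨w, h1, h2, h3, rfl⟩ _ ⟨w', h1', h2', h3', rfl⟩ a b ha hb hab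
    refine ⟨fun k => a * w k + b * w' k, fun k hk => by simp [h1 k hk, h1' k hk], fun k => ?_, ?_, ?_⟩
    · have := h2 k
      have := h2' k
      positivity
    · rw [Finset.sum_add_distrib, ← Finset.mul_sum, ← Finset.mul_sum, h3, h3', mul_one, mul_one, hab]
    · rw [Finset.smul_sum, Finset.smul_sum, ← Finset.sum_add_distrib]
      exact Finset.sum_congr rfl fun k _ => by module
  refine convexHull_min ?_ hconv hy
  rintro _ ⟨l, hl, rfl⟩
  refine ⟨Pi.single l 1, fun k hk => Pi.single_eq_of_ne (by rintro rfl; exact hk hl) _, fun k => ?_, by simp, ?_⟩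
  · by_cases h : k = l
    · subst h
      simp
    · simp [Pi.single_eq_of_ne h]
  · simp [Pi.single_apply, ite_smul]

theorem mem_convexHull_of_weights {M : ℕ} {pos : Fin M → E3} {K : Finset (Fin M)} {w : Fin M → ℝ}
    (h1 : ∀ k ∉ K, w k = 0) (h2 : ∀ k, 0 ≤ w k) (h3 : ∑ k, w k = 1) :
    ∑ k, w k • pos k ∈ convexHull ℝ (pos '' (K : Set (Fin M))) := by
  rw [← Finset.sum_subset (Finset.subset_univ K) fun k _ hk => by rw [h1 k hk, zero_smul]]
  rw [← Finset.sum_subset (Finset.subset_univ K) fun k _ hk => h1 k hk] at h3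
  exact (convex_convexHull ℝ _).sum_mem (fun k _ => h2 k) h3
    fun k hk => subset_convexHull ℝ _ (mem_image_of_mem _ hk)

/-- The plane spanned by a corner contains vectors with arbitrary inner products with the sides. -/
theorem IsCorner.exists_inner_eq {σ : ℝ} {e f : E3} (h : IsCorner σ e f) (A B : ℝ) :
    ∃ μ μ' : ℝ, inner ℝ (μ • e + μ' • f) e = A ∧ inner ℝ (μ • e + μ' • f) f = B := by
  have h1 := h.sin
  have h2 := h.pos
  set c : ℝ := inner ℝ e f
  have h3 : 1 - c ^ 2 ≠ 0 := by
    have : 0 < σ ^ 2 := by positivity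
    linarith
  refine ⟨(A - c * B) / (1 - c ^ 2), (B - c * A) / (1 - c ^ 2), ?_, ?_⟩
  · rw [h.inner_left_comb]
    change _ + c * _ = _
    field_simp
    ring
  · rw [h.inner_right_comb]
    change c * _ + _ = _
    field_simp
    ring

namespace Triangulation

variable {S : EvolvingSurface} {𝒯 : Triangulation S}

theorem exists_face_eq {K : Finset (Fin 𝒯.M)} (hK : K ∈ 𝒯.faces) : ∃ i j, K = 𝒯.face i j := by
  have hne : K.Nonempty := Finset.card_pos.1 (by rw [𝒯.faces_card K hK]; norm_num)
  obtain ⟨i, hi⟩ := hne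
  exact ⟨i, (𝒯.star i K).1 ⟨hK, hi⟩⟩

theorem sum_face {F : Type*} [AddCommMonoid F] (i : Fin 𝒯.M) (j : ℕ) (g : Fin 𝒯.M → F) :
    ∑ k ∈ 𝒯.face i j, g k = g i + (g (𝒯.nbr i j) + g (𝒯.nbr i (j + 1))) := by
  rw [face, Finset.sum_insert, Finset.sum_pair (𝒯.nbr_ne_succ i j)]
  simp [(𝒯.nbr_ne i _).symm]

variable {t : ℝ} (ht : t ∈ Icc 0 S.T)
include ht

theorem weights_eq_zero {K : Finset (Fin 𝒯.M)} (hK : K ∈ 𝒯.faces) {v : Fin 𝒯.M → ℝ} (h0 : ∀ k ∉ K, v k = 0)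
    (h1 : ∑ k, v k = 0) (h2 : ∑ k, v k • 𝒯.x k t = 0) : v = 0 := by
  obtain ⟨i, j, rfl⟩ := exists_face_eq hK
  rw [← Finset.sum_subset (Finset.subset_univ (𝒯.face i j)) fun k _ hk => h0 k hk, sum_face] at h1
  rw [← Finset.sum_subset (Finset.subset_univ (𝒯.face i j)) fun k _ hk => by rw [h0 k hk, zero_smul],
    sum_face] at h2
  have h := (affineIndependent_iff.1 (𝒯.nondegenerate t ht i j)) Finset.univ
    ![v i, v (𝒯.nbr i j), v (𝒯.nbr i (j + 1))] (by simp [Fin.sum_univ_three, ← h1, add_assoc])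
    (by
      rw [← h2]
      simp [Fin.sum_univ_three, add_assoc, x])
  have ha := h 0 (Finset.mem_univ _)
  have hb := h 1 (Finset.mem_univ _)
  have hc := h 2 (Finset.mem_univ _)
  simp only [Matrix.cons_val_zero, Matrix.cons_val_one, Matrix.cons_val] at ha hb hc
  funext k
  by_cases hk : k ∈ 𝒯.face i j
  · simp only [face, Finset.mem_insert, Finset.mem_singleton] at hk
    rcases hk with rfl | rfl | rfl
    · exact ha
    · exact hb
    · exact hc
  · exact h0 k hk

/-- The nodal basis is defined through chosen coordinates, so the choice must not matter. A point of
two triangles lies in the hull of their common vertices; weights on these are admissible in both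
triangles, and in each they are unique. -/
theorem IsBary.unique {y : E3} {w w' : Fin 𝒯.M → ℝ} (h : 𝒯.IsBary t y w) (h' : 𝒯.IsBary t y w') : w = w' := by
  obtain ⟨⟨K, hK, hw0⟩, hw1, hw2, hw3⟩ := h
  obtain ⟨⟨K', hK', hw0'⟩, hw1', hw2', hw3'⟩ := h'
  have hy : y ∈ convexHull ℝ ((fun k => 𝒯.x k t) '' ((K ∩ K' : Finset (Fin 𝒯.M)) : Set (Fin 𝒯.M))) := by
    refine (𝒯.inter t ht K hK K' hK').subset ⟨?_, ?_⟩
    · rw [← hw3]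
      exact mem_convexHull_of_weights hw0 hw1 hw2
    · rw [← hw3']
      exact mem_convexHull_of_weights hw0' hw1' hw2'
  obtain ⟨v, hv0, hv1, hv2, hv3⟩ := exists_weights_of_mem_convexHull hy
  have key : ∀ {L : Finset (Fin 𝒯.M)} {u : Fin 𝒯.M → ℝ}, L ∈ 𝒯.faces → K ∩ K' ⊆ L → (∀ k ∉ L, u k = 0) →
      ∑ k, u k = 1 → ∑ k, u k • 𝒯.x k t = y → u = v := by
    intro L u hL hsub hu0 hu2 hu3
    refine sub_eq_zero.1 (weights_eq_zero ht hL (v := u - v) (fun k hk => ?_) ?_ ?_)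
    · rw [Pi.sub_apply, hu0 k hk, hv0 k fun h => hk (hsub h), sub_zero]
    · simp [Finset.sum_sub_distrib, hu2, hv2]
    · simp [Finset.sum_sub_distrib, sub_smul, hu3, hv3]
  rw [key hK Finset.inter_subset_left hw0 hw2 hw3, key hK' Finset.inter_subset_right hw0' hw2' hw3']

/-- The finite element functions are affine on the triangles. -/
theorem fe_apply (u : Fin 𝒯.M → ℝ) (i : Fin 𝒯.M) (j : ℕ) {a b : ℝ} (ha : 0 ≤ a) (hb : 0 ≤ b) (hab : a + b ≤ 1) :
    𝒯.fe u t (𝒯.x i t + a • (𝒯.x (𝒯.nbr i j) t - 𝒯.x i t) + b • (𝒯.x (𝒯.nbr i (j + 1)) t - 𝒯.x i t)) =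
      u i + a * (u (𝒯.nbr i j) - u i) + b * (u (𝒯.nbr i (j + 1)) - u i) := by
  set y := 𝒯.x i t + a • (𝒯.x (𝒯.nbr i j) t - 𝒯.x i t) + b • (𝒯.x (𝒯.nbr i (j + 1)) t - 𝒯.x i t) with hy
  set w : Fin 𝒯.M → ℝ := Pi.single i (1 - a - b) + Pi.single (𝒯.nbr i j) a +
    Pi.single (𝒯.nbr i (j + 1)) b with hw
  have hsum : ∀ {F : Type} [AddCommGroup F] [Module ℝ F] (g : Fin 𝒯.M → F),
      ∑ k, w k • g k = (1 - a - b) • g i + a • g (𝒯.nbr i j) + b • g (𝒯.nbr i (j + 1)) := by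
    intro F _ _ g
    simp only [hw, Pi.add_apply, add_smul, Finset.sum_add_distrib, Pi.single_apply, ite_smul, zero_smul, Finset.sum_ite_eq',
      Finset.mem_univ, if_true]
  have hbary : 𝒯.IsBary t y w := by
    refine ⟨⟨𝒯.face i j, 𝒯.face_mem i j, fun k hk => ?_⟩, fun k => ?_, ?_, ?_⟩
    · simp only [face, Finset.mem_insert, Finset.mem_singleton, not_or] at hk
      simp [hw, hk.1, hk.2.1, hk.2.2]
    · have h1 : 0 ≤ 1 - a - b := by linarith
      simp only [hw, Pi.add_apply, Pi.single_apply]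
      split_ifs <;> positivity
    · have := hsum fun _ => (1 : ℝ)
      simp only [smul_eq_mul, mul_one] at this
      rw [this]
      ring
    · rw [hsum, hy]
      module
  have hχ : ∀ k, 𝒯.χ k y t = w k := by
    intro k
    have h : ∃ w, 𝒯.IsBary t y w := ⟨w, hbary⟩
    rw [χ, dif_pos h, IsBary.unique ht h.choose_spec hbary]
  have := hsum u
  simp only [smul_eq_mul] at this
  simp only [fe, hχ]
  calc ∑ k, u k * w k = ∑ k, w k * u k := Finset.sum_congr rfl fun k _ => mul_comm _ _
    _ = _ := by
      rw [this]
      ring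

variable {γ : ℝ} (hγ : 0 < γ) (hreg : 𝒯.Regular γ)
include hγ hreg

/-- The gradient on a triangle lies in its plane and is determined by the difference quotients along the edges. -/
theorem exists_feGrad_eq (u : Fin 𝒯.M → ℝ) (i : Fin 𝒯.M) (j : ℕ) :
    ∃ μ μ' : ℝ, 𝒯.feGrad u t i j = μ • 𝒯.edgeDir t i j + μ' • 𝒯.edgeDir t i (j + 1) ∧
      inner ℝ (𝒯.feGrad u t i j) (𝒯.edgeDir t i j) = (u (𝒯.nbr i j) - u i) / 𝒯.edgeLen t i j ∧
      inner ℝ (𝒯.feGrad u t i j) (𝒯.edgeDir t i (j + 1)) =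
        (u (𝒯.nbr i (j + 1)) - u i) / 𝒯.edgeLen t i (j + 1) := by
  obtain ⟨hc, -⟩ := corner_data ht hγ hreg i j
  set p := 𝒯.x i t
  set q := 𝒯.x (𝒯.nbr i j) t
  set r := 𝒯.x (𝒯.nbr i (j + 1)) t
  have hℓ := edgeLen_pos ht i j
  have hℓ' := edgeLen_pos ht i (j + 1)
  have hq : q - p = 𝒯.edgeLen t i j • 𝒯.edgeDir t i j := (dist_smul_dir p q).symm
  have hr : r - p = 𝒯.edgeLen t i (j + 1) • 𝒯.edgeDir t i (j + 1) := (dist_smul_dir p r).symm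
  obtain ⟨m, m', hm, hm'⟩ := hc.exists_inner_eq ((u (𝒯.nbr i j) - u i) / 𝒯.edgeLen t i j)
    ((u (𝒯.nbr i (j + 1)) - u i) / 𝒯.edgeLen t i (j + 1))
  set g := m • 𝒯.edgeDir t i j + m' • 𝒯.edgeDir t i (j + 1)
  have hfe : EqOn (𝒯.fe u t) (fun y => u i + innerSL ℝ g (y - p)) (𝒯.T t i j) := by
    intro y hy
    obtain ⟨a, b, ha, hb, hab, rfl⟩ := mem_triangle_iff.1 hy
    rw [fe_apply ht u i j ha hb hab]
    simp only [innerSL_apply_apply]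
    rw [add_assoc p, add_sub_cancel_left, hq, hr, inner_add_right, inner_smul_right, inner_smul_right,
      inner_smul_right, inner_smul_right, hm, hm']
    field_simp
    ring
  have hpT : p ∈ 𝒯.T t i j := subset_convexHull ℝ _ (by simp [p])
  have hqT : q ∈ 𝒯.T t i j := subset_convexHull ℝ _ (by simp [q])
  have hrT : r ∈ 𝒯.T t i j := subset_convexHull ℝ _ (by simp [r])
  have hder : HasFDerivWithinAt (𝒯.fe u t) (innerSL ℝ g) (𝒯.T t i j) p := by
    refine HasFDerivWithinAt.congr ?_ hfe (hfe hpT)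
    exact (((innerSL ℝ g).hasFDerivAt.comp p ((hasFDerivAt_id p).sub_const p)).const_add _).hasFDerivWithinAt
  -- A derivative within a flat triangle is not unique in space, but any two agree on directions
  -- into the triangle; the projection onto its plane discards the rest.
  have hseg : ∀ z ∈ 𝒯.T t i j, inner ℝ (gradientWithin (𝒯.fe u t) (𝒯.T t i j) p) (z - p) = inner ℝ g (z - p) := by
    intro z hz
    rw [inner_gradientWithin_left]
    exact hder.differentiableWithinAt.hasFDerivWithinAt.unique_on hder
      (mem_tangentConeAt_of_segment_subset ((convex_convexHull ℝ _).segment_subset hpT hz))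
  have hspan : vectorSpan ℝ {p, q, r} = Submodule.span ℝ {𝒯.edgeDir t i j, 𝒯.edgeDir t i (j + 1)} := by
    rw [vectorSpan_eq_span_vsub_set_right ℝ (p := p) (by simp)]
    refine le_antisymm (Submodule.span_le.2 ?_) (Submodule.span_le.2 ?_)
    · rintro _ ⟨z, rfl | rfl | rfl, rfl⟩
      · simp
      · change q - p ∈ _
        rw [hq]
        exact Submodule.smul_mem _ _ (Submodule.subset_span (by simp))
      · change r - p ∈ _
        rw [hr]
        exact Submodule.smul_mem _ _ (Submodule.subset_span (by simp))
    · rintro _ (rfl | rfl)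
      · exact Submodule.smul_mem _ _ (Submodule.subset_span ⟨q, by simp, rfl⟩)
      · exact Submodule.smul_mem _ _ (Submodule.subset_span ⟨r, by simp, rfl⟩)
  have hproj : ∀ z ∈ 𝒯.T t i j, z - p ∈ vectorSpan ℝ {p, q, r} →
      inner ℝ (𝒯.feGrad u t i j) (z - p) = inner ℝ g (z - p) := by
    intro z hz hzs
    rw [feGrad, Submodule.inner_starProjection_left_eq_right, Submodule.starProjection_eq_self_iff.2 hzs, hseg z hz]
  have hmem : 𝒯.feGrad u t i j ∈ vectorSpan ℝ {p, q, r} := Submodule.starProjection_apply_mem _ _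
  rw [hspan] at hmem
  obtain ⟨μ, μ', hμ⟩ := Submodule.mem_span_pair.1 hmem
  refine ⟨μ, μ', hμ.symm, ?_, ?_⟩
  · have h1 := hproj q hqT (vsub_mem_vectorSpan ℝ (by simp) (by simp))
    rw [hq, inner_smul_right, inner_smul_right, hm] at h1
    exact mul_left_cancel₀ hℓ.ne' h1
  · have h1 := hproj r hrT (vsub_mem_vectorSpan ℝ (by simp) (by simp))
    rw [hr, inner_smul_right, inner_smul_right, hm'] at h1
    exact mul_left_cancel₀ hℓ'.ne' h1

end Triangulation

/-! ### Stars do not fold over -/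

/-- A point on a short normal segment has its foot as a closest point. -/
theorem isClosestPoint_of_normal {A : Set E3} {y n z : E3} {L s : ℝ} (hy : y ∈ A)
    (hA : ∀ q ∈ A, |inner ℝ n (q - y)| ≤ L * ‖q - y‖ ^ 2) (hz : z - y = s • n) (hs : 2 * |s| * L ≤ 1) :
    IsClosestPoint A z y := by
  refine ⟨hy, le_antisymm ?_ (Metric.infDist_le_dist_of_mem hy)⟩
  rw [Metric.le_infDist ⟨y, hy⟩]
  intro q hq
  rw [dist_eq_norm, dist_eq_norm]
  rw [← sq_le_sq₀ (norm_nonneg _) (norm_nonneg _)]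
  have h1 : z - q = s • n - (q - y) := by rw [← hz]; abel
  rw [h1, hz, @norm_sub_sq_real _ _ _ (s • n), inner_smul_left]
  simp only [conj_trivial]
  -- The cross term in `‖z - q‖²` is at most `2|s|L‖q - y‖²`, which the term `‖q - y‖²` absorbs.
  have h2 : s * inner ℝ n (q - y) ≤ |s| * (L * ‖q - y‖ ^ 2) := by
    refine (le_abs_self _).trans ?_
    rw [abs_mul]
    exact mul_le_mul_of_nonneg_left (hA q hq) (abs_nonneg _)
  nlinarith [sq_nonneg ‖q - y‖, mul_le_mul_of_nonneg_right hs (sq_nonneg ‖q - y‖)]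

namespace Triangulation

set_option maxHeartbeats 1000000 in
/-- Two different triangles of a star do not have close directions in their interiors. -/
theorem exists_no_fold (S : EvolvingSurface) {γ κ K : ℝ} (hγ : 0 < γ) (hκ : 0 < κ) (hκK : κ ≤ K) (hK : 1 ≤ K) :
    ∃ η > 0, ∃ δ > 0, ∀ 𝒯 : Triangulation S, 𝒯.Regular γ → ∀ t ∈ Icc 0 S.T, ∀ i j k, 𝒯.face i j ≠ 𝒯.face i k →
      𝒯.edgeLen t i j ≤ δ → 𝒯.edgeLen t i (j + 1) ≤ δ → 𝒯.edgeLen t i k ≤ δ → 𝒯.edgeLen t i (k + 1) ≤ δ →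
      ∀ β ∈ Icc κ K, ∀ β' ∈ Icc κ K, ∀ ζ ∈ Icc κ K, ∀ ζ' ∈ Icc κ K,
      η ≤ ‖(β • 𝒯.edgeDir t i j + β' • 𝒯.edgeDir t i (j + 1)) -
        (ζ • 𝒯.edgeDir t i k + ζ' • 𝒯.edgeDir t i (k + 1))‖ := by
  obtain ⟨L, hL, hest⟩ := S.exists_normal_estimate
  have hσ : 0 < γ⁻¹ := by positivity
  set σ := γ⁻¹ with hσdef
  -- The bound `σκ/6` keeps the perturbed coefficients nonnegative, `σ/(20L)` makes the normal of
  -- the surface transversal to the triangles, and `1/(2L)` makes normal segments short enough for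
  -- `isClosestPoint_of_normal`.
  refine ⟨min 1 (σ * κ / 6), by positivity, min (σ / (20 * L)) (1 / (2 * L)), by positivity, ?_⟩
  intro 𝒯 hreg t ht i j k hjk h1 h2 h3 h4 β hβ β' hβ' ζ hζ ζ' hζ'
  set η := min 1 (σ * κ / 6)
  set δ := min (σ / (20 * L)) (1 / (2 * L))
  have hη1 : η ≤ 1 := min_le_left _ _
  have hη2 : η ≤ σ * κ / 6 := min_le_right _ _
  have hδ1 : 20 * L * δ ≤ σ := by
    have : δ ≤ σ / (20 * L) := min_le_left _ _
    rwa [le_div_iff₀' (by positivity)] at this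
  have hδ2 : 2 * L * δ ≤ 1 := by
    have : δ ≤ 1 / (2 * L) := min_le_right _ _
    rwa [le_div_iff₀' (by positivity)] at this
  by_contra! hlt
  obtain ⟨hcj, -⟩ := corner_data ht hγ hreg i j
  obtain ⟨hck, -⟩ := corner_data ht hγ hreg i k
  set b := β • 𝒯.edgeDir t i j + β' • 𝒯.edgeDir t i (j + 1) with hb
  set b' := ζ • 𝒯.edgeDir t i k + ζ' • 𝒯.edgeDir t i (k + 1) with hb'
  set x := 𝒯.x i t with hx
  set ℓ := min (min (𝒯.edgeLen t i j) (𝒯.edgeLen t i (j + 1))) (min (𝒯.edgeLen t i k) (𝒯.edgeLen t i (k + 1)))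
    with hℓdef
  have hℓ : 0 < ℓ := lt_min (lt_min (edgeLen_pos ht i j) (edgeLen_pos ht i (j + 1)))
    (lt_min (edgeLen_pos ht i k) (edgeLen_pos ht i (k + 1)))
  have hℓj : ℓ ≤ 𝒯.edgeLen t i j := (min_le_left _ _).trans (min_le_left _ _)
  have hℓj' : ℓ ≤ 𝒯.edgeLen t i (j + 1) := (min_le_left _ _).trans (min_le_right _ _)
  have hℓk : ℓ ≤ 𝒯.edgeLen t i k := (min_le_right _ _).trans (min_le_left _ _)
  have hℓk' : ℓ ≤ 𝒯.edgeLen t i (k + 1) := (min_le_right _ _).trans (min_le_right _ _)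
  have hK0 : 0 < K := by linarith
  -- With this scale, points with coefficients up to `2K` stay inside all triangles involved: each
  -- of the two barycentric weights is at most `1/2`.
  set ρ := ℓ / (4 * K) with hρ
  have hρ0 : 0 < ρ := by positivity
  have hρK : ρ * K = ℓ / 4 := by rw [hρ]; field_simp
  have hmem : ∀ l, ℓ ≤ 𝒯.edgeLen t i l → ℓ ≤ 𝒯.edgeLen t i (l + 1) → ∀ a a' : ℝ, 0 ≤ a → a ≤ 2 * K → 0 ≤ a' →
      a' ≤ 2 * K → x + ρ • (a • 𝒯.edgeDir t i l + a' • 𝒯.edgeDir t i (l + 1)) ∈ 𝒯.T t i l := by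
    intro l hl hl' a a' ha haK ha' haK'
    refine (mem_triangle_iff_dir (x_ne ht i l) (x_ne ht i (l + 1))).2
      ⟨ρ * a, ρ * a', by positivity, by positivity, ?_, ?_⟩
    · have e1 : ρ * a / 𝒯.edgeLen t i l ≤ 1 / 2 := by
        rw [div_le_iff₀ (edgeLen_pos ht i l)]
        have := mul_le_mul_of_nonneg_left haK hρ0.le
        linarith
      have e2 : ρ * a' / 𝒯.edgeLen t i (l + 1) ≤ 1 / 2 := by
        rw [div_le_iff₀ (edgeLen_pos ht i (l + 1))]
        have := mul_le_mul_of_nonneg_left haK' hρ0.le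
        linarith
      change ρ * a / 𝒯.edgeLen t i l + ρ * a' / 𝒯.edgeLen t i (l + 1) ≤ 1
      linarith
    · rw [smul_add, smul_smul, smul_smul, ← add_assoc]
      rfl
  set z := x + ρ • b with hz
  have hzT : z ∈ 𝒯.T t i j := hmem j hℓj hℓj' β β' (by linarith [hβ.1]) (by linarith [hβ.2])
    (by linarith [hβ'.1]) (by linarith [hβ'.2])
  have hzx : ‖z - x‖ ≤ ℓ / 2 := by
    rw [hz, add_sub_cancel_left, norm_smul, Real.norm_eq_abs, abs_of_pos hρ0]
    have : ‖b‖ ≤ 2 * K := by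
      refine (norm_add_le _ _).trans ?_
      rw [norm_smul, norm_smul, norm_edgeDir ht, norm_edgeDir ht, Real.norm_eq_abs, Real.norm_eq_abs,
        abs_of_pos (by linarith [hβ.1]), abs_of_pos (by linarith [hβ'.1])]
      linarith [hβ.2, hβ'.2]
    calc ρ * ‖b‖ ≤ ρ * (2 * K) := by gcongr
      _ = ℓ / 2 := by linarith
  obtain ⟨Ψ, hΨ⟩ := 𝒯.closestPoint t ht
  set zz : polyhedron 𝒯.faces (fun k => S.Φ (𝒯.x₀ k) t) := ⟨z, 𝒯.T_subset_polyhedron t i j hzT⟩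
  set y : E3 := (Ψ zz : E3) with hy
  have hyc : IsClosestPoint (S.Γ t) z y := (hΨ zz y).2 rfl
  have hyΓ : y ∈ S.Γ t := hyc.1
  have hxΓ : x ∈ S.Γ t := 𝒯.x_mem i
  have hzy : ‖z - y‖ ≤ ℓ / 2 := by
    rw [← dist_eq_norm, hyc.2]
    refine (Metric.infDist_le_dist_of_mem hxΓ).trans ?_
    rwa [dist_eq_norm]
  have hxy : ‖x - y‖ ≤ ℓ := by
    have : x - y = (z - y) - (z - x) := by abel
    rw [this]
    linarith [norm_sub_le (z - y) (z - x)]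
  set n := S.ν y t
  have hn : ‖n‖ = 1 := S.ν_unit t ht y hyΓ
  -- The edges are nearly orthogonal to the normal at `y`, not only at the vertex: both endpoints
  -- are surface points at distance at most twice the edge length from `y`.
  have hLδ : ∀ l, ℓ ≤ 𝒯.edgeLen t i l → 𝒯.edgeLen t i l ≤ δ → |inner ℝ n (𝒯.edgeDir t i l)| ≤ 5 * L * δ := by
    intro l hl hlδ
    set q := 𝒯.x (𝒯.nbr i l) t
    have hq : q - x = 𝒯.edgeLen t i l • 𝒯.edgeDir t i l := (dist_smul_dir x q).symm
    have hpos := edgeLen_pos ht i l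
    have hqx : ‖q - x‖ = 𝒯.edgeLen t i l := by
      rw [hq, norm_smul, norm_edgeDir ht, mul_one, Real.norm_eq_abs, abs_of_pos hpos]
    have e1 := hest t ht y hyΓ q (𝒯.x_mem _)
    have e2 := hest t ht y hyΓ x hxΓ
    have e3 : ‖q - y‖ ≤ 2 * 𝒯.edgeLen t i l := by
      have : q - y = (q - x) + (x - y) := by abel
      rw [this]
      linarith [norm_add_le (q - x) (x - y)]
    have e4 : ‖q - y‖ ^ 2 ≤ (2 * 𝒯.edgeLen t i l) ^ 2 := by gcongr
    have e5 : ‖x - y‖ ^ 2 ≤ (𝒯.edgeLen t i l) ^ 2 := by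
      gcongr
      linarith
    have e6 : 𝒯.edgeLen t i l * inner ℝ n (𝒯.edgeDir t i l) = inner ℝ n (q - y) - inner ℝ n (x - y) := by
      rw [← inner_smul_right, ← hq, ← inner_sub_right]
      congr 1
      abel
    have e7 : 𝒯.edgeLen t i l * |inner ℝ n (𝒯.edgeDir t i l)| ≤ 𝒯.edgeLen t i l * (5 * L * 𝒯.edgeLen t i l) := by
      rw [← abs_of_pos hpos, ← abs_mul, abs_of_pos hpos, e6]
      refine (abs_sub _ _).trans ?_
      nlinarith
    exact (le_of_mul_le_mul_left e7 hpos).trans (by gcongr)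
  obtain ⟨N, hN, hNe, hNf, hdec⟩ := hck.exists_normal
  have hNn : 1 / 2 ≤ |inner ℝ N n| := by
    refine le_trans ?_ (hck.le_abs_inner_normal hN hNe hNf hdec hn (hLδ k hℓk h3) (hLδ (k + 1) hℓk' h4))
    have : 2 * (5 * L * δ) / σ ≤ 1 / 2 := by
      rw [div_le_iff₀ hσ]
      linarith
    linarith
  have hNn0 : inner ℝ N n ≠ 0 := by
    intro h0
    rw [h0, abs_zero] at hNn
    linarith
  -- Chosen so that `b - b' + σ₀ n` lies in the plane of `T_k`: the normal line through `z` is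
  -- followed until it meets that plane.
  set σ₀ := -inner ℝ N (b - b') / inner ℝ N n with hσ₀
  have hσ₀le : |σ₀| ≤ 2 * η := by
    rw [hσ₀, abs_div, abs_neg, div_le_iff₀ (by linarith)]
    have e1 := abs_real_inner_le_norm N (b - b')
    rw [hN, one_mul] at e1
    calc |inner ℝ N (b - b')| ≤ η := e1.trans hlt.le
      _ = 2 * η * (1 / 2) := by ring
      _ ≤ 2 * η * |inner ℝ N n| := by
        have : 0 ≤ η := (norm_nonneg _).trans hlt.le
        gcongr
  obtain ⟨μ, μ', hμ⟩ := hdec (b - b' + σ₀ • n)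
  have hNw : inner ℝ N (b - b' + σ₀ • n) = 0 := by
    rw [inner_add_right, inner_smul_right, hσ₀]
    field_simp
    ring
  rw [hNw, zero_smul, add_zero] at hμ
  have hw : ‖μ • 𝒯.edgeDir t i k + μ' • 𝒯.edgeDir t i (k + 1)‖ ≤ 3 * η := by
    rw [← hμ]
    refine (norm_add_le _ _).trans ?_
    rw [norm_smul, hn, Real.norm_eq_abs]
    linarith
  have hcoef : 3 * η / σ ≤ κ / 2 := by
    rw [div_le_iff₀ hσ]
    linarith
  have hμ1 := abs_le.1 ((hck.abs_left_coeff_le μ μ').trans ((div_le_div_of_nonneg_right hw hσ.le).trans hcoef))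
  have hμ2 := abs_le.1 ((hck.abs_right_coeff_le μ μ').trans ((div_le_div_of_nonneg_right hw hσ.le).trans hcoef))
  have hz' : z + (ρ * σ₀) • n = x + ρ • ((ζ + μ) • 𝒯.edgeDir t i k + (ζ' + μ') • 𝒯.edgeDir t i (k + 1)) := by
    have : (ζ + μ) • 𝒯.edgeDir t i k + (ζ' + μ') • 𝒯.edgeDir t i (k + 1) = b' +
        (μ • 𝒯.edgeDir t i k + μ' • 𝒯.edgeDir t i (k + 1)) := by
      rw [hb']
      module
    rw [this, ← hμ, hz]
    module
  -- The point reached has coefficients `ζ + μ` and `ζ' + μ'` with `|μ|, |μ'| ≤ κ/2`, so it is in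
  -- the triangle and not merely in its plane.
  have hz'T : z + (ρ * σ₀) • n ∈ 𝒯.T t i k := by
    rw [hz']
    exact hmem k hℓk hℓk' _ _ (by linarith [hζ.1]) (by linarith [hζ.2]) (by linarith [hζ'.1]) (by linarith [hζ'.2])
  obtain ⟨s, hs⟩ := S.exists_closest_eq ht hyc
  have hsabs : |s| ≤ ℓ / 2 := by
    rw [hs, norm_smul, hn, mul_one, Real.norm_eq_abs] at hzy
    exact hzy
  have hρσ : |ρ * σ₀| ≤ ℓ / 2 := by
    rw [abs_mul, abs_of_pos hρ0]
    have e1 : ρ * |σ₀| ≤ ρ * (2 * K) := by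
      gcongr
      linarith
    linarith
  have hy' : IsClosestPoint (S.Γ t) (z + (ρ * σ₀) • n) y := by
    refine isClosestPoint_of_normal (L := L) (s := s + ρ * σ₀) hyΓ (fun q hq => hest t ht y hyΓ q hq) ?_ ?_
    · rw [add_sub_right_comm, hs, add_smul]
    · have e1 : |s + ρ * σ₀| ≤ δ := (abs_add_le _ _).trans (by linarith)
      calc 2 * |s + ρ * σ₀| * L ≤ 2 * δ * L := by gcongr
        _ ≤ 1 := by linarith
  -- Both points have the closest point `y`, so injectivity of the closest point map identifies
  -- them. Then `z` lies in two different triangles, hence on an edge of `T_j`, although both its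
  -- coefficients there are positive.
  have hzz : z = z + (ρ * σ₀) • n := by
    have e1 := (hΨ ⟨_, 𝒯.T_subset_polyhedron t i k hz'T⟩ y).1 hy'
    have e2 := Ψ.injective (Subtype.ext (hy.symm.trans e1))
    exact congrArg Subtype.val e2
  rw [← hzz] at hz'T
  have hfin : ∃ c c' : ℝ, (c = 0 ∨ c' = 0) ∧ ρ • b = c • 𝒯.edgeDir t i j + c' • 𝒯.edgeDir t i (j + 1) := by
    rcases inter_subset_edge ht hjk hzT hz'T with h0 | ⟨l, hl, -, s', -, h0⟩
    · refine ⟨0, 0, Or.inl rfl, ?_⟩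
      rw [hz, add_eq_left] at h0
      simp [h0]
    · rw [hz, add_right_inj] at h0
      rcases hl with rfl | rfl
      · exact ⟨s', 0, Or.inr rfl, by simp [h0]⟩
      · exact ⟨0, s', Or.inl rfl, by simp [h0]⟩
  obtain ⟨c, c', hcc, h0⟩ := hfin
  have e0 := hcj.coeff_eq_zero (μ := ρ * β - c) (μ' := ρ * β' - c') (by
    rw [← sub_eq_zero] at h0
    rw [← h0, hb]
    module)
  have e1 : 0 < ρ * β := mul_pos hρ0 (by linarith [hβ.1])
  have e2 : 0 < ρ * β' := mul_pos hρ0 (by linarith [hβ'.1])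
  rcases hcc with rfl | rfl
  · linarith [e0.1]
  · linarith [e0.2]

end Triangulation

/-! ### Comparability of the triangles of a star -/

namespace Triangulation

variable {S : EvolvingSurface} {𝒯 : Triangulation S} {t : ℝ}

theorem edgeLen_le_diam (t : ℝ) (i : Fin 𝒯.M) (j : ℕ) :
    𝒯.edgeLen t i j ≤ Metric.diam (𝒯.T t i j) ∧ 𝒯.edgeLen t i (j + 1) ≤ Metric.diam (𝒯.T t i j) :=
  ⟨(dist_le_diam_triangle _ _ _).1, (dist_le_diam_triangle _ _ _).2.1⟩

theorem T_mod (t : ℝ) (i : Fin 𝒯.M) (j : ℕ) : 𝒯.T t i (j % 𝒯.Υ i) = 𝒯.T t i j := by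
  have h1 : 𝒯.nbr i (j % 𝒯.Υ i + 1) = 𝒯.nbr i (j + 1) := by
    rw [𝒯.nbr_eq_iff]
    simp
  rw [T, T, 𝒯.nbr_mod, h1]

theorem diam_le_starDiam (t : ℝ) (i : Fin 𝒯.M) (j : ℕ) : Metric.diam (𝒯.T t i j) ≤ 𝒯.starDiam t i := by
  rw [← T_mod]
  exact le_ciSup (f := fun j : Fin (𝒯.Υ i) => Metric.diam (𝒯.T t i j)) (Set.finite_range _).bddAbove
    ⟨j % 𝒯.Υ i, Nat.mod_lt _ (𝒯.Υ_pos i)⟩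

theorem edgeLen_le_starDiam (t : ℝ) (i : Fin 𝒯.M) (j : ℕ) : 𝒯.edgeLen t i j ≤ 𝒯.starDiam t i :=
  (edgeLen_le_diam t i j).1.trans (diam_le_starDiam t i j)

theorem exists_diam_T_le (S : EvolvingSurface) : ∃ R > 0, ∀ 𝒯 : Triangulation S, ∀ t ∈ Icc 0 S.T, ∀ i j,
    Metric.diam (𝒯.T t i j) ≤ R := by
  obtain ⟨R, hR, h⟩ := S.exists_diam_bound
  refine ⟨R, hR, fun 𝒯 t ht i j => ?_⟩
  rw [T, triangle, convexHull_diam]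
  refine Metric.diam_le_of_forall_dist_le hR.le fun y hy z hz => ?_
  rw [dist_eq_norm]
  have hmem : ∀ y ∈ ({𝒯.x i t, 𝒯.x (𝒯.nbr i j) t, 𝒯.x (𝒯.nbr i (j + 1)) t} : Set E3), y ∈ S.Γ t := by
    rintro _ (rfl | rfl | rfl) <;> exact 𝒯.x_mem _
  exact h t ht y (hmem y hy) z (hmem z hz)

theorem starDiam_le_meshSize (ht : t ∈ Icc 0 S.T) (i : Fin 𝒯.M) : 𝒯.starDiam t i ≤ 𝒯.meshSize := by
  have : Nonempty (Fin (𝒯.Υ i)) := ⟨⟨0, 𝒯.Υ_pos i⟩⟩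
  obtain ⟨R, -, hR⟩ := exists_diam_T_le S
  refine ciSup_le fun j => le_csSup ⟨R, ?_⟩ ⟨t, ht, i, j, rfl⟩
  rintro _ ⟨s, hs, k, l, rfl⟩
  exact hR 𝒯 s hs k l

theorem one_le_of_regular (ht : t ∈ Icc 0 S.T) {γ : ℝ} (hγ : 0 < γ) (hreg : 𝒯.Regular γ) (i : Fin 𝒯.M) : 1 ≤ γ :=
  (inv_le_one₀ hγ).1 (corner_data ht hγ hreg i 0).1.le_one

/-- The edges are nearly tangential. -/
theorem exists_inner_ν_edgeDir_le (S : EvolvingSurface) : ∃ L > 0, ∀ 𝒯 : Triangulation S, ∀ t ∈ Icc 0 S.T, ∀ i j,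
    |inner ℝ (S.ν (𝒯.x i t) t) (𝒯.edgeDir t i j)| ≤ L * 𝒯.starDiam t i := by
  obtain ⟨L, hL, hest⟩ := S.exists_normal_estimate
  refine ⟨L, hL, fun 𝒯 t ht i j => ?_⟩
  have hpos := edgeLen_pos ht i j
  have h2 := hest t ht _ (𝒯.x_mem i) _ (𝒯.x_mem (𝒯.nbr i j))
  rw [← dist_smul_dir, inner_smul_right, norm_smul, ← edgeDir_eq, norm_edgeDir ht, mul_one, abs_mul,
    Real.norm_eq_abs, abs_dist] at h2
  change 𝒯.edgeLen t i j * _ ≤ L * 𝒯.edgeLen t i j ^ 2 at h2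
  have h3 : |inner ℝ (S.ν (𝒯.x i t) t) (𝒯.edgeDir t i j)| ≤ L * 𝒯.edgeLen t i j := by
    refine le_of_mul_le_mul_left ?_ hpos
    linarith
  exact h3.trans (mul_le_mul_of_nonneg_left (edgeLen_le_starDiam t i j) hL.le)

/-- The number of triangles in a star that are all small is bounded. -/
theorem exists_card_small_le (S : EvolvingSurface) {γ : ℝ} (hγ : 0 < γ) : ∃ N₀ : ℕ, ∃ δ > 0, ∀ 𝒯 : Triangulation S,
    𝒯.Regular γ → ∀ t ∈ Icc 0 S.T, ∀ i j, N₀ < 𝒯.Υ i → ∃ m ≤ N₀, δ < Metric.diam (𝒯.T t i (j + m)) := by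
  -- With all coefficients equal to one, the vectors `e_l + e_{l+1}` of different small triangles
  -- are `η`-separated in a ball of radius 2. A cover by balls of radius `η/2` and the pigeonhole
  -- principle bound their number.
  obtain ⟨η, hη, δ, hδ, h⟩ := exists_no_fold S hγ one_pos le_rfl le_rfl
  obtain ⟨s, -, hs, hcov⟩ := (isCompact_closedBall (0 : E3) 2).finite_cover_balls (half_pos hη)
  refine ⟨hs.toFinset.card, δ, hδ, fun 𝒯 hreg t ht i j hN => ?_⟩
  by_contra! hsmall
  set b : ℕ → E3 := fun l => 𝒯.edgeDir t i (j + l) + 𝒯.edgeDir t i (j + l + 1) with hb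
  have hex : ∀ l, ∃ y ∈ s, b l ∈ Metric.ball y (η / 2) := by
    intro l
    have : b l ∈ Metric.closedBall (0 : E3) 2 := by
      rw [mem_closedBall_zero_iff]
      refine (norm_add_le _ _).trans ?_
      rw [norm_edgeDir ht, norm_edgeDir ht]
      norm_num
    simpa using hcov this
  choose c hcs hcb using hex
  obtain ⟨l, hl, m, hm, hlm, hc⟩ := Finset.exists_ne_map_eq_of_card_lt_of_maps_to
    (s := Finset.range (hs.toFinset.card + 1)) (t := hs.toFinset) (f := c) (by simp)
    (fun l _ => hs.mem_toFinset.2 (hcs l))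
  rw [Finset.mem_range] at hl hm
  have hface : 𝒯.face i (j + l) ≠ 𝒯.face i (j + m) := by
    rw [Ne, 𝒯.face_eq_iff]
    intro h1
    have h2 := Nat.ModEq.add_left_cancel' j h1
    rw [Nat.ModEq, Nat.mod_eq_of_lt (by omega), Nat.mod_eq_of_lt (by omega)] at h2
    exact hlm h2
  have hl' := hsmall l (by omega)
  have hm' := hsmall m (by omega)
  have hel := edgeLen_le_diam (𝒯 := 𝒯) t i (j + l)
  have hem := edgeLen_le_diam (𝒯 := 𝒯) t i (j + m)
  have h1 : (1 : ℝ) ∈ Icc (1 : ℝ) 1 := ⟨le_rfl, le_rfl⟩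
  have := h 𝒯 hreg t ht i (j + l) (j + m) hface (hel.1.trans hl') (hel.2.trans hl') (hem.1.trans hm')
    (hem.2.trans hm') 1 h1 1 h1 1 h1 1 h1
  rw [one_smul, one_smul, one_smul, one_smul, ← dist_eq_norm] at this
  have hd1 := hcb l
  have hd2 := hcb m
  rw [← hc] at hd2
  rw [Metric.mem_ball] at hd1 hd2
  have := dist_triangle_right (b l) (b m) (c l)
  linarith

/-- Consecutive triangles share an edge whose length is comparable to both diameters, so each step
around the vertex costs a factor `γ`. -/
theorem diam_add_le (ht : t ∈ Icc 0 S.T) {γ : ℝ} (hγ : 0 < γ) (hreg : 𝒯.Regular γ) (i : Fin 𝒯.M) (j m : ℕ) :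
    Metric.diam (𝒯.T t i (j + m)) ≤ γ ^ m * Metric.diam (𝒯.T t i j) := by
  induction m with
  | zero => simp
  | succ m ih =>
    obtain ⟨-, h1, -⟩ := corner_data ht hγ hreg i (j + m + 1)
    have h2 := (edgeLen_le_diam (𝒯 := 𝒯) t i (j + m)).2
    calc Metric.diam (𝒯.T t i (j + (m + 1))) ≤ γ * 𝒯.edgeLen t i (j + m + 1) := h1
      _ ≤ γ * (γ ^ m * Metric.diam (𝒯.T t i j)) := by
        gcongr
        exact h2.trans ih
      _ = γ ^ (m + 1) * Metric.diam (𝒯.T t i j) := by ring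

/-- The triangles of a star have comparable diameters. -/
theorem exists_starDiam_le (S : EvolvingSurface) {γ : ℝ} (hγ : 0 < γ) : ∃ C > 0, ∀ 𝒯 : Triangulation S,
    𝒯.Regular γ → ∀ t ∈ Icc 0 S.T, ∀ i, 𝒯.starDiam t i ≤ C * 𝒯.d t i := by
  obtain ⟨N₀, δ, hδ, hN⟩ := exists_card_small_le S hγ
  obtain ⟨R, hR, hRle⟩ := exists_diam_T_le S
  refine ⟨(1 + R / δ) * γ ^ (2 * N₀) * (2 * γ ^ 2), by positivity, fun 𝒯 hreg t ht i => ?_⟩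
  have hγ1 := one_le_of_regular ht hγ hreg i
  have : Nonempty (Fin (𝒯.Υ i)) := ⟨⟨0, 𝒯.Υ_pos i⟩⟩
  obtain ⟨j₀, hj₀⟩ := exists_d_eq (𝒯 := 𝒯) t i
  obtain ⟨-, -, -, hcon, -⟩ := corner_data ht hγ hreg i j₀
  rw [← hj₀] at hcon
  refine ciSup_le fun k => ?_
  rw [mul_assoc]
  refine le_trans ?_ (mul_le_mul_of_nonneg_left hcon (by positivity))
  rw [← T_mod t i j₀]
  set j := j₀ % 𝒯.Υ i
  have hj : j < 𝒯.Υ i := Nat.mod_lt _ (𝒯.Υ_pos i)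
  set D := Metric.diam (𝒯.T t i j)
  have hD : 0 ≤ D := Metric.diam_nonneg
  -- Going around forwards from the minimizing triangle `j`, the triangle `k` is reached after `m <
  -- 2 Υ i` steps.
  obtain ⟨m, hm⟩ : ∃ m, (k : ℕ) + 𝒯.Υ i = j + m := ⟨k + 𝒯.Υ i - j, by omega⟩
  have hk := k.2
  have hTk : 𝒯.T t i k = 𝒯.T t i (j + m) := by
    rw [← hm, ← T_mod t i (k + 𝒯.Υ i), Nat.add_mod_right, T_mod]
  rcases le_or_gt m (2 * N₀) with hmN | hmN
  · rw [hTk]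
    refine (diam_add_le ht hγ hreg i j m).trans ?_
    gcongr
    calc γ ^ m ≤ γ ^ (2 * N₀) := pow_le_pow_right₀ hγ1 hmN
      _ ≤ (1 + R / δ) * γ ^ (2 * N₀) := le_mul_of_one_le_left (by positivity) (by
        have : 0 ≤ R / δ := by positivity
        linarith)
  -- Since `m < 2 Υ i`, a long way forces `Υ i > N₀`. Then a triangle of diameter above `δ` occurs
  -- within `N₀` steps; this bounds the diameter of `j` below, while all diameters are at most `R`.
  · obtain ⟨l, hl, hlδ⟩ := hN 𝒯 hreg t ht i j (by omega)
    have h1 : δ ≤ γ ^ (2 * N₀) * D := by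
      refine hlδ.le.trans ((diam_add_le ht hγ hreg i j l).trans ?_)
      gcongr
      · omega
    calc Metric.diam (𝒯.T t i k) ≤ R := hRle 𝒯 t ht i k
      _ = R / δ * δ := by field_simp
      _ ≤ R / δ * (γ ^ (2 * N₀) * D) := by gcongr
      _ ≤ (1 + R / δ) * (γ ^ (2 * N₀) * D) := by
        gcongr
        linarith
      _ = (1 + R / δ) * γ ^ (2 * N₀) * D := by ring

end Triangulation

/-! ### Conormals and their cancellation -/

/-- The unit vector orthogonal to `e` in the plane of the corner, on the side of `f`. -/
noncomputable def conormal (e f : E3) : E3 := (√(1 - inner ℝ e f ^ 2))⁻¹ • (f - (inner ℝ e f : ℝ) • e)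

namespace IsCorner

variable {σ : ℝ} {e f : E3} (h : IsCorner σ e f)
include h

theorem le_sqrt : σ ≤ √(1 - inner ℝ e f ^ 2) := Real.le_sqrt_of_sq_le h.sin

omit h in
theorem sqrt_le_one : √(1 - inner ℝ e f ^ 2) ≤ 1 := by
  rw [Real.sqrt_le_iff]
  constructor <;> linarith [sq_nonneg (inner ℝ e f : ℝ)]

theorem sq_sqrt : √(1 - inner ℝ e f ^ 2) ^ 2 = 1 - inner ℝ e f ^ 2 :=
  Real.sq_sqrt ((sq_nonneg σ).trans h.sin)

theorem inner_conormal : inner ℝ e (conormal e f) = 0 := by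
  rw [conormal, inner_smul_right, inner_sub_right, inner_smul_right, real_inner_self_eq_norm_sq, h.norm_left]
  ring

theorem norm_conormal : ‖conormal e f‖ = 1 := by
  have h1 := h.pos.trans_le h.le_sqrt
  have h2 : ‖f - (inner ℝ e f : ℝ) • e‖ = √(1 - inner ℝ e f ^ 2) := by
    rw [← sq_eq_sq₀ (norm_nonneg _) h1.le, h.sq_sqrt, @norm_sub_sq_real, norm_smul, h.norm_left, h.norm_right,
      inner_smul_right, real_inner_comm, Real.norm_eq_abs, mul_one, sq_abs]
    ring
  rw [conormal, norm_smul, h2, norm_inv, Real.norm_eq_abs, abs_of_pos h1, inv_mul_cancel₀ h1.ne']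

theorem abs_inner_conormal_le {n : E3} {a : ℝ} (h1 : |inner ℝ n e| ≤ a) (h2 : |inner ℝ n f| ≤ a) :
    |inner ℝ n (conormal e f)| ≤ 2 * a / σ := by
  have ha : 0 ≤ a := (abs_nonneg _).trans h1
  have hσ := h.pos
  have hs := h.le_sqrt
  rw [conormal, inner_smul_right, inner_sub_right, inner_smul_right, abs_mul, abs_inv, abs_of_pos (hσ.trans_le hs),
    inv_mul_eq_div]
  have h3 : |inner ℝ n f - inner ℝ e f * inner ℝ n e| ≤ 2 * a := by
    refine (abs_sub _ _).trans ?_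
    rw [abs_mul]
    have : |inner ℝ e f| * |inner ℝ n e| ≤ 1 * a := by
      gcongr
      exact h.abs_inner_le
    linarith
  gcongr

/-- The coefficients of a direction that points from `e` well into the corner. -/
theorem exists_comb_conormal : ∃ β ∈ Icc 1 (2 * σ⁻¹ + 1), ∃ β' ∈ Icc 1 (2 * σ⁻¹ + 1),
    (σ⁻¹ + 1) • e + conormal e f = β • e + β' • f := by
  have hσ := h.pos
  have hs := h.le_sqrt
  have hs1 := sqrt_le_one (e := e) (f := f)
  have hs0 := hσ.trans_le hs
  have h1 : (√(1 - inner ℝ e f ^ 2))⁻¹ ≤ σ⁻¹ := inv_anti₀ hσ hs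
  have h2 : 1 ≤ (√(1 - inner ℝ e f ^ 2))⁻¹ := (one_le_inv₀ hs0).2 hs1
  have h3 := abs_le.1 h.abs_inner_le
  -- The multiple `σ⁻¹ + 1` of `e` outweighs a negative contribution of the conormal along `e`,
  -- which is at most `σ⁻¹` in size.
  refine ⟨σ⁻¹ + 1 - (√(1 - inner ℝ e f ^ 2))⁻¹ * inner ℝ e f, ⟨?_, ?_⟩, (√(1 - inner ℝ e f ^ 2))⁻¹,
    ⟨h2, by linarith [inv_pos.2 hσ]⟩, ?_⟩
  · nlinarith
  · nlinarith
  · rw [conormal]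
    module

end IsCorner

namespace Triangulation

/-- The conormals of neighbouring triangles at their common edge nearly cancel. -/
theorem exists_conormal_add_le (S : EvolvingSurface) {γ : ℝ} (hγ : 0 < γ) : ∃ C > 0, ∀ 𝒯 : Triangulation S,
    𝒯.Regular γ → ∀ t ∈ Icc 0 S.T, ∀ i j,
    ‖conormal (𝒯.edgeDir t i (j + 1)) (𝒯.edgeDir t i j) + conormal (𝒯.edgeDir t i (j + 1)) (𝒯.edgeDir t i (j + 2))‖ ≤
      C * 𝒯.starDiam t i := by
  obtain ⟨L, hL, hest⟩ := exists_inner_ν_edgeDir_le S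
  obtain ⟨η, hη, δ, hδ, h⟩ := exists_no_fold S hγ (K := 2 * γ + 1) one_pos (by linarith) (by linarith)
  -- The second bound gives `2γL · starDiam ≤ 1/4`, the smallness needed in
  -- `norm_add_le_of_conormals`.
  set δ' := min δ (1 / (8 * γ * L))
  have hδ' : 0 < δ' := by positivity
  refine ⟨16 * γ * L / η + 2 / δ', by positivity, fun 𝒯 hreg t ht i j => ?_⟩
  obtain ⟨hc, -⟩ := corner_data ht hγ hreg i j
  obtain ⟨hc', -⟩ := corner_data ht hγ hreg i (j + 1)
  replace hc := hc.symm
  set e := 𝒯.edgeDir t i (j + 1)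
  set p := conormal e (𝒯.edgeDir t i j)
  set q := conormal e (𝒯.edgeDir t i (j + 2))
  have hp : ‖p‖ = 1 := hc.norm_conormal
  have hq : ‖q‖ = 1 := hc'.norm_conormal
  have hsd : 0 ≤ 𝒯.starDiam t i := (edgeLen_pos ht i 0).le.trans (edgeLen_le_starDiam t i 0)
  rw [add_mul]
  rcases le_or_gt (𝒯.starDiam t i) δ' with hs | hs
  · have hsδ : 𝒯.starDiam t i ≤ δ := hs.trans (min_le_left _ _)
    have hsL : 𝒯.starDiam t i * (8 * γ * L) ≤ 1 := by
      have := hs.trans (min_le_right _ _)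
      rwa [le_div_iff₀ (by positivity)] at this
    have hface : 𝒯.face i j ≠ 𝒯.face i (j + 1) := by
      rw [Ne, 𝒯.face_eq_iff]
      intro h1
      have h2 := Nat.ModEq.add_left_cancel' j (a := 0) (b := 1) h1
      have h3 := 𝒯.three_le i
      rw [Nat.ModEq, Nat.mod_eq_of_lt (by omega), Nat.mod_eq_of_lt (by omega)] at h2
      omega
    -- Shifted by the same multiple of the common edge, the two conormals become directions well
    -- inside the two triangles, so the no-fold bound is a lower bound for `‖p - q‖`.
    obtain ⟨β, hβ, β', hβ', hb⟩ := hc.exists_comb_conormal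
    obtain ⟨ζ, hζ, ζ', hζ', hb'⟩ := hc'.exists_comb_conormal
    rw [inv_inv] at hβ hβ' hb hζ hζ' hb'
    have hel := fun l => (edgeLen_le_starDiam (𝒯 := 𝒯) t i l).trans hsδ
    have h1 := h 𝒯 hreg t ht i j (j + 1) hface (hel _) (hel _) (hel _) (hel _) β' hβ' β hβ ζ hζ ζ' hζ'
    rw [add_comm (β' • _), ← hb, ← hb', add_sub_add_left_eq_sub] at h1
    have hx : 𝒯.x i t ∈ S.Γ t := 𝒯.x_mem i
    have hn := S.ν_unit t ht _ hx
    set n := S.ν (𝒯.x i t) t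
    have hnl := hest 𝒯 t ht i
    have hγ1 := one_le_of_regular ht hγ hreg i
    have hconv : 2 * (L * 𝒯.starDiam t i) / γ⁻¹ = 2 * γ * L * 𝒯.starDiam t i := by
      rw [div_inv_eq_mul]
      ring
    have hnp := hc.abs_inner_conormal_le (hnl _) (hnl _)
    have hnq := hc'.abs_inner_conormal_le (hnl _) (hnl _)
    rw [hconv] at hnp hnq
    have hne : |inner ℝ n e| ≤ 2 * γ * L * 𝒯.starDiam t i := (hnl _).trans (by
      have : 0 ≤ L * 𝒯.starDiam t i := by positivity
      nlinarith)
    have h4 := norm_add_le_of_conormals hc.norm_left hp hq hn hc.inner_conormal hc'.inner_conormal hne hnp hnq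
      (by linarith) hη h1
    have h5 : 8 * (2 * γ * L * 𝒯.starDiam t i) / η = 16 * γ * L / η * 𝒯.starDiam t i := by ring
    have h6 : 0 ≤ 2 / δ' * 𝒯.starDiam t i := by positivity
    linarith
  · have h1 : ‖p + q‖ ≤ 2 := (norm_add_le _ _).trans (by rw [hp, hq]; norm_num)
    have h2 : 2 ≤ 2 / δ' * 𝒯.starDiam t i := by
      rw [div_mul_eq_mul_div, le_div_iff₀ hδ']
      linarith
    have h3 : 0 ≤ 16 * γ * L / η * 𝒯.starDiam t i := by positivity
    linarith

end Triangulation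

theorem sum_range_shift {F : Type*} [AddCommGroup F] {n : ℕ} {g : ℕ → F} (hg : g n = g 0) :
    ∑ j ∈ Finset.range n, g (j + 1) = ∑ j ∈ Finset.range n, g j := by
  have h1 := Finset.sum_range_succ g n
  rw [Finset.sum_range_succ' g n, hg] at h1
  exact add_right_cancel h1

/-- By symmetry the sum points along the bisector; its factor `tan(θ/2)` is the one in `kiteSide`,
which links the side lengths of `V` to conormals. -/
theorem IsCorner.conormal_add_conormal {σ : ℝ} {e f : E3} (h : IsCorner σ e f) :
    conormal e f + conormal f e = (√(1 - inner ℝ e f ^ 2) / (1 + inner ℝ e f)) • (e + f) := by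
  have h1 := h.pos.trans_le h.le_sqrt
  have h2 := h.sq_sqrt
  have h3 := h.one_add_pos
  rw [conormal, conormal, real_inner_comm e f]
  set c : ℝ := inner ℝ e f
  set s := √(1 - c ^ 2)
  have h4 : s / (1 + c) = s⁻¹ * (1 - c) := by
    field_simp
    linear_combination h2
  rw [h4]
  module

namespace Triangulation

variable {S : EvolvingSurface} {𝒯 : Triangulation S} {t : ℝ}

theorem edgeDir_periodic (t : ℝ) (i : Fin 𝒯.M) (j : ℕ) : 𝒯.edgeDir t i (j + 𝒯.Υ i) = 𝒯.edgeDir t i j := by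
  rw [edgeDir_eq, edgeDir_eq, 𝒯.nbr_periodic]

theorem kiteSide_periodic (t : ℝ) (i : Fin 𝒯.M) (j : ℕ) : 𝒯.kiteSide t i (j + 𝒯.Υ i) = 𝒯.kiteSide t i j := by
  rw [kiteSide, kiteSide, add_right_comm, edgeDir_periodic, edgeDir_periodic]

/-- The edge vectors, weighted with the lengths of the sides of `V`, in terms of conormals. -/
theorem sum_side_smul_edgeDir (ht : t ∈ Icc 0 S.T) {γ : ℝ} (hγ : 0 < γ) (hreg : 𝒯.Regular γ) (i : Fin 𝒯.M) :
    ∑ j ∈ Finset.range (𝒯.Υ i), (𝒯.hL t i j + 𝒯.hR t i j) • 𝒯.edgeDir t i j =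
      𝒯.d t i • ∑ j ∈ Finset.range (𝒯.Υ i), (conormal (𝒯.edgeDir t i (j + 1)) (𝒯.edgeDir t i j) +
        conormal (𝒯.edgeDir t i (j + 1)) (𝒯.edgeDir t i (j + 2))) := by
  have hΥ := 𝒯.Υ_pos i
  -- Summation by triangles instead of edges: the left side at `E_{j+1}` lies in `T_j`, so both
  -- sides of a kite meet in one summand. The cyclic shift in `h2` regroups the conormals by edges.
  have h1 : ∑ j ∈ Finset.range (𝒯.Υ i), 𝒯.hL t i j • 𝒯.edgeDir t i j =
      ∑ j ∈ Finset.range (𝒯.Υ i), 𝒯.kiteSide t i j • 𝒯.edgeDir t i (j + 1) := by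
    rw [← sum_range_shift]
    · refine Finset.sum_congr rfl fun j _ => ?_
      rw [hL_eq ht hγ hreg, show j + 1 + 𝒯.Υ i - 1 = j + 𝒯.Υ i by omega, kiteSide_periodic]
    · rw [hL_eq ht hγ hreg, hL_eq ht hγ hreg, show 𝒯.Υ i + 𝒯.Υ i - 1 = 0 + 𝒯.Υ i - 1 + 𝒯.Υ i by omega,
        kiteSide_periodic, ← edgeDir_periodic t i 0, zero_add]
  have h2 : ∑ j ∈ Finset.range (𝒯.Υ i), conormal (𝒯.edgeDir t i (j + 1)) (𝒯.edgeDir t i (j + 2)) =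
      ∑ j ∈ Finset.range (𝒯.Υ i), conormal (𝒯.edgeDir t i j) (𝒯.edgeDir t i (j + 1)) := by
    refine sum_range_shift (g := fun j => conormal (𝒯.edgeDir t i j) (𝒯.edgeDir t i (j + 1))) ?_
    rw [← edgeDir_periodic t i 0, ← edgeDir_periodic t i (0 + 1), zero_add, zero_add, add_comm]
  simp only [add_smul, Finset.sum_add_distrib]
  rw [h1, h2, ← Finset.sum_add_distrib, ← Finset.sum_add_distrib, Finset.smul_sum]
  refine Finset.sum_congr rfl fun j _ => ?_
  obtain ⟨hc, -⟩ := corner_data ht hγ hreg i j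
  rw [hR_eq ht hγ hreg, add_comm (conormal _ _), hc.conormal_add_conormal, smul_smul, kiteSide, mul_div_assoc,
    smul_add, add_comm]

theorem side_nonneg (t : ℝ) (i : Fin 𝒯.M) (j : ℕ) : 0 ≤ 𝒯.hL t i j + 𝒯.hR t i j :=
  add_nonneg Metric.diam_nonneg Metric.diam_nonneg

theorem side_le (ht : t ∈ Icc 0 S.T) {γ : ℝ} (hγ : 0 < γ) (hreg : 𝒯.Regular γ) (i : Fin 𝒯.M) (j : ℕ) :
    𝒯.hL t i j + 𝒯.hR t i j ≤ 4 * γ ^ 2 * 𝒯.d t i := by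
  have hd := d_pos ht hγ hreg i
  have key : ∀ k, 𝒯.kiteSide t i k ≤ 2 * γ ^ 2 * 𝒯.d t i := by
    intro k
    obtain ⟨hc, -⟩ := corner_data ht hγ hreg i k
    have h1 := IsCorner.sqrt_le_one (e := 𝒯.edgeDir t i k) (f := 𝒯.edgeDir t i (k + 1))
    have h2 := hc.le_one_add
    have h3 := hc.one_add_pos
    rw [kiteSide, div_le_iff₀ h3]
    calc _ ≤ 𝒯.d t i * 1 := by gcongr
      _ = 2 * γ ^ 2 * 𝒯.d t i * (γ⁻¹ ^ 2 / 2) := by field_simp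
      _ ≤ _ := by gcongr
  rw [hL_eq ht hγ hreg, hR_eq ht hγ hreg]
  have := key j
  have := key (j + 𝒯.Υ i - 1)
  linarith

/-! ### Consistency of the gradients, the diffusion and the numerical Hamiltonian -/

/-- Difference quotients along edges approximate directional derivatives. -/
theorem exists_edge_quotient (S : EvolvingSurface) : ∃ L > 0, ∀ 𝒯 : Triangulation S, ∀ t ∈ Icc 0 S.T,
    ∀ φ, S.IsC2 φ → ∀ i j,
    |(𝒯.interp φ t (𝒯.nbr i j) - 𝒯.interp φ t i) / 𝒯.edgeLen t i j -
      inner ℝ (S.tangGrad φ (𝒯.x i t) t) (𝒯.edgeDir t i j)| ≤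
      L * (S.supNorm (S.tangGrad φ) + S.supNorm (S.tangHess φ)) * 𝒯.starDiam t i := by
  obtain ⟨L, hL, hest⟩ := S.exists_space_taylor
  refine ⟨L, hL, fun 𝒯 t ht φ hφ i j => ?_⟩
  have hpos := edgeLen_pos ht i j
  have h2 := hest φ hφ t ht _ (𝒯.x_mem i) _ (𝒯.x_mem (𝒯.nbr i j))
  set Q := S.supNorm (S.tangGrad φ) + S.supNorm (S.tangHess φ)
  have hQ : 0 ≤ Q := add_nonneg (S.supNorm_nonneg _) (S.supNorm_nonneg _)
  rw [← dist_smul_dir, inner_smul_right, norm_smul, ← edgeDir_eq, norm_edgeDir ht, mul_one,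
    Real.norm_eq_abs, abs_dist] at h2
  change |𝒯.interp φ t (𝒯.nbr i j) - 𝒯.interp φ t i - 𝒯.edgeLen t i j * _| ≤ L * Q * 𝒯.edgeLen t i j ^ 2 at h2
  have h3 : (𝒯.interp φ t (𝒯.nbr i j) - 𝒯.interp φ t i) / 𝒯.edgeLen t i j -
      inner ℝ (S.tangGrad φ (𝒯.x i t) t) (𝒯.edgeDir t i j) = (𝒯.interp φ t (𝒯.nbr i j) - 𝒯.interp φ t i -
      𝒯.edgeLen t i j * inner ℝ (S.tangGrad φ (𝒯.x i t) t) (𝒯.edgeDir t i j)) / 𝒯.edgeLen t i j := by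
    field_simp
  rw [h3, abs_div, abs_of_pos hpos, div_le_iff₀ hpos]
  refine h2.trans ?_
  rw [sq, ← mul_assoc]
  gcongr
  exact edgeLen_le_starDiam t i j

/-- The gradients of the interpolation approximate the tangential gradient. -/
theorem exists_feGrad_sub_le (S : EvolvingSurface) {γ : ℝ} (hγ : 0 < γ) : ∃ C > 0, ∀ 𝒯 : Triangulation S,
    𝒯.Regular γ → ∀ t ∈ Icc 0 S.T, ∀ φ, S.IsC2 φ → ∀ i j,
    ‖𝒯.feGrad (𝒯.interp φ t) t i j - S.tangGrad φ (𝒯.x i t) t‖ ≤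
      C * (S.supNorm (S.tangGrad φ) + S.supNorm (S.tangHess φ)) * 𝒯.starDiam t i := by
  obtain ⟨L, hL, hest⟩ := exists_edge_quotient S
  obtain ⟨L', hL', hest'⟩ := exists_inner_ν_edgeDir_le S
  refine ⟨2 * γ * L + 4 * γ * L', by positivity, fun 𝒯 hreg t ht φ hφ i j => ?_⟩
  obtain ⟨hc, -⟩ := corner_data ht hγ hreg i j
  obtain ⟨μ, μ', hμ, h1, h2⟩ := exists_feGrad_eq ht hγ hreg (𝒯.interp φ t) i j
  have hx : 𝒯.x i t ∈ S.Γ t := 𝒯.x_mem i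
  have h3 := hest 𝒯 t ht φ hφ i j
  have h4 := hest 𝒯 t ht φ hφ i (j + 1)
  rw [← h1, ← inner_sub_left, hμ] at h3
  rw [← h2, ← inner_sub_left, hμ] at h4
  have hG := hφ.norm_tangGrad_le ht hx
  have h5 := hc.norm_sub_le (S.ν_unit t ht _ hx) (S.tangGrad_normal φ ht hx) (hest' 𝒯 t ht i j)
    (hest' 𝒯 t ht i (j + 1)) h3 h4
  rw [hμ]
  refine h5.trans ?_
  have hsd : 0 ≤ 𝒯.starDiam t i := (edgeLen_pos ht i 0).le.trans (edgeLen_le_starDiam t i 0)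
  have hH : 0 ≤ S.supNorm (S.tangHess φ) := S.supNorm_nonneg _
  set G := S.supNorm (S.tangGrad φ)
  set Hs := S.supNorm (S.tangHess φ)
  rw [div_inv_eq_mul, div_inv_eq_mul]
  calc 2 * (L * (G + Hs) * 𝒯.starDiam t i) * γ + 4 * (L' * 𝒯.starDiam t i) * γ * ‖S.tangGrad φ (𝒯.x i t) t‖
      ≤ 2 * (L * (G + Hs) * 𝒯.starDiam t i) * γ + 4 * (L' * 𝒯.starDiam t i) * γ * (G + Hs) := by
        gcongr
        linarith
    _ = _ := by ring

/-- The artificial diffusion is of first order. -/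
theorem exists_diffusion_le (S : EvolvingSurface) {γ C₁ : ℝ} (hγ : 0 < γ) (hC₁ : 0 < C₁) : ∃ C > 0,
    ∀ 𝒯 : Triangulation S, 𝒯.Regular γ → ∀ t ∈ Icc 0 S.T, ∀ φ, S.IsC2 φ → ∀ i, ∀ ε, 0 ≤ ε →
    ε ≤ C₁ * 𝒯.starDiam t i →
    |ε / area (𝒯.V t i) * ∑ j ∈ Finset.range (𝒯.Υ i), (𝒯.interp φ t (𝒯.nbr i j) - 𝒯.interp φ t i) /
      𝒯.edgeLen t i j * (𝒯.hL t i j + 𝒯.hR t i j)| ≤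
      C * (S.supNorm (S.tangGrad φ) + S.supNorm (S.tangHess φ)) * 𝒯.starDiam t i := by
  obtain ⟨L, hL, hest⟩ := exists_edge_quotient S
  obtain ⟨κ, hκ, harea⟩ := exists_area_kite_lower hγ
  obtain ⟨A, hA, hsd⟩ := exists_starDiam_le S hγ
  obtain ⟨B, hB, hcon⟩ := exists_conormal_add_le S hγ
  refine ⟨C₁ * A / κ * (4 * γ ^ 2 * L + B), by positivity, fun 𝒯 hreg t ht φ hφ i ε hε0 hε => ?_⟩
  have hd := d_pos ht hγ hreg i
  have hΥ : (0 : ℝ) < 𝒯.Υ i := Nat.cast_pos.2 (𝒯.Υ_pos i)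
  -- The factor `Υ i` is kept here and in the bounds of the sums, so that it cancels in the end.
  have hV : 𝒯.Υ i * (κ * 𝒯.d t i ^ 2) ≤ area (𝒯.V t i) := by
    rw [← sum_area_kite ht i]
    have := Finset.card_nsmul_le_sum (Finset.range (𝒯.Υ i)) (fun j => area (𝒯.kite t i j)) (κ * 𝒯.d t i ^ 2)
      fun j _ => harea S 𝒯 hreg t ht i j
    rwa [Finset.card_range, nsmul_eq_mul] at this
  have hx : 𝒯.x i t ∈ S.Γ t := 𝒯.x_mem i
  have hG := hφ.norm_tangGrad_le ht hx
  set s := 𝒯.starDiam t i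
  have hs : 0 ≤ s := (edgeLen_pos ht i 0).le.trans (edgeLen_le_starDiam t i 0)
  have hH : 0 ≤ S.supNorm (S.tangHess φ) := S.supNorm_nonneg _
  set Q := S.supNorm (S.tangGrad φ) + S.supNorm (S.tangHess φ) with hQ
  set G := S.tangGrad φ (𝒯.x i t) t
  have hGQ : ‖G‖ ≤ Q := by linarith
  have hQ0 : 0 ≤ Q := (norm_nonneg _).trans hGQ
  set a : ℕ → ℝ := fun j => (𝒯.interp φ t (𝒯.nbr i j) - 𝒯.interp φ t i) / 𝒯.edgeLen t i j with ha
  -- The first sum has summands of size `starDiam * d` by Taylor. The second is the response to a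
  -- constant gradient and is small only through the cancellation of conormals.
  have hsplit : ∑ j ∈ Finset.range (𝒯.Υ i), a j * (𝒯.hL t i j + 𝒯.hR t i j) =
      ∑ j ∈ Finset.range (𝒯.Υ i), (a j - inner ℝ G (𝒯.edgeDir t i j)) * (𝒯.hL t i j + 𝒯.hR t i j) +
      inner ℝ G (∑ j ∈ Finset.range (𝒯.Υ i), (𝒯.hL t i j + 𝒯.hR t i j) • 𝒯.edgeDir t i j) := by
    rw [inner_sum, ← Finset.sum_add_distrib]
    refine Finset.sum_congr rfl fun j _ => ?_
    rw [inner_smul_right]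
    ring
  have h1 : |∑ j ∈ Finset.range (𝒯.Υ i), (a j - inner ℝ G (𝒯.edgeDir t i j)) * (𝒯.hL t i j + 𝒯.hR t i j)| ≤
      𝒯.Υ i * (L * Q * s * (4 * γ ^ 2 * 𝒯.d t i)) := by
    refine (Finset.abs_sum_le_sum_abs _ _).trans ?_
    have := Finset.sum_le_card_nsmul (Finset.range (𝒯.Υ i))
      (fun j => |(a j - inner ℝ G (𝒯.edgeDir t i j)) * (𝒯.hL t i j + 𝒯.hR t i j)|)
      (L * Q * s * (4 * γ ^ 2 * 𝒯.d t i)) fun j _ => by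
        rw [abs_mul, abs_of_nonneg (side_nonneg t i j)]
        exact mul_le_mul (hest 𝒯 t ht φ hφ i j) (side_le ht hγ hreg i j) (side_nonneg t i j) (by positivity)
    rwa [Finset.card_range, nsmul_eq_mul] at this
  have h2 : |inner ℝ G (∑ j ∈ Finset.range (𝒯.Υ i), (𝒯.hL t i j + 𝒯.hR t i j) • 𝒯.edgeDir t i j)| ≤
      𝒯.Υ i * (Q * (𝒯.d t i * (B * s))) := by
    refine (abs_real_inner_le_norm _ _).trans ?_
    rw [sum_side_smul_edgeDir ht hγ hreg, norm_smul, Real.norm_eq_abs, abs_of_pos hd]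
    have h3 : ‖∑ j ∈ Finset.range (𝒯.Υ i), (conormal (𝒯.edgeDir t i (j + 1)) (𝒯.edgeDir t i j) +
        conormal (𝒯.edgeDir t i (j + 1)) (𝒯.edgeDir t i (j + 2)))‖ ≤ 𝒯.Υ i * (B * s) := by
      refine (norm_sum_le_of_le _ fun j _ => hcon 𝒯 hreg t ht i j).trans ?_
      rw [Finset.sum_const, Finset.card_range, nsmul_eq_mul]
    calc ‖G‖ * (𝒯.d t i * _) ≤ Q * (𝒯.d t i * (𝒯.Υ i * (B * s))) := by gcongr
      _ = _ := by ring
  have hVpos : 0 < area (𝒯.V t i) := lt_of_lt_of_le (by positivity) hV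
  rw [abs_mul, abs_of_nonneg (div_nonneg hε0 hVpos.le)]
  have h3 : |∑ j ∈ Finset.range (𝒯.Υ i), a j * (𝒯.hL t i j + 𝒯.hR t i j)| ≤
      𝒯.Υ i * (𝒯.d t i * ((4 * γ ^ 2 * L + B) * Q * s)) := by
    rw [hsplit]
    refine (abs_add_le _ _).trans ((add_le_add h1 h2).trans (le_of_eq ?_))
    ring
  -- Replacing the star diameter in the bound for `ε` by a multiple of `d` leaves `1/d`, which meets
  -- the factor `d` in `h3`.
  have h4 : ε / area (𝒯.V t i) ≤ C₁ * (A * 𝒯.d t i) / (𝒯.Υ i * (κ * 𝒯.d t i ^ 2)) := by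
    have := hsd 𝒯 hreg t ht i
    gcongr
    exact hε.trans (by gcongr)
  calc _ ≤ C₁ * (A * 𝒯.d t i) / (𝒯.Υ i * (κ * 𝒯.d t i ^ 2)) *
        (𝒯.Υ i * (𝒯.d t i * ((4 * γ ^ 2 * L + B) * Q * s))) := by gcongr
    _ = _ := by field_simp

/-- The numerical Hamiltonian is consistent with the Hamiltonian. -/
theorem exists_numHam_sub_le (S : EvolvingSurface) {γ L₂ C₁ : ℝ} (hγ : 0 < γ) (hL₂ : 0 < L₂) (hC₁ : 0 < C₁) :
    ∃ C > 0, ∀ (H : E3 → ℝ → E3 → ℝ) (L₁ : ℝ), S.IsHamiltonian L₁ L₂ H → ∀ 𝒯 : Triangulation S, 𝒯.Regular γ →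
    ∀ t ∈ Icc 0 S.T, ∀ φ, S.IsC2 φ → ∀ i, ∀ ε, 0 ≤ ε → ε ≤ C₁ * 𝒯.starDiam t i →
    |𝒯.numHam H ε t (𝒯.interp φ t) i - H (𝒯.x i t) t (S.tangGrad φ (𝒯.x i t) t)| ≤
      C * (S.supNorm (S.tangGrad φ) + S.supNorm (S.tangHess φ)) * 𝒯.starDiam t i := by
  obtain ⟨A, hA, hgrad⟩ := exists_feGrad_sub_le S hγ
  obtain ⟨B, hB, hdiff⟩ := exists_diffusion_le S hγ hC₁
  obtain ⟨κ, hκ, harea⟩ := exists_area_kite_lower hγ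
  refine ⟨L₂ * A + B, by positivity, fun H L₁ hH 𝒯 hreg t ht φ hφ i ε hε0 hε => ?_⟩
  have hx : (𝒯.x i t, t) ∈ S.spaceTime := ⟨ht, 𝒯.x_mem i⟩
  have hd := d_pos ht hγ hreg i
  have hkite : ∀ j, 0 < area (𝒯.kite t i j) := fun j => lt_of_lt_of_le (by positivity) (harea S 𝒯 hreg t ht i j)
  have hV : 0 < area (𝒯.V t i) := by
    rw [← sum_area_kite ht i]
    exact Finset.sum_pos (fun j _ => hkite j) ⟨0, Finset.mem_range.2 (𝒯.Υ_pos i)⟩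
  set w : ℕ → ℝ := fun j => area (𝒯.V t i ∩ 𝒯.T t i j) / area (𝒯.V t i) with hw
  have hw0 : ∀ j, 0 ≤ w j := fun j => div_nonneg ENNReal.toReal_nonneg hV.le
  -- The pieces `V ∩ T_j` are the kites, which fill `V` with overlaps of zero area.
  have hw1 : ∑ j ∈ Finset.range (𝒯.Υ i), w j = 1 := by
    simp only [hw, V_inter_T ht hγ hreg]
    rw [← Finset.sum_div, sum_area_kite ht, div_self hV.ne']
  set Q := S.supNorm (S.tangGrad φ) + S.supNorm (S.tangHess φ)
  set s := 𝒯.starDiam t i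
  set G := S.tangGrad φ (𝒯.x i t) t
  have h1 : |∑ j ∈ Finset.range (𝒯.Υ i), w j * H (𝒯.x i t) t (𝒯.feGrad (𝒯.interp φ t) t i j) - H (𝒯.x i t) t G| ≤
      L₂ * (A * Q * s) := by
    have h2 : ∑ j ∈ Finset.range (𝒯.Υ i), w j * H (𝒯.x i t) t (𝒯.feGrad (𝒯.interp φ t) t i j) - H (𝒯.x i t) t G =
        ∑ j ∈ Finset.range (𝒯.Υ i), w j * (H (𝒯.x i t) t (𝒯.feGrad (𝒯.interp φ t) t i j) - H (𝒯.x i t) t G) := by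
      simp only [mul_sub, Finset.sum_sub_distrib, ← Finset.sum_mul, hw1, one_mul]
    rw [h2]
    calc _ ≤ ∑ j ∈ Finset.range (𝒯.Υ i), w j * (L₂ * (A * Q * s)) := by
          refine (Finset.abs_sum_le_sum_abs _ _).trans (Finset.sum_le_sum fun j _ => ?_)
          rw [abs_mul, abs_of_nonneg (hw0 j)]
          refine mul_le_mul_of_nonneg_left ((hH.lip_p _ _ hx _ _).trans ?_) (hw0 j)
          exact mul_le_mul_of_nonneg_left (hgrad 𝒯 hreg t ht φ hφ i j) hL₂.le
      _ = _ := by rw [← Finset.sum_mul, hw1, one_mul]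
  have h2 := hdiff 𝒯 hreg t ht φ hφ i ε hε0 hε
  rw [numHam, sub_right_comm]
  refine (abs_sub _ _).trans ((add_le_add h1 h2).trans (le_of_eq ?_))
  ring

theorem IsPartition.mem_Icc {T : ℝ} {N : ℕ} {t : ℕ → ℝ} (h : IsPartition T N t) {n : ℕ} (hn : n ≤ N) :
    t n ∈ Icc 0 T := by
  have hmono : ∀ m k, m ≤ k → k ≤ N → t m ≤ t k := by
    intro m k hmk
    induction k, hmk using Nat.le_induction with
    | base => exact fun _ => le_rfl
    | succ k hk ih => exact fun hkN => (ih (by omega)).trans (h.lt k (by omega)).le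
  refine ⟨?_, ?_⟩
  · rw [← h.zero]
    exact hmono 0 n n.zero_le hn
  · rw [← h.last]
    exact hmono n N hn le_rfl

end Triangulation

end SurfaceHJ

theorem lemma4p2 (S : EvolvingSurface) (γ L₂ C₀ C₁ C₂ : ℝ)
    (hγ : 0 < γ) (hL₂ : 0 < L₂) (hC₀ : 0 < C₀) (hC₁ : 0 < C₁) (hC₂ : 0 < C₂) :
    ∃ C₃ : ℝ, 0 < C₃ ∧
      ∀ (H : E3 → ℝ → E3 → ℝ) (L₁ : ℝ), 0 < L₁ → S.IsHamiltonian L₁ L₂ H →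
      ∀ (𝒯 : Triangulation S), 𝒯.Regular γ →
      ∀ (N : ℕ) (t : ℕ → ℝ), Triangulation.IsPartition S.T N t →
      ∀ ε : ℕ → Fin 𝒯.M → ℝ, 𝒯.StepCondition C₀ C₁ C₂ N t ε →
      ∀ φ : E3 → ℝ → ℝ, S.IsC2 φ →
      ∀ n < N, ∀ i : Fin 𝒯.M,
        |(𝒯.interp φ (t (n + 1)) i -
              𝒯.step H (ε n) (t n) (t (n + 1) - t n) (𝒯.interp φ (t n)) i) / (t (n + 1) - t n) -
            (S.matDeriv φ (𝒯.x i (t n)) (t n) +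
              H (𝒯.x i (t n)) (t n) (S.tangGrad φ (𝒯.x i (t n)) (t n)))| ≤
          C₃ * 𝒯.meshSize *
            (S.supNorm (S.tangGrad φ) + S.supNorm (S.tangHess φ) +
              S.supNorm (S.matDeriv (S.matDeriv φ))) := by
  obtain ⟨C, hC, hnum⟩ := Triangulation.exists_numHam_sub_le S hγ hL₂ hC₁
  refine ⟨C + C₂, by positivity, ?_⟩
  intro H L₁ _ hH 𝒯 hreg N t hpart ε hstep φ hφ n hn i
  have ht := hpart.mem_Icc hn.le
  have ht' := hpart.mem_Icc hn
  have hlt := hpart.lt n hn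
  have hτ : 0 < t (n + 1) - t n := sub_pos.2 hlt
  have hsd := Triangulation.starDiam_le_meshSize (𝒯 := 𝒯) ht i
  have hℓ := Triangulation.edgeLen_le_starDiam (𝒯 := 𝒯) (t n) i 0
  have hs : 0 ≤ 𝒯.starDiam (t n) i := (Triangulation.edgeLen_pos ht i 0).le.trans hℓ
  -- The lower constraint on `ε` supplies its nonnegativity, the upper one its order `h`.
  have h1 := hnum H L₁ hH 𝒯 hreg (t n) ht φ hφ i (ε n i) ((mul_nonneg hC₀.le hs).trans (hstep.lower n hn i))
    (hstep.upper n hn i)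
  have h2 := hφ.abs_time_taylor_le (𝒯.x₀_mem i) ht ht' hlt.le
  have hG := S.supNorm_nonneg (S.tangGrad φ)
  have hHs := S.supNorm_nonneg (S.tangHess φ)
  have hM := S.supNorm_nonneg (S.matDeriv (S.matDeriv φ))
  set τ := t (n + 1) - t n
  change |𝒯.interp φ (t (n + 1)) i - 𝒯.interp φ (t n) i - S.matDeriv φ (𝒯.x i (t n)) (t n) * τ| ≤ _ at h2
  set G := S.supNorm (S.tangGrad φ)
  set Hs := S.supNorm (S.tangHess φ)
  set D := S.supNorm (S.matDeriv (S.matDeriv φ))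
  set h := 𝒯.meshSize
  have hh : 0 ≤ h := hs.trans hsd
  -- The Taylor remainder is quadratic in `τ`; division by `τ` leaves one factor, which the time
  -- step constraint bounds by `C₂ h`.
  have h3 : |(𝒯.interp φ (t (n + 1)) i - 𝒯.interp φ (t n) i - S.matDeriv φ (𝒯.x i (t n)) (t n) * τ) / τ| ≤
      C₂ * h * D := by
    rw [abs_div, abs_of_pos hτ, div_le_iff₀ hτ]
    have : τ ≤ C₂ * h := (hstep.time n hn i 0).trans (mul_le_mul_of_nonneg_left (hℓ.trans hsd) hC₂.le)
    calc _ ≤ D * τ ^ 2 := h2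
      _ = τ * D * τ := by ring
      _ ≤ C₂ * h * D * τ := by gcongr
  have hsplit : (𝒯.interp φ (t (n + 1)) i - 𝒯.step H (ε n) (t n) τ (𝒯.interp φ (t n)) i) / τ -
      (S.matDeriv φ (𝒯.x i (t n)) (t n) + H (𝒯.x i (t n)) (t n) (S.tangGrad φ (𝒯.x i (t n)) (t n))) =
      (𝒯.interp φ (t (n + 1)) i - 𝒯.interp φ (t n) i - S.matDeriv φ (𝒯.x i (t n)) (t n) * τ) / τ +
      (𝒯.numHam H (ε n i) (t n) (𝒯.interp φ (t n)) i -
        H (𝒯.x i (t n)) (t n) (S.tangGrad φ (𝒯.x i (t n)) (t n))) := by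
    rw [Triangulation.step]
    field_simp
    ring
  rw [hsplit]
  calc _ ≤ C₂ * h * D + C * (G + Hs) * 𝒯.starDiam (t n) i := (abs_add_le _ _).trans (add_le_add h3 h1)
    _ ≤ C₂ * h * D + C * (G + Hs) * h := by gcongr
    _ ≤ C₂ * h * D + C * (G + Hs) * h + (C * h * D + C₂ * h * (G + Hs)) := le_add_of_nonneg_right (by positivity)
    _ = (C + C₂) * h * (G + Hs + D) := by ring
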